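/- **Setting.** Write $\mathsf e[x]=e^{2\pi i x}$. Let $K\subset\mathbb C$ be an imaginary quadratic field of discriminant $-D$ with ring of integers $\mathfrak o_K$, let $\mathfrak d_K=\frac{i}{\sqrt D}\mathfrak o_K$ be its inverse different and $[\mathfrak d_K]=\mathfrak d_K/\mathfrak o_K$, let $\chi=\chi_K$ be the quadratic character of $K$, and let $k$ be an integer divisible by $|\mathfrak o_K^\times|$. For $\ell\in\mathbb Z$ put $$a_D(\ell)=\#\{u\in[\mathfrak d_K] : D|u|^2\equiv-\ell \bmod D\}.$$ *Jacobi forms.* $\mathfrak J_k^*(N)$ is the space of special Hermitian Jacobi forms of weight $k$, index $1$ and level $N$, that is, of holomorphic $\varphi:\mathfrak H\times\mathbb C^2\to\mathbb C$ such that 1. $\varphi(\tau,z,w)=(c\tau+d)^{-k}\,\mathsf e\!\left[-\frac{czw}{c\tau+d}\right]\varphi\!\left(\frac{a\tau+b}{c\tau+d},\frac{\epsilon z}{c\tau+d},\frac{\bar\epsilon w}{c\tau+d}\right)$ for all $\epsilon\in\mathfrak o_K^\times$ and $\begin{pmatrix}a&b\\c&d\end{pmatrix}\in\Gamma_0(N)$;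 2. $\varphi(\tau,z,w)=\mathsf e[|\lambda|^2\tau+\bar\lambda z+\lambda w]\,\varphi(\tau,z+\lambda\tau+\mu,w+\bar\lambda\tau+\bar\mu)$ for all $\lambda,\mu\in\mathfrak o_K$; 3. for every $M=\begin{pmatrix}a&b\\c&d\end{pmatrix}\in SL_2(\mathbb Z)$ the function given by the right-hand side of (1) with $\epsilon=1$ has an expansion $\sum c^M_\varphi(\ell,t)\,\mathsf e[\frac{\ell}{\nu}\tau+\bar tz+tw]$ over $\ell\in\mathbb Z_{\ge0}$, $t\in\mathfrak d_K$ with $\nu|t|^2\le\ell$, for some positive integer $\nu=\nu(M)$, where $\nu(I_2)=1$; 4. the coefficients $c_\varphi(\ell,t)=c_\varphi^{I_2}(\ell,t)$ depend only on $\ell-|t|^2$. For $\varphi\in\mathfrak J_k^*(N)$ let $\alpha^*_\varphi(n)$ $(n\ge0)$ be the common value of $c_\varphi(\ell,t)$ over all $(\ell,t)$ with $D(\ell-|t|^2)=n$ (and $0$ if there are none), and for $u\in[\mathfrak d_K]$ let $$f_u(\tau)=\sum_{\ell\ge0,\ \ell\equiv-D|u|^2\bmod D}\alpha^*_\varphi(\ell)\,\mathsf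 e\!\left[\tfrac{\ell\tau}{D}\right],\qquad \vartheta_u(\tau,z,w)=\sum_{a\in u+\mathfrak o_K}\mathsf e[|a|^2\tau+\bar az+aw].$$ *Plus forms.* $\mathfrak M_{k-1}^+(DN,\chi)$ is the space of elliptic modular forms $g=\sum_{\ell\ge0}a_\ell(g)\,\mathsf e[\ell\tau]$ of weight $k-1$, level $\Gamma_0(DN)$ and nebentypus $\chi$ such that $a_\ell(g)=0$ whenever $a_D(\ell)=0$. For an integral matrix of positive determinant, $\left(g|_{\kappa}\begin{pmatrix}a&b\\c&d\end{pmatrix}\right)(\tau)=(c\tau+d)^{-\kappa}g\!\left(\frac{a\tau+b}{c\tau+d}\right)$. **Proposition 2.5.** Suppose that $\gcd(D,N)=1$, let $y$ be an integer with $Ny\equiv-1 \bmod D$, and let $$W_D=\begin{pmatrix}1&0\\N&1\end{pmatrix}\begin{pmatrix}D&y\\0&1\end{pmatrix}.$$ Every $\varphi\in\mathfrak J_k^*(N)$ has the theta decomposition $\varphi=\sum_{u\in[\mathfrak d_K]}f_u\vartheta_u$, and $\varphi\mapsto f:=f_0|_{k-1}W_D$ is an injective map from $\mathfrak J_k^*(N)$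 to $\mathfrak M_{k-1}^+(DN,\chi)$. The Fourier coefficients of $f$ are $$a_\ell(f)=i\,\frac{a_D(\ell)}{\sqrt D}\,\chi(N)\,\alpha^*_\varphi(\ell)\qquad(\ell\ge0).$$ -/

import Mathlib

open UpperHalfPlane NumberField
open scoped MatrixGroups ModularForm Manifold ComplexConjugate

noncomputable section

namespace HermitianJacobi

/-- `e[x] = exp(2πix)`. -/
def e (x : ℂ) : ℂ := Complex.exp (2 * (Real.pi : ℂ) * Complex.I * x)

/-! ### The quadratic character of the imaginary quadratic field of discriminant `-D` -/

/-- The local factor `χ_p` (for `p ∣ D`) of the quadratic character of discriminant `-D`: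
the Legendre symbol for odd `p`; for `p = 2` it is `(-8/·)` if `8 ∣ D`, `D/8 ≡ 1 mod 4`,
`(8/·)` if `8 ∣ D`, `D/8 ≡ 3 mod 4`, and `(-4/·)` if `4 ∣ D`, `8 ∤ D`. -/
def chiP (D p : ℕ) (n : ℤ) : ℤ :=
  if p = 2 then
    if 8 ∣ D then
      if D / 8 % 4 = 1 then ZMod.χ₈' (n : ZMod 8) else ZMod.χ₈ (n : ZMod 8)
    else ZMod.χ₄ (n : ZMod 4)
  else jacobiSym n p

/-- The quadratic character `χ_K = ∏_{p ∣ D} χ_p` of the imaginary quadratic field `K` of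
discriminant `-D`. -/
def chi (D : ℕ) (n : ℤ) : ℤ := ∏ p ∈ D.primeFactors, chiP D p n

/-! ### The ring of integers and the inverse different, as lattices in `ℂ` -/

section Lattice

variable {K : Type*} [Field K] (ι : K →+* ℂ) (D : ℕ)

/-- The ring of integers of `K`, inside `ℂ` through the embedding `ι`. -/
def intC : AddSubgroup ℂ := (ι.comp (algebraMap (𝓞 K) K)).range.toAddSubgroup

/-- The inverse different `(i/√D) 𝓞_K` of `K`, inside `ℂ`. -/
def invDiff : AddSubgroup ℂ :=
  (intC ι).map (AddMonoidHom.mulLeft (Complex.I / ((Real.sqrt D : ℝ) : ℂ)))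

/-- The finite group `[𝔡_K] = (i/√D) 𝓞_K / 𝓞_K`. -/
abbrev discGroup : Type := invDiff ι D ⧸ (intC ι).addSubgroupOf (invDiff ι D)

/-- `D |u|² ≡ -ℓ mod D` for the class `q` of `u`. (`D|u|²` is an integer whose residue
modulo `D` depends only on the class of `u`.) -/
def NormCong (q : discGroup ι D) (ℓ : ℤ) : Prop :=
  ∃ u : invDiff ι D, (QuotientAddGroup.mk u : discGroup ι D) = q ∧
    ∃ n : ℤ, (D : ℝ) * Complex.normSq u + ℓ = D * n

/-- `a_D(ℓ) = #{u ∈ [𝔡_K] : D|u|² ≡ -ℓ mod D}`. -/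
def aD (ℓ : ℤ) : ℕ := Nat.card {q : discGroup ι D // NormCong ι D q ℓ}

/-! ### Hermitian Jacobi forms -/

/-- The action `φ|_{k,m}[εA]` for `A ∈ SL₂(ℤ)` and a unit `ε`. -/
def slashMat (k : ℤ) (m : ℕ) (ε : ℂ) (A : SL(2, ℤ)) (φ : ℍ → ℂ → ℂ → ℂ) : ℍ → ℂ → ℂ → ℂ :=
  fun τ z w =>
    ((A 1 0 : ℂ) * τ + A 1 1) ^ (-k) * e (-(m * ((A 1 0 : ℂ) * z * w / (A 1 0 * τ + A 1 1)))) *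
      φ (A • τ) (ε * z / (A 1 0 * τ + A 1 1)) (conj ε * w / (A 1 0 * τ + A 1 1))

/-- The action `φ|_{k,m}[lam, mu]` (it does not depend on `k`). -/
def slashHeis (m : ℕ) (lam mu : ℂ) (φ : ℍ → ℂ → ℂ → ℂ) : ℍ → ℂ → ℂ → ℂ :=
  fun τ z w => e (m * (lam * conj lam * τ + conj lam * z + lam * w)) *
    φ τ (z + lam * τ + mu) (w + conj lam * τ + conj mu)

/-- `ψ(τ,z,w) = ∑ c(ℓ,t) e[(ℓ/ν)τ + t̄ z + t w]`, the sum being over `ℓ ∈ ℤ_{≥0}` and `t` in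
the inverse different with `ν|t|² ≤ ℓm`. -/
structure IsFourierExpansion (m ν : ℕ) (c : ℕ → invDiff ι D → ℂ) (ψ : ℍ → ℂ → ℂ → ℂ) : Prop where
  support : ∀ ℓ t, c ℓ t ≠ 0 → (ν : ℝ) * Complex.normSq t ≤ ℓ * m
  hasSum : ∀ (τ : ℍ) (z w : ℂ),
    HasSum (fun p : ℕ × invDiff ι D =>
      c p.1 p.2 * e ((p.1 : ℂ) / ν * τ + conj (p.2 : ℂ) * z + (p.2 : ℂ) * w)) (ψ τ z w)

/-- Hermitian Jacobi forms of weight `k`, index `m` and level `N`. -/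
structure IsJacobiForm (k : ℤ) (m N : ℕ) (φ : ℍ → ℂ → ℂ → ℂ) : Prop where
  holo : DifferentiableOn ℂ (fun p : ℂ × ℂ × ℂ => φ (ofComplex p.1) p.2.1 p.2.2)
    {p | 0 < p.1.im}
  slash_mat : ∀ (ε : (𝓞 K)ˣ), ∀ A ∈ CongruenceSubgroup.Gamma0 N,
    slashMat k m (ι (ε : 𝓞 K)) A φ = φ
  slash_heis : ∀ lam ∈ intC ι, ∀ mu ∈ intC ι, slashHeis m lam mu φ = φ
  fourier : ∀ A : SL(2, ℤ), ∃ ν : ℕ, 0 < ν ∧ (A = 1 → ν = 1) ∧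
    ∃ c, IsFourierExpansion ι D m ν c (slashMat k m 1 A φ)

open Classical in
/-- The Fourier coefficients `c_φ(ℓ,t)` (which are unique) of a Hermitian Jacobi form of
index `m`; junk value `0` if `φ` has no Fourier expansion. -/
def fourierCoeff (m : ℕ) (φ : ℍ → ℂ → ℂ → ℂ) : ℕ → invDiff ι D → ℂ :=
  if h : ∃ c, IsFourierExpansion ι D m 1 c φ then h.choose else 0

/-- The space of special Jacobi forms of weight `k`, index `1`, level `N`: those for which
`c_φ(ℓ,t)` depends only on `ℓ - |t|²`. -/
def specialJacobi (k : ℤ) (N : ℕ) : Set (ℍ → ℂ → ℂ → ℂ) :=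
  {φ | IsJacobiForm ι D k 1 N φ ∧ ∀ (ℓ ℓ' : ℕ) (t t' : invDiff ι D),
    (ℓ : ℝ) - Complex.normSq t = ℓ' - Complex.normSq t' →
      fourierCoeff ι D 1 φ ℓ t = fourierCoeff ι D 1 φ ℓ' t'}

open Classical in
/-- `α*_φ(n)`: the common value of `c_φ(ℓ,t)` over all `(ℓ,t)` with `D(ℓ - |t|²) = n`
(and `0` if there are no such `(ℓ,t)`). -/
def alphaStar (φ : ℍ → ℂ → ℂ → ℂ) (n : ℕ) : ℂ :=
  if h : ∃ p : ℕ × invDiff ι D, (D : ℝ) * (p.1 - Complex.normSq p.2) = n then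
    fourierCoeff ι D 1 φ h.choose.1 h.choose.2 else 0

/-! ### Theta decomposition -/

/-- `θ_q(τ,z,w) = ∑_{a ∈ q} e[|a|²τ + ā z + a w]` for a class `q = u + 𝓞_K`. -/
def theta (q : discGroup ι D) (τ : ℍ) (z w : ℂ) : ℂ :=
  ∑' a : {a : invDiff ι D // (QuotientAddGroup.mk a : discGroup ι D) = q},
    e ((a : ℂ) * conj (a : ℂ) * τ + conj (a : ℂ) * z + (a : ℂ) * w)

open Classical in
/-- The theta component `f_u(τ) = ∑_{ℓ ≥ 0, ℓ ≡ -D|u|² mod D} α*_φ(ℓ) e[ℓτ/D]` of `φ`. -/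
def thetaComponent (φ : ℍ → ℂ → ℂ → ℂ) (q : discGroup ι D) (τ : ℍ) : ℂ :=
  ∑' ℓ : ℕ, if NormCong ι D q ℓ then alphaStar ι D φ ℓ * e (ℓ * τ / D) else 0

end Lattice

/-! ### Elliptic modular forms -/

/-- Modular forms of weight `κ` for `Γ₀(M)` with nebentypus `ψ`: holomorphic on the upper
half plane, `g|_κ γ = ψ(d) g` for `γ = (a b; c d) ∈ Γ₀(M)`, and holomorphic at all cusps. -/
def modularForms (κ : ℤ) (M : ℕ) (ψ : ℤ → ℂ) : Set (ℍ → ℂ) :=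
  {g | MDiff g ∧
    (∀ γ ∈ CongruenceSubgroup.Gamma0 M, g ∣[κ] γ = ψ (γ 1 1) • g) ∧
    ∀ γ : SL(2, ℤ), IsBoundedAtImInfty (g ∣[κ] γ)}

/-- `a_ℓ(g)`: the coefficient of `e[ℓτ]` in the Fourier expansion of `g`. -/
def ellCoeff (g : ℍ → ℂ) (ℓ : ℕ) : ℂ := (qExpansion 1 g).coeff ℓ

/-- The plus space of weight `κ` and level `DN`: modular forms of weight `κ`, level `DN` and
nebentypus `χ_K` such that `a_ℓ(g) = 0` whenever `a_D(ℓ) = 0`. -/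
def plusForms {K : Type*} [Field K] (ι : K →+* ℂ) (D : ℕ) (κ : ℤ) (N : ℕ) : Set (ℍ → ℂ) :=
  {g | g ∈ modularForms κ (D * N) (fun n => (chi D n : ℂ)) ∧
    ∀ ℓ : ℕ, aD ι D ℓ = 0 → ellCoeff g ℓ = 0}

/-- `(g|_κ M)(τ) = (cτ+d)^{-κ} g((aτ+b)/(cτ+d))` for an integral matrix `M = (a b; c d)` of
positive determinant, without a determinant factor. (For positive determinant `(aτ+b)/(cτ+d)`
lies in the upper half plane, where `ofComplex` is the identity.) -/
def slashInt (κ : ℤ) (M : Matrix (Fin 2) (Fin 2) ℤ) (g : ℍ → ℂ) : ℍ → ℂ :=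
  fun τ => ((M 1 0 : ℂ) * τ + M 1 1) ^ (-κ) *
    g (ofComplex (((M 0 0 : ℂ) * τ + M 0 1) / ((M 1 0 : ℂ) * τ + M 1 1)))

/-- `W_D = (1 0; N 1) (D y; 0 1)`. -/
def matW (D N : ℕ) (y : ℤ) : Matrix (Fin 2) (Fin 2) ℤ :=
  !![1, 0; (N : ℤ), 1] * !![(D : ℤ), y; 0, 1]

/-- The map `φ ↦ f₀|_{k-1} W_D`. -/
def toElliptic {K : Type*} [Field K] (ι : K →+* ℂ) (D : ℕ) (k : ℤ) (N : ℕ) (y : ℤ)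
    (φ : ℍ → ℂ → ℂ → ℂ) : ℍ → ℂ :=
  slashInt (k - 1) (matW D N y) (thetaComponent ι D φ 0)

end HermitianJacobi

end

/-! Embedded in `ℂ`, the ring of integers is `ℤ + ℤω` with `ω = (D + i√D)/2` (`isQuadLattice`), and
the inverse different is its trace dual. The theta functions attached to the classes of the quotient
span a unitary representation of the modular group in weight 1. `T` acts diagonally by `e[|u|²]`,
and `S` acts by a finite Fourier transform, which is Poisson summation (`poisson_oC`). Unitarity of
the `S`-matrix is read off from `S² = -1`, so every matrix of the representation is unitary
(`exists_isThetaMatrix`).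

Because the coefficients of a special form depend only on `ℓ - |t|²`, summing its Fourier expansion
class by class gives the theta decomposition. The theta functions are linearly independent at each
fixed `τ` (`theta_independent`), so invariance of `φ` under `Γ₀(N)` makes the vector of components
`f_u` transform by the conjugate matrices. The growth condition on `φ` at a cusp likewise becomes
boundedness of the `f_u` there.

Two explicit rows of the representation are needed. For `A ∈ Γ₀(D)` the function `θ₀` is an
eigenfunction (`row_zero_eq_zero`), since it is fixed by translations from the inverse different and
no other class has this symmetry. Its eigenvalue is `χ(d)` (`row_zero_eq_chi`): Dirichlet's theorem
reduces to `d = p` an odd prime, the behaviour of `θ₀` near a rational number of denominator `p` is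
governed by a Gauss sum of the norm form, and quadratic reciprocity (`chi_prime`) identifies the
result. For `(1 0; N 1)`, factor it as `A S T^(-y)` with `A ∈ Γ₀(D)` (`row_zero_lower`).

Consequently `f` is `χ(N) i/√D` times the sum over `v` of `e[y|v|²] f_v(Dτ + y)`. In the term of
index `n` the phase is `e[y(|v|² + n/D)] = 1`, so all classes with `D|v|² ≡ -n` contribute equally;
this yields the factor `a_D(n)` (`toElliptic_hasSum`). The formula gives the plus condition,
holomorphy and injectivity, because `α*` vanishes wherever `a_D` does and `χ(N) ≠ 0`. The nebentypus
follows by conjugating `Γ₀(DN)` through `W_D` (`toElliptic_slash`), and the behaviour at cusps from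
a Hermite factorization (`isBounded_ellSlash_dilate`). -/

noncomputable section

namespace HermitianJacobi

/-! ### The ring of integers as an explicit lattice -/

section RingOfIntegers

variable {K : Type*} [Field K]

/-- The generator `(D + i√D)/2` of the ring of integers. -/
def omg (D : ℕ) : ℂ := ((D : ℂ) + Complex.I * (Real.sqrt D : ℝ)) / 2

lemma omg_re (D : ℕ) : (omg D).re = D / 2 := by simp [omg]

lemma omg_im (D : ℕ) : (omg D).im = Real.sqrt D / 2 := by simp [omg]

/-- An explicit description of `𝓞_K ⊂ ℂ`, and the fundamentality of its discriminant. -/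
structure IsQuadLattice (ι : K →+* ℂ) (D : ℕ) : Prop where
  pos : 0 < D
  mod_four : D % 4 = 0 ∨ D % 4 = 3
  mem_iff : ∀ a : ℂ, a ∈ intC ι ↔ ∃ m n : ℤ, a = m + n * omg D
  fundamental : ∀ f E : ℕ, D = f ^ 2 * E → (E % 4 = 0 ∨ E % 4 = 3) → f = 1

lemma mem_intC {ι : K →+* ℂ} {a : ℂ} : a ∈ intC ι ↔ ∃ x : 𝓞 K, ι x = a := by
  simp only [intC]
  constructor
  · rintro ⟨x, hx⟩; exact ⟨x, hx⟩
  · rintro ⟨x, hx⟩; exact ⟨x, hx⟩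

lemma mem_intC_of_isIntegral_of_range {ι : K →+* ℂ} (a : K) (ha : IsIntegral ℤ a) :
    ι a ∈ intC ι := mem_intC.2 ⟨⟨a, ha⟩, rfl⟩

variable [NumberField K]

/-- The second complex embedding of a quadratic field. -/
lemma exists_trace_norm_embeddings (hquad : Module.finrank ℚ K = 2) (ι : K →+* ℂ) :
    ∃ ι' : K →+* ℂ, ι' ≠ ι ∧ (∀ σ : K →+* ℂ, σ = ι ∨ σ = ι') ∧
      (∀ a : K, ((Algebra.trace ℚ K a : ℚ) : ℂ) = ι a + ι' a) ∧
      (∀ a : K, ((Algebra.norm ℚ a : ℚ) : ℂ) = ι a * ι' a) := by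
  classical
  have hcard : Fintype.card (K →ₐ[ℚ] ℂ) = 2 := by rw [AlgHom.card, hquad]
  set f : K →ₐ[ℚ] ℂ := ι.toRatAlgHom with hf
  have h1 : (Finset.univ.erase f).card = 1 := by
    rw [Finset.card_erase_of_mem (Finset.mem_univ f), Finset.card_univ, hcard]
  obtain ⟨g, hg⟩ := Finset.card_eq_one.1 h1
  have hgf : g ≠ f := by
    have : g ∈ Finset.univ.erase f := by rw [hg]; simp
    exact (Finset.mem_erase.1 this).1
  have huniv : (Finset.univ : Finset (K →ₐ[ℚ] ℂ)) = {f, g} := by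
    rw [← Finset.insert_erase (Finset.mem_univ f), hg]
  refine ⟨g.toRingHom, ?_, ?_, ?_, ?_⟩
  · intro h
    apply hgf
    ext x
    exact congrArg (fun s : K →+* ℂ => s x) h
  · intro σ
    have : σ.toRatAlgHom ∈ (Finset.univ : Finset (K →ₐ[ℚ] ℂ)) := Finset.mem_univ _
    rw [huniv, Finset.mem_insert, Finset.mem_singleton] at this
    rcases this with h | h
    · left; ext x; exact congrArg (fun s : K →ₐ[ℚ] ℂ => s x) h
    · right; ext x; exact congrArg (fun s : K →ₐ[ℚ] ℂ => s x) h
  · intro a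
    have := trace_eq_sum_embeddings (K := ℚ) ℂ (x := a)
    rw [huniv, Finset.sum_pair hgf.symm] at this
    simpa [hf] using this
  · intro a
    have := Algebra.norm_eq_prod_embeddings ℚ ℂ a
    rw [huniv, Finset.prod_pair hgf.symm] at this
    simpa [hf] using this

/-- The discriminant fixes the covolume of an integral basis at `√D/2`. With integrality of traces
and norms this places the lattice inside `ℤ + ℤω`, and equal covolumes give equality. Fundamentality
holds because a factorization `D = f²E` with `-E` a discriminant would make `(E + √-E)/2` an integer
of `K` outside this lattice unless `f = 1`. -/
lemma isQuadLattice (hquad : Module.finrank ℚ K = 2) (ι : K →+* ℂ) (D : ℕ)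
    (hdisc : NumberField.discr K = -(D : ℤ)) : IsQuadLattice ι D := by
  classical
  obtain ⟨ι', hne, hall, htr, hnm⟩ := exists_trace_norm_embeddings hquad ι
  have hD : 0 < D := by
    rcases Nat.eq_zero_or_pos D with h | h
    · exact absurd (by rw [hdisc, h]; simp) (NumberField.discr_ne_zero K)
    · exact h
  have hDR : (0 : ℝ) < D := by exact_mod_cast hD
  have hs : 0 < Real.sqrt D := Real.sqrt_pos.2 hDR
  have hss : Real.sqrt D ^ 2 = D := Real.sq_sqrt hDR.le
  have hrank : Module.finrank ℤ (𝓞 K) = 2 := by rw [RingOfIntegers.rank, hquad]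
  let b : Module.Basis (Fin 2) ℤ (𝓞 K) := Module.finBasisOfFinrankEq ℤ (𝓞 K) hrank
  set α := ι (b 0 : 𝓞 K) with hα
  set β := ι (b 1 : 𝓞 K) with hβ
  have htrZ : ∀ x : 𝓞 K, ((Algebra.trace ℤ (𝓞 K) x : ℤ) : ℂ) = ι x + ι' x := by
    intro x
    rw [← htr, ← Algebra.coe_trace_int]; simp
  have hnmZ : ∀ x : 𝓞 K, ((Algebra.norm ℤ x : ℤ) : ℂ) = ι x * ι' x := by
    intro x
    rw [← hnm, ← Algebra.coe_norm_int]; simp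
  have hdet : (ι (b 0) * ι' (b 1) - ι' (b 0) * ι (b 1)) ^ 2 = -(D : ℂ) := by
    have h := NumberField.discr_eq_discr K b
    rw [hdisc, Algebra.discr_def, Matrix.det_fin_two] at h
    simp only [Algebra.traceMatrix_apply, Algebra.traceForm_apply] at h
    have h2 := congrArg (fun n : ℤ => (n : ℂ)) h
    simp only [Int.cast_sub, Int.cast_mul, htrZ, Int.cast_neg, Int.cast_natCast] at h2
    rw [← h2]
    simp only [map_mul]
    ring
  -- Were `ι` real, `ι'` would be real as well, and the real number in `hdet` would have the
  -- negative square `-D`.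
  have hconj : ∀ a, ι' a = conj (ι a) := by
    rcases hall ((starRingEnd ℂ).comp ι) with h | h
    · exfalso
      have hr : ∀ a, conj (ι a) = ι a := fun a => congrArg (fun s : K →+* ℂ => s a) h
      have hr' : ∀ a, conj (ι' a) = ι' a := by
        rcases hall ((starRingEnd ℂ).comp ι') with h' | h'
        · exfalso
          apply hne
          ext a
          have := congrArg (fun s : K →+* ℂ => conj (s a)) h'
          simp only [RingHom.comp_apply, Complex.conj_conj] at this
          rw [this, hr]
        · exact fun a => congrArg (fun s : K →+* ℂ => s a) h'
      have hreal : conj (ι (b 0) * ι' (b 1) - ι' (b 0) * ι (b 1)) =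
          (ι (b 0) * ι' (b 1) - ι' (b 0) * ι (b 1)) := by
        simp only [map_sub, map_mul, hr, hr']
      obtain ⟨r, hr⟩ := Complex.conj_eq_iff_real.1 hreal
      rw [hr] at hdet
      have : r ^ 2 = -(D : ℝ) := by exact_mod_cast hdet
      nlinarith [sq_nonneg r]
    · exact fun a => (congrArg (fun s : K →+* ℂ => s a) h).symm
  have hre : ∀ x : 𝓞 K, ∃ r : ℤ, (r : ℝ) = 2 * (ι x).re := fun x => by
    refine ⟨Algebra.trace ℤ (𝓞 K) x, ?_⟩
    have := congrArg Complex.re (htrZ x)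
    rw [hconj] at this
    simp at this
    linarith
  have hno : ∀ x : 𝓞 K, ∃ r : ℤ, (r : ℝ) = (ι x).re ^ 2 + (ι x).im ^ 2 := fun x => by
    refine ⟨Algebra.norm ℤ x, ?_⟩
    have := congrArg Complex.re (hnmZ x)
    rw [hconj, Complex.mul_conj] at this
    simp [Complex.normSq_apply] at this
    rw [this]; ring
  have hdet2 : (2 * (α.re * β.im - α.im * β.re)) ^ 2 = (D : ℝ) := by
    have h3 : ι (b 0) * ι' (b 1) - ι' (b 0) * ι (b 1) =
        ((-(2 * (α.re * β.im - α.im * β.re)) : ℝ) : ℂ) * Complex.I := by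
      rw [hconj, hconj, ← hα, ← hβ]
      apply Complex.ext <;> simp <;> ring
    rw [h3, mul_pow, Complex.I_sq] at hdet
    have : (-(2 * (α.re * β.im - α.im * β.re))) ^ 2 = (D : ℝ) := by
      have h4 : (((-(2 * (α.re * β.im - α.im * β.re))) ^ 2 : ℝ) : ℂ) = (D : ℂ) := by
        push_cast at hdet ⊢
        linear_combination -hdet
      exact_mod_cast h4
    nlinarith
  obtain ⟨ε, hε, hεD⟩ : ∃ ε : ℤ, ε ^ 2 = 1 ∧
      α.re * β.im - α.im * β.re = ε * (Real.sqrt D / 2) := by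
    have : (2 * (α.re * β.im - α.im * β.re)) ^ 2 = Real.sqrt D ^ 2 := by rw [hdet2, hss]
    rcases sq_eq_sq_iff_eq_or_eq_neg.1 this with h | h
    · exact ⟨1, by norm_num, by push_cast; linarith⟩
    · exact ⟨-1, by norm_num, by push_cast; linarith⟩
  have hcoord : ∀ x : 𝓞 K, ∃ s t : ℤ, ι x = s * α + t * β := fun x => by
    refine ⟨b.repr x 0, b.repr x 1, ?_⟩
    have h := b.sum_repr x
    rw [Fin.sum_univ_two] at h
    conv_lhs => rw [← h]
    simp only [zsmul_eq_mul, map_add, map_mul, map_intCast, hα, hβ]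
  -- The pair `(1, x)` has integral determinant relative to the basis, and writing `1 = mα + nβ`
  -- identifies `Im x` with that determinant times the signed covolume.
  have him : ∀ x : 𝓞 K, ∃ s : ℤ, (ι x).im = s * (Real.sqrt D / 2) := fun x => by
    obtain ⟨m, n, h1⟩ := hcoord 1
    obtain ⟨s, t, hx⟩ := hcoord x
    refine ⟨(m * t - n * s) * ε, ?_⟩
    have e1 := congrArg Complex.re h1
    have e2 := congrArg Complex.im h1
    have e3 := congrArg Complex.re hx
    have e4 := congrArg Complex.im hx
    simp at e1 e2 e3 e4
    push_cast
    calc (ι x).im = ((m:ℝ) * α.re + n * β.re) * (s * α.im + t * β.im)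
        - (m * α.im + n * β.im) * (s * α.re + t * β.re) := by rw [← e1, ← e2, e4]; ring
      _ = (m * t - n * s) * (α.re * β.im - α.im * β.re) := by ring
      _ = _ := by rw [hεD]; ring
  -- `D = 4 N(α) N(β) - tr(αβ̄)²`, and squares are 0 or 1 modulo 4.
  have hmod : D % 4 = 0 ∨ D % 4 = 3 := by
    obtain ⟨A, hA⟩ := hno (b 0)
    obtain ⟨B, hB⟩ := hno (b 1)
    obtain ⟨C, hC⟩ := hno (b 0 + b 1)
    have : (D : ℤ) = 4 * A * B - (C - A - B) ^ 2 := by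
      have : (D : ℝ) = 4 * A * B - (C - A - B) ^ 2 := by
        rw [← hdet2, hA, hB, hC]
        have : ι ((b 0 + b 1 : 𝓞 K) : K) = α + β := by simp [hα, hβ]
        rw [this, ← hα, ← hβ]
        simp; ring
      exact_mod_cast this
    have h2 : (C - A - B) % 2 = 0 ∨ (C - A - B) % 2 = 1 := by omega
    rcases h2 with h2 | h2
    · obtain ⟨q, hq⟩ : ∃ q, C - A - B = 2 * q := ⟨(C - A - B) / 2, by omega⟩
      left
      have h3 : (D : ℤ) = 4 * (A * B - q ^ 2) := by rw [this, hq]; ring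
      omega
    · obtain ⟨q, hq⟩ : ∃ q, C - A - B = 2 * q + 1 := ⟨(C - A - B) / 2, by omega⟩
      right
      have h3 : (D : ℤ) = 4 * (A * B - q ^ 2 - q) - 1 := by rw [this, hq]; ring
      omega
  have hsub : ∀ x : 𝓞 K, ∃ m n : ℤ, ι x = m + n * omg D := fun x => by
    obtain ⟨r, hr⟩ := hre x
    obtain ⟨s, hs'⟩ := him x
    obtain ⟨A, hA⟩ := hno x
    have key : r ^ 2 + s ^ 2 * D = 4 * A := by
      have : (r : ℝ) ^ 2 + s ^ 2 * D = 4 * A := by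
        rw [hA, hr, hs']; linear_combination (-(s:ℝ)^2) * hss
      exact_mod_cast this
    -- `r² + s²D ≡ 0 mod 4` forces `r ≡ sD mod 2`, which is what makes `r/2 + s i√D/2` an integral
    -- combination of `1` and `ω`.
    have hpar : (r - s * D) % 2 = 0 := by
      rcases hmod with h | h
      · obtain ⟨q, hq⟩ : ∃ q : ℤ, (D : ℤ) = 4 * q := ⟨D / 4, by omega⟩
        rw [hq] at key ⊢
        have hr2 : r % 2 = 0 := by
          by_contra hc
          obtain ⟨u, hu⟩ : ∃ u, r = 2 * u + 1 := ⟨r / 2, by omega⟩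
          rw [hu] at key
          ring_nf at key
          omega
        have : s * (4 * q) = 2 * (2 * (s * q)) := by ring
        omega
      · obtain ⟨q, hq⟩ : ∃ q : ℤ, (D : ℤ) = 4 * q + 3 := ⟨D / 4, by omega⟩
        rw [hq] at key ⊢
        obtain ⟨u, hu⟩ : ∃ u, r = 2 * u + r % 2 := ⟨r / 2, by omega⟩
        obtain ⟨v, hv⟩ : ∃ v, s = 2 * v + s % 2 := ⟨s / 2, by omega⟩
        have h1 : r % 2 = 0 ∨ r % 2 = 1 := by omega
        have h2 : s % 2 = 0 ∨ s % 2 = 1 := by omega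
        rcases h1 with h1 | h1 <;> rcases h2 with h2 | h2 <;> rw [h1] at hu <;> rw [h2] at hv <;>
          rw [hu, hv] at key ⊢ <;> ring_nf at key ⊢ <;> omega
    refine ⟨(r - s * D) / 2, s, ?_⟩
    have e : ((((r - s * D) / 2 : ℤ)) : ℝ) = ((r : ℝ) - s * D) / 2 := by
      have : (2 : ℤ) * ((r - s * D) / 2) = r - s * D := by omega
      have h2 : (2 : ℝ) * (((r - s * D) / 2 : ℤ)) = r - s * D := by exact_mod_cast this
      linarith
    apply Complex.ext
    · simp only [Complex.add_re, Complex.intCast_re, Complex.mul_re, Complex.intCast_im, omg_re,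
        zero_mul, sub_zero]
      rw [e]; linarith
    · simp only [Complex.add_im, Complex.intCast_im, Complex.mul_im, Complex.intCast_re, omg_im,
        zero_mul, add_zero, zero_add]
      linarith
  have hsup : ∀ m n : ℤ, ∃ x : 𝓞 K, ι x = m + n * omg D := by
    obtain ⟨m1, n1, h1⟩ := hsub (b 0)
    obtain ⟨m2, n2, h2⟩ := hsub (b 1)
    have hd : m1 * n2 - m2 * n1 = ε := by
      have : ((m1 * n2 - m2 * n1 : ℤ) : ℝ) * (Real.sqrt D / 2) = ε * (Real.sqrt D / 2) := by
        rw [← hεD, hα, hβ, h1, h2]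
        simp [omg_re, omg_im]; ring
      have := mul_right_cancel₀ (by positivity) this
      exact_mod_cast this
    intro m n
    -- Cramer's rule; the change-of-basis determinant `ε` is its own inverse.
    refine ⟨((ε * (m * n2 - m2 * n) : ℤ) : 𝓞 K) * b 0 + ((ε * (m1 * n - m * n1) : ℤ) : 𝓞 K) * b 1,
      ?_⟩
    have hcd : ((m1 : ℂ) * n2 - m2 * n1) = ε := by exact_mod_cast hd
    have hce : (ε : ℂ) ^ 2 = 1 := by exact_mod_cast hε
    simp only [map_add, map_mul, map_intCast, h1, h2]
    push_cast
    linear_combination (ε * m + ε * n * omg D) * hcd + (m + n * omg D) * hce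
  have hmem : ∀ a : ℂ, a ∈ intC ι ↔ ∃ m n : ℤ, a = m + n * omg D := by
    intro a
    rw [mem_intC]
    constructor
    · rintro ⟨x, rfl⟩; exact hsub x
    · rintro ⟨m, n, rfl⟩; exact hsup m n
  refine ⟨hD, hmod, hmem, ?_⟩
  intro f E hfE hE
  have hf0 : f ≠ 0 := by rintro rfl; simp at hfE; omega
  obtain ⟨x, hx⟩ := hsup 0 1
  have hfC : (f : ℂ) ≠ 0 := by exact_mod_cast hf0
  -- the integral element (E + √-E)/2
  set y : K := ((E : K) + (2 * (x : K) - D) / f) / 2 with hy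
  have hιy : ι y = ((E : ℂ) + Complex.I * (Real.sqrt D : ℝ) / f) / 2 := by
    rw [hy]
    simp only [map_div₀, map_add, map_sub, map_mul, map_natCast, map_ofNat, hx]
    simp [omg]
    ring
  have hyint : IsIntegral ℤ y := by
    obtain ⟨q, hq⟩ : ∃ q : ℕ, E ^ 2 + E = 4 * q := by
      have : (E ^ 2 + E) % 4 = 0 := by
        rw [Nat.add_mod, Nat.pow_mod]
        rcases hE with h | h <;> rw [h]
      exact ⟨(E ^ 2 + E) / 4, by omega⟩
    refine ⟨Polynomial.X ^ 2 - Polynomial.C (E : ℤ) * Polynomial.X + Polynomial.C (q : ℤ), ?_, ?_⟩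
    · monicity!
    · apply ι.injective
      simp only [Polynomial.eval₂_add, Polynomial.eval₂_sub, Polynomial.eval₂_mul,
        Polynomial.eval₂_pow, Polynomial.eval₂_X, map_add, map_sub, map_mul,
        map_pow, map_zero, Polynomial.eval₂_natCast, map_natCast]
      have hqC : (E : ℂ) ^ 2 + E = 4 * q := by exact_mod_cast hq
      have hssC : ((Real.sqrt D : ℝ) : ℂ) ^ 2 = f ^ 2 * E := by
        rw [← Complex.ofReal_pow, hss, hfE]; push_cast; ring
      rw [hιy]
      field_simp
      linear_combination (-1) * (f:ℂ)^2 * hqC + (Complex.I) ^ 2 * hssC + (f : ℂ) ^ 2 * E * Complex.I_sq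
  obtain ⟨m, n, hmn⟩ := (hmem _).1 (mem_intC_of_isIntegral_of_range (ι := ι) y hyint)
  rw [hιy] at hmn
  have him2 := congrArg Complex.im hmn
  have e1 : ((E : ℂ) + Complex.I * (Real.sqrt D : ℝ) / f) / 2 =
      ((E / 2 : ℝ) : ℂ) + ((Real.sqrt D / f / 2 : ℝ) : ℂ) * Complex.I := by
    push_cast; ring
  rw [e1] at him2
  simp only [Complex.add_im, Complex.intCast_im, Complex.mul_im, Complex.intCast_re, omg_im,
        zero_mul, add_zero, zero_add, Complex.ofReal_im, Complex.ofReal_re, Complex.I_im,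
        Complex.I_re, mul_one, mul_zero] at him2
  have hfR : (f : ℝ) ≠ 0 := by exact_mod_cast hf0
  have h5 : (n : ℝ) * f = 1 := by
    field_simp at him2
    linarith
  have h6 : n * (f : ℤ) = 1 := by exact_mod_cast h5
  have := Int.eq_one_or_neg_one_of_mul_eq_one' h6
  omega

end RingOfIntegers

/-! ### The quadratic character and reciprocity -/

section Character

lemma chiP_mul (D p : ℕ) (a b : ℤ) : chiP D p (a * b) = chiP D p a * chiP D p b := by
  unfold chiP
  split_ifs
  · rw [Int.cast_mul, map_mul]
  · rw [Int.cast_mul, map_mul]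
  · rw [Int.cast_mul, map_mul]
  · exact jacobiSym.mul_left a b p

lemma chi_mul (D : ℕ) (a b : ℤ) : chi D (a * b) = chi D a * chi D b := by
  simp [chi, chiP_mul, Finset.prod_mul_distrib]

lemma chi_one (D : ℕ) : chi D 1 = 1 := by
  unfold chi
  refine Finset.prod_eq_one fun p _ => ?_
  unfold chiP
  split_ifs <;> simp

/-- The hypothesis `h4` is needed for the branch `8 ∤ D`, where the factor at 2 has conductor 4. -/
lemma chiP_congr {D p : ℕ} (hp : p ∣ D) (h4 : p = 2 → 4 ∣ D) {a b : ℤ} (h : a ≡ b [ZMOD D]) :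
    chiP D p a = chiP D p b := by
  have key : ∀ m : ℕ, m ∣ D → ((a : ZMod m) = (b : ZMod m)) := fun m hm =>
    (ZMod.intCast_eq_intCast_iff _ _ _).2 (h.of_dvd (by exact_mod_cast hm))
  unfold chiP
  split_ifs with h1 h2 h3
  · rw [key 8 h2]
  · rw [key 8 h2]
  · rw [key 4 (h4 h1)]
  · exact jacobiSym.mod_left' (h.of_dvd (by exact_mod_cast hp))

lemma four_dvd_of_two_dvd {D : ℕ} (hD : D % 4 = 0 ∨ D % 4 = 3) (h : 2 ∣ D) : 4 ∣ D := by omega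

lemma chi_congr {D : ℕ} (hD : D % 4 = 0 ∨ D % 4 = 3) {a b : ℤ} (h : a ≡ b [ZMOD D]) :
    chi D a = chi D b := by
  refine Finset.prod_congr rfl fun p hp => ?_
  have hpD := Nat.dvd_of_mem_primeFactors hp
  exact chiP_congr hpD (fun h2 => four_dvd_of_two_dvd hD (h2 ▸ hpD)) h

lemma chi_eq_of_mul_modEq_one {D : ℕ} (hD : D % 4 = 0 ∨ D % 4 = 3) {a d : ℤ}
    (h : a * d ≡ 1 [ZMOD D]) : chi D a = chi D d := by
  have : chi D a * chi D d = 1 := by rw [← chi_mul, chi_congr hD h, chi_one]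
  rcases Int.mul_eq_one_iff_eq_one_or_neg_one.1 this with ⟨h1, h2⟩ | ⟨h1, h2⟩ <;> rw [h1, h2]

lemma chi_sq_eq_one {D : ℕ} (hD : D % 4 = 0 ∨ D % 4 = 3) {a d : ℤ}
    (h : a * d ≡ 1 [ZMOD D]) : chi D a ^ 2 = 1 := by
  rw [sq]
  nth_rw 2 [chi_eq_of_mul_modEq_one hD h]
  rw [← chi_mul, chi_congr hD h, chi_one]

lemma jacobiSym_eq_prod_primeFactors {m : ℕ} (hm : Squarefree m) (n : ℤ) :
    jacobiSym n m = ∏ q ∈ m.primeFactors, jacobiSym n q := by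
  induction m using Nat.recOnMul with
  | zero => exact absurd hm not_squarefree_zero
  | one => simp
  | prime p hp => simp [hp.primeFactors]
  | mul a b ha hb =>
    have ha0 : a ≠ 0 := by rintro rfl; simp at hm
    have hb0 : b ≠ 0 := by rintro rfl; simp at hm
    have hc : Nat.Coprime a b := Nat.coprime_of_squarefree_mul hm
    rw [jacobiSym.mul_right' n ha0 hb0, hc.primeFactors_mul,
      Finset.prod_union hc.disjoint_primeFactors, ha (hm.of_mul_left), hb (hm.of_mul_right)]

lemma prod_chiP_odd {D m : ℕ} (hm : Squarefree m) (hodd : Odd m) (n : ℤ) :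
    ∏ q ∈ m.primeFactors, chiP D q n = jacobiSym n m := by
  rw [jacobiSym_eq_prod_primeFactors hm]
  refine Finset.prod_congr rfl fun q hq => ?_
  have : q ≠ 2 := by
    rintro rfl
    have := Nat.dvd_of_mem_primeFactors hq
    exact (Nat.not_even_iff_odd.2 hodd) (even_iff_two_dvd.2 this)
  simp [chiP, this]

/-- `D > 0` such that `-D` is a fundamental discriminant. -/
structure IsFundamental (D : ℕ) : Prop where
  pos : 0 < D
  mod_four : D % 4 = 0 ∨ D % 4 = 3
  fundamental : ∀ f E : ℕ, D = f ^ 2 * E → (E % 4 = 0 ∨ E % 4 = 3) → f = 1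

/-- An odd prime has `p² ≡ 1 mod 4`, so removing a factor `p²` from `D` would leave the negative of
a discriminant, against fundamentality. -/
lemma IsFundamental.squarefree_of_odd {D : ℕ} (h : IsFundamental D) {c m : ℕ} (hD : D = c * m)
    (hc : c = 1 ∨ c = 4 ∨ c = 8) (hm : Odd m) : Squarefree m := by
  rw [Nat.squarefree_iff_prime_squarefree]
  rintro p hp ⟨E, hE⟩
  have hpodd : Odd p := by
    by_contra hcon
    rw [Nat.not_odd_iff_even] at hcon
    have : Even m := by rw [hE, mul_assoc]; exact hcon.mul_right _
    exact (Nat.not_even_iff_odd.2 hm) this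
  have h1 : p = 1 := by
    refine h.fundamental p (c * E) (by rw [hD, hE]; ring) ?_
    obtain ⟨r, hr⟩ := hpodd
    have hpp : p ^ 2 = 4 * (r ^ 2 + r) + 1 := by rw [hr]; ring
    rcases hc with rfl | rfl | rfl
    · have : D = 4 * ((r ^ 2 + r) * E) + E := by
        rw [hD, hE, one_mul, ← sq, hpp]; ring
      have := h.mod_four
      omega
    · omega
    · omega
  exact hp.one_lt.ne' h1

lemma odd_mod_four {m : ℕ} (h : Odd m) : m % 4 = 1 ∨ m % 4 = 3 := by
  obtain ⟨r, hr⟩ := h; omega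

/-- For `m ≡ 3 mod 4` the reciprocity sign depends on `p` alone, and equals `χ₄(p)`; it is the sign
that also appears in `(-1/p)`. -/
lemma jacobiSym_flip_three {p m : ℕ} (hp : Odd p) (hm : m % 4 = 3) :
    jacobiSym m p = ZMod.χ₄ (p : ZMod 4) * jacobiSym p m := by
  have hmo : Odd m := by rw [Nat.odd_iff]; omega
  rcases odd_mod_four hp with h | h
  · rw [jacobiSym.quadratic_reciprocity_one_mod_four' hmo h, ZMod.χ₄_nat_one_mod_four h, one_mul]
  · rw [jacobiSym.quadratic_reciprocity_three_mod_four hm h, ZMod.χ₄_nat_three_mod_four h]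
    ring

/-- Quadratic reciprocity for the character of an imaginary quadratic field. -/
lemma chi_prime {D : ℕ} (h : IsFundamental D) {p : ℕ} (hp : Odd p) :
    chi D p = jacobiSym (-D) p := by
  have hneg : ∀ a : ℤ, jacobiSym (-a) p = ZMod.χ₄ (p : ZMod 4) * jacobiSym a p := fun a => by
    rw [jacobiSym.neg a hp]
  have hpc : p.Coprime 2 := (Nat.coprime_two_right).2 hp
  have hsq4 : jacobiSym 4 p = 1 := by
    have : (4 : ℤ) = 2 ^ 2 := by norm_num
    rw [this]
    exact jacobiSym.sq_one' (by simpa [Int.gcd] using hpc.symm)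
  rcases Nat.even_or_odd D with heven | hodd
  · have h4 : 4 ∣ D := four_dvd_of_two_dvd h.mod_four (even_iff_two_dvd.1 heven)
    obtain ⟨m4, hm4⟩ := h4
    have two_case : ∀ c m : ℕ, D = c * m → (c = 4 ∨ c = 8) → Odd m →
        chi D p = chiP D 2 p * jacobiSym p m := by
      intro c m hD hc hm
      have hsf := h.squarefree_of_odd hD (by tauto) hm
      have hcop : Nat.Coprime c m := by
        rcases hc with rfl | rfl
        · exact Nat.Coprime.pow_left 2 ((Nat.coprime_two_left).2 hm)
        · exact Nat.Coprime.pow_left 3 ((Nat.coprime_two_left).2 hm)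
      have hc2 : c.primeFactors = {2} := by
        rcases hc with rfl | rfl
        · exact Nat.primeFactors_prime_pow (k := 2) (by norm_num) Nat.prime_two
        · exact Nat.primeFactors_prime_pow (k := 3) (by norm_num) Nat.prime_two
      have : chi D p = ∏ q ∈ D.primeFactors, chiP D q p := rfl
      rw [this, ← prod_chiP_odd (D := D) hsf hm]
      conv_lhs => rw [show D.primeFactors = (c * m).primeFactors by rw [← hD]]
      rw [hcop.primeFactors_mul, Finset.prod_union hcop.disjoint_primeFactors, hc2,
        Finset.prod_singleton]
    rcases Nat.even_or_odd m4 with he | ho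
    · obtain ⟨m, hm⟩ := even_iff_two_dvd.1 he
      have hD8 : D = 8 * m := by rw [hm4, hm]; ring
      have hmo : Odd m := by
        by_contra hcon
        rw [Nat.not_odd_iff_even] at hcon
        obtain ⟨r, hr⟩ := even_iff_two_dvd.1 hcon
        have := h.fundamental 2 (4 * r) (by rw [hD8, hr]; ring) (by omega)
        omega
      rw [two_case 8 m hD8 (Or.inr rfl) hmo, hneg]
      have e1 : ((D : ℕ) : ℤ) = 4 * (2 * m) := by rw [hD8]; push_cast; ring
      have h2 : jacobiSym 2 p = ZMod.χ₈ (p : ZMod 8) := jacobiSym.at_two hp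
      rw [e1, jacobiSym.mul_left, jacobiSym.mul_left, hsq4, one_mul, h2]
      have h8 : 8 ∣ D := ⟨m, hD8⟩
      have hdiv : D / 8 = m := by omega
      have hχ : ZMod.χ₈' (p : ZMod 8) = ZMod.χ₄ (p : ZMod 4) * ZMod.χ₈ (p : ZMod 8) := by
        have := ZMod.χ₈'_eq_χ₄_mul_χ₈ (p : ZMod 8)
        rw [this]
        congr 2
        simp
      rcases odd_mod_four hmo with hm1 | hm3
      · have : chiP D 2 p = ZMod.χ₈' (p : ZMod 8) := by simp [chiP, h8, hdiv, hm1]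
        rw [this, hχ, jacobiSym.quadratic_reciprocity_one_mod_four hm1 hp]
        ring
      · have : chiP D 2 p = ZMod.χ₈ (p : ZMod 8) := by simp [chiP, h8, hdiv, hm3]
        rw [this, jacobiSym_flip_three hp hm3]
        have hχ4 : ZMod.χ₄ (p : ZMod 4) * ZMod.χ₄ (p : ZMod 4) = 1 := by
          rcases odd_mod_four hp with h | h
          · rw [ZMod.χ₄_nat_one_mod_four h, one_mul]
          · rw [ZMod.χ₄_nat_three_mod_four h]; norm_num
        linear_combination (-(ZMod.χ₈ (p : ZMod 8) * jacobiSym p m)) * hχ4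
    -- If `D/4 ≡ 3 mod 4`, then `-D/4` would already be a discriminant and `D` would not be
    -- fundamental.
    · have hm1 : m4 % 4 = 1 := by
        rcases odd_mod_four ho with h1 | h1
        · exact h1
        · have := h.fundamental 2 m4 (by rw [hm4]; ring) (Or.inr h1)
          omega
      rw [two_case 4 m4 hm4 (Or.inl rfl) ho, hneg]
      have e1 : ((D : ℕ) : ℤ) = 4 * m4 := by rw [hm4]; push_cast; ring
      rw [e1, jacobiSym.mul_left, hsq4, one_mul]
      have h8 : ¬ 8 ∣ D := by omega
      have : chiP D 2 p = ZMod.χ₄ (p : ZMod 4) := by simp [chiP, h8]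
      rw [this, jacobiSym.quadratic_reciprocity_one_mod_four hm1 hp]
  · have h3 : D % 4 = 3 := by
      have := h.mod_four
      rw [Nat.odd_iff] at hodd
      omega
    have hsf := h.squarefree_of_odd (one_mul D).symm (Or.inl rfl) hodd
    have : chi D p = jacobiSym p D := prod_chiP_odd hsf hodd p
    rw [this, hneg, jacobiSym_flip_three hp h3]
    have hχ4 : ZMod.χ₄ (p : ZMod 4) * ZMod.χ₄ (p : ZMod 4) = 1 := by
      rcases odd_mod_four hp with h | h
      · rw [ZMod.χ₄_nat_one_mod_four h, one_mul]
      · rw [ZMod.χ₄_nat_three_mod_four h]; norm_num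
    linear_combination (-(jacobiSym p D)) * hχ4

end Character

/-! ### Gauss sums of binary forms modulo an odd prime -/

section GaussSum

variable {p : ℕ} [Fact p.Prime]

/-- The equation `x² = y` has `1 + (y/p)` solutions; the constant `1` contributes a full character
sum, which vanishes. -/
lemma sum_sq_eq_gaussSum (hp : p ≠ 2) {ψ : AddChar (ZMod p) ℂ} (hψ : ψ.IsPrimitive)
    {a : ZMod p} (ha : a ≠ 0) :
    ∑ x : ZMod p, ψ (a * x ^ 2) =
      (quadraticChar (ZMod p) a : ℂ) *
        gaussSum ((quadraticChar (ZMod p)).ringHomComp (Int.castRingHom ℂ)) ψ := by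
  classical
  have hchar : ringChar (ZMod p) ≠ 2 := by rwa [ZMod.ringChar_zmod_n]
  have h1 : ∑ x : ZMod p, ψ (a * x ^ 2) =
      ∑ y : ZMod p, ((quadraticChar (ZMod p) y : ℂ) + 1) * ψ (a * y) := by
    rw [← Finset.sum_fiberwise' Finset.univ (fun x : ZMod p => x ^ 2) (fun y => ψ (a * y))]
    refine Finset.sum_congr rfl fun y _ => ?_
    rw [Finset.sum_const, nsmul_eq_mul]
    congr 1
    have := quadraticChar_card_sqrts hchar y
    have h2 : ({x : ZMod p | x ^ 2 = y}.toFinset) = Finset.univ.filter (fun x => x ^ 2 = y) := by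
      ext; simp
    rw [h2] at this
    exact_mod_cast congrArg (fun n : ℤ => (n : ℂ)) this
  have h0 : ∑ y : ZMod p, ψ (a * y) = 0 := by
    have := AddChar.sum_eq_zero_of_ne_one (hψ ha)
    simpa [AddChar.mulShift_apply] using this
  rw [h1]
  simp only [add_mul, one_mul, Finset.sum_add_distrib, h0, add_zero]
  have h2 := gaussSum_mulShift ((quadraticChar (ZMod p)).ringHomComp (Int.castRingHom ℂ)) ψ
    (Units.mk0 a ha)
  have h3 : ((quadraticChar (ZMod p) a : ℤ) : ℂ) ^ 2 = 1 := by
    have := quadraticChar_sq_one ha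
    exact_mod_cast congrArg (fun n : ℤ => (n : ℂ)) this
  rw [← h2]
  simp only [gaussSum, MulChar.ringHomComp_apply, Units.val_mk0, AddChar.mulShift_apply,
    Int.coe_castRingHom]
  rw [← mul_assoc, ← sq, h3, one_mul]

/-- The sum factors into two one-variable Gauss sums, whose product is a sign times `g² = (-1/p) p`.
-/
lemma sum_binary_form (hp : p ≠ 2) {ψ : AddChar (ZMod p) ℂ} (hψ : ψ.IsPrimitive)
    {a d : ZMod p} (ha : a ≠ 0) (hd : d ≠ 0) :
    ∑ x : ZMod p, ∑ y : ZMod p, ψ (a * (x ^ 2 + d * y ^ 2)) =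
      (quadraticChar (ZMod p) (-d) : ℂ) * p := by
  classical
  have hchar : ringChar (ZMod p) ≠ 2 := by rwa [ZMod.ringChar_zmod_n]
  have h1 : ∑ x : ZMod p, ∑ y : ZMod p, ψ (a * (x ^ 2 + d * y ^ 2)) =
      (∑ x : ZMod p, ψ (a * x ^ 2)) * ∑ y : ZMod p, ψ ((a * d) * y ^ 2) := by
    rw [Finset.sum_mul_sum]
    refine Finset.sum_congr rfl fun x _ => Finset.sum_congr rfl fun y _ => ?_
    rw [← AddChar.map_add_eq_mul]; ring_nf
  have hq : (quadraticChar (ZMod p)).ringHomComp (Int.castRingHom ℂ) ≠ 1 :=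
    (MulChar.ringHomComp_ne_one_iff Int.cast_injective).2 (quadraticChar_ne_one hchar)
  have hsq := gaussSum_sq hq ((quadraticChar_isQuadratic (ZMod p)).comp _) hψ
  have h3 : ((quadraticChar (ZMod p) a : ℤ) : ℂ) ^ 2 = 1 := by
    have := quadraticChar_sq_one ha
    exact_mod_cast congrArg (fun n : ℤ => (n : ℂ)) this
  rw [h1, sum_sq_eq_gaussSum hp hψ ha, sum_sq_eq_gaussSum hp hψ (mul_ne_zero ha hd)]
  rw [MulChar.ringHomComp_apply, ZMod.card] at hsq
  simp only [Int.coe_castRingHom] at hsq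
  have e : (quadraticChar (ZMod p) (-d)) = quadraticChar (ZMod p) (-1) * quadraticChar (ZMod p) d := by
    rw [← map_mul]; ring_nf
  rw [e, map_mul]
  push_cast
  linear_combination ((quadraticChar (ZMod p) a : ℂ) ^ 2 * (quadraticChar (ZMod p) d : ℂ)) * hsq +
    (quadraticChar (ZMod p) d : ℂ) * (quadraticChar (ZMod p) (-1) : ℂ) * p * h3

/-- The Gauss sum of the norm form of discriminant `-D` modulo an odd prime `p ∤ D`. -/
lemma sum_norm_form (hp : p ≠ 2) {ψ : AddChar (ZMod p) ℂ} (hψ : ψ.IsPrimitive)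
    {b D q : ZMod p} (hb : b ≠ 0) (hD : D ≠ 0) (hq : 4 * q = D ^ 2 + D) :
    ∑ x : ZMod p, ∑ y : ZMod p, ψ (b * (x ^ 2 + D * x * y + q * y ^ 2)) =
      (quadraticChar (ZMod p) (-D) : ℂ) * p := by
  have h2 : (2 : ZMod p) ≠ 0 := by
    intro h
    have : ((2 : ℕ) : ZMod p) = 0 := by exact_mod_cast h
    rw [ZMod.natCast_eq_zero_iff] at this
    exact hp ((Nat.prime_dvd_prime_iff_eq Fact.out Nat.prime_two).1 this)
  have hb4 : b / 4 ≠ 0 := div_ne_zero hb (by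
    have : (4 : ZMod p) = 2 * 2 := by norm_num
    rw [this]; exact mul_ne_zero h2 h2)
  rw [← sum_binary_form hp hψ hb4 hD, Finset.sum_comm]
  conv_rhs => rw [Finset.sum_comm]
  refine Finset.sum_congr rfl fun y _ => ?_
  -- Completing the square: `4(x² + Dxy + qy²) = (2x + Dy)² + Dy²`.
  have hbij : Function.Bijective (fun x : ZMod p => 2 * x + D * y) := by
    constructor
    · intro x x' h
      exact mul_left_cancel₀ h2 (add_right_cancel h)
    · intro z
      exact ⟨(z - D * y) / 2, by field_simp; ring⟩
  refine Fintype.sum_bijective _ hbij _ _ fun x => ?_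
  congr 1
  have : (4 : ZMod p) ≠ 0 := by
    have : (4 : ZMod p) = 2 * 2 := by norm_num
    rw [this]; exact mul_ne_zero h2 h2
  field_simp
  linear_combination (y ^ 2) * hq

end GaussSum

/-! ### The normalized exponential -/

section Exponential

lemma e_add (x y : ℂ) : e (x + y) = e x * e y := by
  simp only [e, mul_add, Complex.exp_add]

lemma e_zero : e 0 = 1 := by simp [e]

lemma e_int (n : ℤ) : e n = 1 := by
  rw [e, show 2 * (Real.pi : ℂ) * Complex.I * n = n * (2 * Real.pi * Complex.I) by ring]
  exact Complex.exp_int_mul_two_pi_mul_I n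

lemma e_ne_zero (x : ℂ) : e x ≠ 0 := Complex.exp_ne_zero _

lemma e_neg (x : ℂ) : e (-x) = (e x)⁻¹ := by
  simp only [e, mul_neg, Complex.exp_neg]

lemma norm_e (x : ℂ) : ‖e x‖ = Real.exp (-(2 * Real.pi * x.im)) := by
  rw [e, Complex.norm_exp]
  congr 1
  simp

lemma norm_e_ofReal (x : ℝ) : ‖e x‖ = 1 := by simp [norm_e]

lemma conj_e_ofReal (x : ℝ) : conj (e x) = e (-x) := by
  simp [e, ← Complex.exp_conj, map_ofNat]

lemma e_eq_one_iff (x : ℂ) : e x = 1 ↔ ∃ n : ℤ, x = n := by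
  rw [e, Complex.exp_eq_one_iff]
  have h : (2 * (Real.pi : ℂ) * Complex.I) ≠ 0 := Complex.two_pi_I_ne_zero
  constructor
  · rintro ⟨n, hn⟩
    exact ⟨n, mul_left_cancel₀ h (by rw [hn]; ring)⟩
  · rintro ⟨n, rfl⟩
    exact ⟨n, by ring⟩

end Exponential

/-! ### Coordinates and convergence of theta series -/

section Coordinates

/-- The elements of the lattice `ℤ + ℤω` in coordinates. -/
def oC (D : ℕ) (p : ℤ × ℤ) : ℂ := p.1 + p.2 * omg D

/-- The elements of the inverse different in coordinates. -/
def dC (D : ℕ) (p : ℤ × ℤ) : ℂ := Complex.I / ((Real.sqrt D : ℝ) : ℂ) * oC D p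

lemma oC_re (D : ℕ) (p : ℤ × ℤ) : (oC D p).re = p.1 + p.2 * (D / 2) := by
  simp [oC, omg_re]

lemma oC_im (D : ℕ) (p : ℤ × ℤ) : (oC D p).im = p.2 * (Real.sqrt D / 2) := by
  simp [oC, omg_im]

/-- Positive definiteness of the norm form, in the quantitative shape needed to dominate theta
series by a product of one-variable Gaussian sums. -/
lemma exists_normSq_oC_ge {D : ℕ} (hD : 0 < D) :
    ∃ c : ℝ, 0 < c ∧ ∀ p : ℤ × ℤ, c * ((p.1 : ℝ) ^ 2 + (p.2 : ℝ) ^ 2) ≤ Complex.normSq (oC D p) := by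
  have hD1 : (1 : ℝ) ≤ D := by exact_mod_cast hD
  refine ⟨1 / (4 * ((D : ℝ) + 2) ^ 2), by positivity, fun p => ?_⟩
  rw [Complex.normSq_apply, oC_re, oC_im]
  have hs : Real.sqrt D ^ 2 = D := Real.sq_sqrt (by positivity)
  set m : ℝ := (p.1 : ℝ)
  set n : ℝ := (p.2 : ℝ)
  rw [div_mul_eq_mul_div, one_mul, div_le_iff₀ (by positivity)]
  have h1 : (m + n * (D / 2)) * (m + n * (D / 2)) + n * (Real.sqrt D / 2) * (n * (Real.sqrt D / 2))
      = (m + n * (D / 2)) ^ 2 + D * n ^ 2 / 4 := by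
    linear_combination (n ^ 2 / 4) * hs
  rw [h1]
  have h2 : m ^ 2 ≤ 2 * (m + n * (D / 2)) ^ 2 + D ^ 2 * n ^ 2 / 2 := by
    nlinarith [sq_nonneg (m + n * (D / 2) + n * (D / 2))]
  have h3 : 1 ≤ ((D : ℝ) + 2) ^ 2 := by nlinarith
  have h4 : n ^ 2 ≤ D * n ^ 2 := by nlinarith [sq_nonneg n]
  have h5 : 0 ≤ (m + n * (D / 2)) ^ 2 := sq_nonneg _
  have h6 : D * n ^ 2 * ((D : ℝ) + 2) ^ 2 ≥ n ^ 2 * ((D : ℝ) + 2) ^ 2 :=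
    mul_le_mul_of_nonneg_right h4 (by positivity)
  nlinarith [mul_nonneg h5 (sub_nonneg.2 h3), sq_nonneg n, mul_nonneg (sq_nonneg n) (by positivity : (0:ℝ) ≤ D)]

lemma summable_exp_neg_sq {a : ℝ} (ha : 0 < a) :
    Summable fun n : ℤ => Real.exp (-(a * (n : ℝ) ^ 2)) := by
  have h := ((summable_jacobiTheta₂_term_iff 0 (((a / Real.pi : ℝ) : ℂ) * Complex.I)).2
    (by simp; positivity)).norm
  refine h.congr fun n => ?_
  rw [norm_jacobiTheta₂_term]
  congr 1
  have := Real.pi_pos.ne'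
  simp
  field_simp

lemma summable_exp_neg_normSq {D : ℕ} (hD : 0 < D) {a : ℝ} (ha : 0 < a) :
    Summable fun p : ℤ × ℤ => Real.exp (-(a * Complex.normSq (oC D p))) := by
  obtain ⟨c, hc, hle⟩ := exists_normSq_oC_ge hD
  have h1 := summable_exp_neg_sq (mul_pos ha hc)
  refine Summable.of_nonneg_of_le (fun _ => (Real.exp_pos _).le) (fun p => ?_)
    (h1.mul_of_nonneg h1 (fun _ => (Real.exp_pos _).le) (fun _ => (Real.exp_pos _).le))
  rw [← Real.exp_add, Real.exp_le_exp]
  nlinarith [mul_le_mul_of_nonneg_left (hle p) ha.le]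

/-- The general term of a theta series. -/
def thetaTerm (τ z w a : ℂ) : ℂ := e (a * conj a * τ + conj a * z + a * w)

/-- The linear part of the exponent is absorbed by `(C - y|a|)² ≥ 0`, with `C = ‖z‖ + ‖w‖`, at the
price of half the Gaussian decay. -/
lemma norm_thetaTerm_le {y : ℝ} (hy : 0 < y) {τ : ℂ} (hτ : y ≤ τ.im) (z w a : ℂ) :
    ‖thetaTerm τ z w a‖ ≤
      Real.exp (Real.pi * (‖z‖ + ‖w‖) ^ 2 / y) * Real.exp (-(Real.pi * y * Complex.normSq a)) := by
  rw [thetaTerm, norm_e, ← Real.exp_add, Real.exp_le_exp]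
  have h1 : (a * conj a * τ + conj a * z + a * w).im =
      Complex.normSq a * τ.im + (conj a * z).im + (a * w).im := by
    rw [Complex.mul_conj, Complex.add_im, Complex.add_im, Complex.im_ofReal_mul]
  have h2 : -(‖a‖ * ‖z‖) ≤ (conj a * z).im := by
    have := Complex.abs_im_le_norm (conj a * z)
    rw [norm_mul, RCLike.norm_conj] at this
    exact (abs_le.1 this).1
  have h3 : -(‖a‖ * ‖w‖) ≤ (a * w).im := by
    have := Complex.abs_im_le_norm (a * w)
    rw [norm_mul] at this
    exact (abs_le.1 this).1
  rw [h1, Complex.normSq_eq_norm_sq]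
  set s := ‖a‖
  set C := ‖z‖ + ‖w‖ with hC
  have h4 : s ^ 2 * y ≤ s ^ 2 * τ.im := mul_le_mul_of_nonneg_left hτ (sq_nonneg _)
  have h5 : s ^ 2 * y - s * C ≤ s ^ 2 * τ.im + (conj a * z).im + (a * w).im := by
    rw [hC]; nlinarith
  have h6 : 0 ≤ C ^ 2 / y + y * s ^ 2 - 2 * s * C := by
    have : C ^ 2 / y + y * s ^ 2 - 2 * s * C = (C - y * s) ^ 2 / y := by field_simp; ring
    rw [this]; positivity
  have h7 : Real.pi * C ^ 2 / y = Real.pi * (C ^ 2 / y) := by ring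
  rw [h7]
  nlinarith [Real.pi_pos, mul_le_mul_of_nonneg_left h5 Real.pi_pos.le, mul_nonneg Real.pi_pos.le h6]

lemma summable_thetaTerm_mul {D : ℕ} (hD : 0 < D) {s : ℂ} (hs : s ≠ 0) {τ : ℂ} (hτ : 0 < τ.im)
    (z w : ℂ) : Summable fun p : ℤ × ℤ => ‖thetaTerm τ z w (s * oC D p)‖ := by
  have hs' : 0 < Complex.normSq s := Complex.normSq_pos.2 hs
  refine Summable.of_nonneg_of_le (fun _ => norm_nonneg _)
    (fun p => norm_thetaTerm_le hτ le_rfl z w _) (Summable.mul_left _ ?_)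
  refine (summable_exp_neg_normSq hD (a := Real.pi * τ.im * Complex.normSq s)
    (by have := Real.pi_pos; positivity)).congr fun p => ?_
  rw [map_mul]; ring_nf

lemma sqrtC_ne_zero {D : ℕ} (hD : 0 < D) : ((Real.sqrt D : ℝ) : ℂ) ≠ 0 := by
  have : 0 < Real.sqrt D := Real.sqrt_pos.2 (by exact_mod_cast hD)
  exact_mod_cast this.ne'

lemma sqrtC_sq (D : ℕ) : ((Real.sqrt D : ℝ) : ℂ) ^ 2 = D := by
  rw [← Complex.ofReal_pow, Real.sq_sqrt (by positivity)]; simp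

lemma dScale_ne_zero {D : ℕ} (hD : 0 < D) : Complex.I / ((Real.sqrt D : ℝ) : ℂ) ≠ 0 :=
  div_ne_zero Complex.I_ne_zero (sqrtC_ne_zero hD)

end Coordinates

/-! ### Poisson summation for the lattice -/

section Poisson

/-- After completing squares this is Jacobi's inversion formula at the argument `s - θσ`. The
character `θ` is carried along because the cross term of the norm form produces one in the second
variable. -/
lemma tsum_gaussian_shift {σ : ℂ} (hσ : 0 < σ.im) (s θ : ℂ) :
    ∑' n : ℤ, Complex.exp (-(Real.pi * Complex.I * (n + s) ^ 2 / σ) + 2 * Real.pi * Complex.I * n * θ) =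
      (-Complex.I * σ) ^ (1 / 2 : ℂ) * ∑' j : ℤ,
        Complex.exp (2 * Real.pi * Complex.I * (j - θ) * s + Real.pi * Complex.I * (j - θ) ^ 2 * σ) := by
  have hσ0 : σ ≠ 0 := by rintro rfl; simp at hσ
  have hI : (-Complex.I * σ) ^ (1 / 2 : ℂ) ≠ 0 := by
    rw [Ne, Complex.cpow_eq_zero_iff]; simp [hσ0]
  have h := jacobiTheta₂_functional_equation (s - θ * σ) σ
  have h1 : ∑' n : ℤ, Complex.exp (-(Real.pi * Complex.I * (n + s) ^ 2 / σ) +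
        2 * Real.pi * Complex.I * n * θ) =
      Complex.exp (Real.pi * Complex.I * θ ^ 2 * σ - 2 * Real.pi * Complex.I * s * θ) *
      (Complex.exp (-Real.pi * Complex.I * (s - θ * σ) ^ 2 / σ) *
        jacobiTheta₂ (-((s - θ * σ) / σ)) (-1 / σ)) := by
    rw [jacobiTheta₂, ← tsum_mul_left, ← tsum_mul_left]
    refine tsum_congr fun n => ?_
    rw [jacobiTheta₂_term, ← Complex.exp_add, ← Complex.exp_add]
    congr 1
    field_simp
    ring
  have h2 : ∑' j : ℤ, Complex.exp (2 * Real.pi * Complex.I * (j - θ) * s +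
        Real.pi * Complex.I * (j - θ) ^ 2 * σ) =
      Complex.exp (Real.pi * Complex.I * θ ^ 2 * σ - 2 * Real.pi * Complex.I * s * θ) *
        jacobiTheta₂ (s - θ * σ) σ := by
    rw [jacobiTheta₂, ← tsum_mul_left]
    refine tsum_congr fun n => ?_
    rw [jacobiTheta₂_term, ← Complex.exp_add]
    congr 1
    ring
  rw [h1, h2, h, jacobiTheta₂_neg_left]
  field_simp

lemma summable_gaussian {σ : ℂ} (hσ : 0 < σ.im) (s : ℂ) :
    Summable fun j : ℤ => ‖Complex.exp (2 * Real.pi * Complex.I * j * s +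
      Real.pi * Complex.I * j ^ 2 * σ)‖ :=
  ((summable_jacobiTheta₂_term_iff s σ).2 hσ).norm

lemma neg_inv_im_pos {σ : ℂ} (hσ : 0 < σ.im) : 0 < (-1 / σ).im := by
  have hσ0 : σ ≠ 0 := by rintro rfl; simp at hσ
  have : 0 < Complex.normSq σ := Complex.normSq_pos.2 hσ0
  rw [neg_div, one_div, Complex.neg_im, Complex.inv_im]
  rw [neg_div, neg_neg]; positivity

lemma summable_gaussian_shift {σ : ℂ} (hσ : 0 < σ.im) (s : ℂ) :
    Summable fun n : ℤ => ‖Complex.exp (-(Real.pi * Complex.I * (n + s) ^ 2 / σ))‖ := by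
  have h := (summable_gaussian (neg_inv_im_pos hσ) (-(s / σ))).mul_left
    ‖Complex.exp (-(Real.pi * Complex.I * s ^ 2 / σ))‖
  refine h.congr fun n => ?_
  rw [← norm_mul, ← Complex.exp_add]
  congr 2
  field_simp
  ring

set_option maxHeartbeats 800000 in
/-- Poisson summation for the lattice `ℤ + ℤω` and its dual, the inverse different. -/
theorem poisson_oC {D : ℕ} (hD : 0 < D) {τ : ℂ} (hτ : 0 < τ.im) (P Q : ℂ) :
    ∑' p : ℤ × ℤ, e (-((oC D p + P) * (conj (oC D p) + Q) / τ)) =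
      (-Complex.I * τ / (Real.sqrt D : ℝ)) *
        ∑' p : ℤ × ℤ, thetaTerm τ P Q (dC D p) := by
  have hτ0 : τ ≠ 0 := by rintro rfl; simp at hτ
  set δ : ℂ := ((Real.sqrt D : ℝ) : ℂ) with hδ
  have hδ0 : δ ≠ 0 := sqrtC_ne_zero hD
  have hδ2 : δ ^ 2 = D := sqrtC_sq D
  have hDC : (D : ℂ) ≠ 0 := by exact_mod_cast hD.ne'
  -- `P` and `Q` are independent; with `P = p0 + i q0` and `Q = p0 - i q0` the product `(o + P)(ō +
  -- Q)` is a sum of two squares, one of which involves `n` alone.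
  set p0 : ℂ := (P + Q) / 2 with hp0
  set q0 : ℂ := (P - Q) / (2 * Complex.I) with hq0
  have hPe : P = p0 + Complex.I * q0 := by
    rw [hp0, hq0]; field_simp; ring
  have hQe : Q = p0 - Complex.I * q0 := by
    rw [hp0, hq0]; field_simp; ring
  have hconj : ∀ p, conj (oC D p) = p.1 + p.2 * ((D - Complex.I * δ) / 2) := by
    intro p
    simp only [oC, omg, map_add, map_mul, map_intCast, map_div₀, map_natCast, Complex.conj_I,
      Complex.conj_ofReal, map_ofNat, hδ]
    ring
  have ho : ∀ p, oC D p = p.1 + p.2 * ((D + Complex.I * δ) / 2) := fun p => rfl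
  have hd : ∀ p, dC D p = Complex.I / δ * (p.1 + p.2 * ((D + Complex.I * δ) / 2)) := fun p => rfl
  have hdconj : ∀ p, conj (dC D p) =
      -Complex.I / δ * (p.1 + p.2 * ((D - Complex.I * δ) / 2)) := by
    intro p
    rw [dC, map_mul, hconj, map_div₀, Complex.conj_I, Complex.conj_ofReal]
  have hτ2 : 0 < (τ / 2).im := by
    rw [show τ / 2 = ((1 / 2 : ℝ) : ℂ) * τ by push_cast; ring, Complex.im_ofReal_mul]; positivity
  have hτD : 0 < (2 * τ / D).im := by
    have : (0 : ℝ) < D := by exact_mod_cast hD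
    rw [show 2 * τ / D = ((2 / D : ℝ) : ℂ) * τ by push_cast; ring, Complex.im_ofReal_mul]
    positivity
  -- the term of the left side, factored
  have hterm : ∀ m n : ℤ, e (-((oC D (m, n) + P) * (conj (oC D (m, n)) + Q) / τ)) =
      Complex.exp (-(Real.pi * Complex.I * (n + 2 * q0 / δ) ^ 2 / (2 * τ / D))) *
      Complex.exp (-(Real.pi * Complex.I * (m + (n * D / 2 + p0)) ^ 2 / (τ / 2)) +
        2 * Real.pi * Complex.I * m * 0) := by
    intro m n
    rw [e, ← Complex.exp_add]
    congr 1
    rw [hconj, ho, hPe, hQe]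
    simp only
    field_simp
    rw [← hδ2]
    ring_nf
    simp only [Complex.I_sq]
    ring_nf
  have hsumL : Summable fun p : ℤ × ℤ => e (-((oC D p + P) * (conj (oC D p) + Q) / τ)) := by
    have h := summable_thetaTerm_mul hD (one_ne_zero) (neg_inv_im_pos hτ) (-(P / τ)) (-(Q / τ))
    have h2 := (h.of_norm).mul_left (e (-(P * Q / τ)))
    refine h2.congr fun p => ?_
    rw [thetaTerm, ← e_add]
    congr 1
    field_simp
    ring
  have hsumR : Summable fun p : ℤ × ℤ => thetaTerm τ P Q (dC D p) :=
    (summable_thetaTerm_mul hD (dScale_ne_zero hD) hτ P Q).of_norm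
  -- the mixed sum
  set F : ℤ → ℤ → ℂ := fun ξ n =>
    Complex.exp (-(Real.pi * Complex.I * (n + 2 * q0 / δ) ^ 2 / (2 * τ / D))) *
      Complex.exp (2 * Real.pi * Complex.I * ξ * (n * D / 2 + p0) +
        Real.pi * Complex.I * ξ ^ 2 * (τ / 2)) with hF
  have hsumF : Summable (Function.uncurry F) := by
    have h1 := summable_gaussian_shift hτD (2 * q0 / δ)
    have h2 := summable_gaussian hτ2 p0
    have h3 := h2.mul_of_nonneg h1 (fun _ => norm_nonneg _) (fun _ => norm_nonneg _)
    refine Summable.of_norm (h3.congr fun p => ?_)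
    simp only [Function.uncurry, hF, norm_mul]
    rw [mul_comm]
    congr 1
    have : 2 * (Real.pi : ℂ) * Complex.I * p.1 * (p.2 * D / 2 + p0) +
        Real.pi * Complex.I * (p.1 : ℂ) ^ 2 * (τ / 2) =
        ((Real.pi * p.1 * p.2 * D : ℝ) : ℂ) * Complex.I + (2 * (Real.pi : ℂ) * Complex.I * p.1 * p0 +
        Real.pi * Complex.I * (p.1 : ℂ) ^ 2 * (τ / 2)) := by push_cast; ring
    rw [this, Complex.exp_add (_ * Complex.I), norm_mul, Complex.norm_exp_ofReal_mul_I, one_mul]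
  set c1 := (-Complex.I * (τ / 2)) ^ (1 / 2 : ℂ) with hc1
  set c2 := (-Complex.I * (2 * τ / D)) ^ (1 / 2 : ℂ) with hc2
  -- Both arguments are positive multiples of `-iτ`, so the principal square roots multiply without
  -- a sign ambiguity.
  have hc : c1 * c2 = -Complex.I * τ / δ := by
    have hDR : (0 : ℝ) < D := by exact_mod_cast hD
    have e1 : -Complex.I * (τ / 2) = ((1 / 2 : ℝ) : ℂ) * (-Complex.I * τ) := by push_cast; ring
    have e2 : -Complex.I * (2 * τ / D) = ((2 / D : ℝ) : ℂ) * (-Complex.I * τ) := by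
      push_cast; ring
    have hIτ : -Complex.I * τ ≠ 0 := mul_ne_zero (neg_ne_zero.2 Complex.I_ne_zero) hτ0
    have m1 : ∀ r : ℝ, 0 < r → (r * (-Complex.I * τ)) ^ (1 / 2 : ℂ) =
        Complex.exp ((Real.log r / 2 : ℝ) + Complex.log (-Complex.I * τ) / 2) := by
      intro r hr
      rw [Complex.cpow_def_of_ne_zero (mul_ne_zero (by exact_mod_cast hr.ne') hIτ),
        Complex.log_ofReal_mul hr hIτ]
      push_cast
      ring_nf
    have hlog : Real.log (1 / 2) / 2 + Real.log (2 / D) / 2 = -Real.log (Real.sqrt D) := by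
      rw [Real.log_sqrt hDR.le, Real.log_div (by norm_num) (by norm_num),
        Real.log_div (by norm_num) hDR.ne', Real.log_one]
      ring
    rw [hc1, hc2, e1, e2, m1 _ (by norm_num), m1 _ (by positivity), ← Complex.exp_add]
    rw [show ∀ a b l : ℂ, a + l / 2 + (b + l / 2) = (a + b) + l by intros; ring,
      Complex.exp_add, Complex.exp_log hIτ, ← Complex.ofReal_add, hlog, ← Complex.ofReal_exp,
      Real.exp_neg, Real.exp_log (Real.sqrt_pos.2 hDR), hδ]
    push_cast
    field_simp
  have inner1 : ∀ n : ℤ, ∑' m : ℤ, e (-((oC D (m, n) + P) * (conj (oC D (m, n)) + Q) / τ)) =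
      c1 * ∑' ξ : ℤ, F ξ n := by
    intro n
    rw [tsum_congr (fun m => hterm m n), tsum_mul_left, tsum_gaussian_shift hτ2, mul_left_comm]
    congr 1
    rw [← tsum_mul_left]
    exact tsum_congr fun ξ => by rw [sub_zero]
  -- The first inversion (in `m`) left the character `e[ξDn/2]`; the second, in `n`, turns it into a
  -- shift of `j`, and `(j, -ξ)` are the coordinates of the dual vector.
  have inner2 : ∀ ξ : ℤ, ∑' n : ℤ, F ξ n = c2 * ∑' j : ℤ, thetaTerm τ P Q (dC D (j, -ξ)) := by
    intro ξ
    have h1 : ∀ n : ℤ, F ξ n = Complex.exp (2 * Real.pi * Complex.I * ξ * p0 +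
        Real.pi * Complex.I * ξ ^ 2 * (τ / 2)) *
        Complex.exp (-(Real.pi * Complex.I * (n + 2 * q0 / δ) ^ 2 / (2 * τ / D)) +
          2 * Real.pi * Complex.I * n * (ξ * D / 2)) := by
      intro n
      simp only [hF]
      rw [← Complex.exp_add, ← Complex.exp_add]
      congr 1
      ring
    rw [tsum_congr h1, tsum_mul_left, tsum_gaussian_shift hτD, mul_left_comm]
    congr 1
    rw [← tsum_mul_left]
    refine tsum_congr fun j => ?_
    rw [← Complex.exp_add, thetaTerm, e, hdconj, hd, hPe, hQe]
    congr 1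
    push_cast
    field_simp
    rw [← hδ2]
    ring_nf
    simp only [Complex.I_sq, Complex.I_pow_four]
    ring_nf
  have hR : ∑' p : ℤ × ℤ, thetaTerm τ P Q (dC D p) =
      ∑' ξ : ℤ, ∑' j : ℤ, thetaTerm τ P Q (dC D (j, -ξ)) := by
    rw [hsumR.tsum_prod, ← hsumR.tsum_comm (f := fun m n => thetaTerm τ P Q (dC D (m, n)))]
    exact ((Equiv.neg ℤ).tsum_eq (fun n => ∑' m : ℤ, thetaTerm τ P Q (dC D (m, n)))).symm
  rw [hR, ← hc, mul_assoc, ← tsum_mul_left, ← tsum_congr inner2, ← hsumF.tsum_comm,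
    ← tsum_mul_left, ← tsum_congr inner1, hsumL.tsum_prod]
  exact (hsumL.tsum_comm (f := fun m n => e (-((oC D (m, n) + P) * (conj (oC D (m, n)) + Q) / τ)))).symm

end Poisson

/-! ### Uniqueness of Fourier coefficients -/

section Uniqueness

lemma integral_e_int (n : ℤ) (hn : n ≠ 0) : ∫ x in (0 : ℝ)..1, e (n * x) = 0 := by
  have hc : (2 * (Real.pi : ℂ) * Complex.I * n) ≠ 0 :=
    mul_ne_zero Complex.two_pi_I_ne_zero (by exact_mod_cast hn)
  have h := integral_exp_mul_complex (a := 0) (b := 1) hc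
  simp only [e, ← mul_assoc]
  rw [h]
  have : Complex.exp (2 * (Real.pi : ℂ) * Complex.I * n * ((1 : ℝ) : ℂ)) = 1 := by
    have := e_int n
    rw [e] at this
    simpa using this
  rw [this]
  simp

/-- Multiply by `e[-n₀x]` and integrate termwise over a period; absolute summability is the
dominating bound. -/
lemma coeff_eq_zero_of_tsum_e_eq_zero {a : ℤ → ℂ} (ha : Summable fun n => ‖a n‖)
    (h : ∀ x : ℝ, ∑' n : ℤ, a n * e (n * x) = 0) (n₀ : ℤ) : a n₀ = 0 := by
  have hsum : ∀ x : ℝ, HasSum (fun n : ℤ => a n * e (((n - n₀ : ℤ) : ℂ) * x)) 0 := by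
    intro x
    have h1 : Summable fun n : ℤ => a n * e (n * x) := by
      refine Summable.of_norm (ha.congr fun n => ?_)
      have : (n : ℂ) * x = ((n * x : ℝ) : ℂ) := by push_cast; rfl
      rw [norm_mul, this, norm_e_ofReal, mul_one]
    have h2 := (h1.hasSum).mul_right (e (-(n₀ * x)))
    rw [h x, zero_mul] at h2
    refine h2.congr_fun fun n => ?_
    rw [mul_assoc, ← e_add]
    congr 2
    push_cast; ring
  have hint := intervalIntegral.hasSum_integral_of_dominated_convergence (a := 0) (b := 1)
    (μ := MeasureTheory.volume) (F := fun (n : ℤ) (x : ℝ) => a n * e (((n - n₀ : ℤ) : ℂ) * x))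
    (f := fun _ => 0) (fun n _ => ‖a n‖)
    (fun n => by
      apply Continuous.aestronglyMeasurable
      unfold e
      fun_prop)
    (fun n => Filter.Eventually.of_forall fun x _ => by
      have : (((n - n₀ : ℤ) : ℂ) * x) = (((n - n₀ : ℤ) * x : ℝ) : ℂ) := by push_cast; rfl
      rw [norm_mul, this, norm_e_ofReal, mul_one])
    (Filter.Eventually.of_forall fun x _ => ha)
    (by simp)
    (Filter.Eventually.of_forall fun x _ => hsum x)
  have h3 : ∀ n : ℤ, ∫ x in (0 : ℝ)..1, a n * e (((n - n₀ : ℤ) : ℂ) * x) =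
      if n = n₀ then a n₀ else 0 := by
    intro n
    rw [intervalIntegral.integral_const_mul]
    split_ifs with hn
    · subst hn
      simp [e_zero]
    · rw [integral_e_int _ (sub_ne_zero.2 hn), mul_zero]
  simp only [h3] at hint
  have h4 := hint.unique (hasSum_ite_eq n₀ (a n₀))
  simpa using h4.symm

/-- Uniqueness of Fourier coefficients on the torus dual to the inverse different. -/
lemma coeff_eq_zero_of_tsum_dC_eq_zero {D : ℕ} (hD : 0 < D) {g : ℤ × ℤ → ℂ}
    (hg : Summable fun p => ‖g p‖)
    (h : ∀ z : ℂ, ∑' p, g p * e (conj (dC D p) * z + dC D p * conj z) = 0) (p : ℤ × ℤ) :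
    g p = 0 := by
  have hδ := sqrtC_ne_zero hD
  have hδ2 := sqrtC_sq D
  -- In the real coordinates `z = x + yω` the trace pairing is integral in `p` and separates the
  -- variables, so the one-variable statement applies twice.
  have hz : ∀ (x y : ℝ) (p : ℤ × ℤ), conj (dC D p) * (x + y * omg D) +
      dC D p * conj ((x : ℂ) + y * omg D) = ((-p.2 * x + p.1 * y : ℝ) : ℂ) := by
    intro x y p
    simp only [dC, oC, omg, map_add, map_mul, map_intCast, map_div₀, map_natCast, Complex.conj_I,
      Complex.conj_ofReal, map_ofNat]
    push_cast
    field_simp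
    ring_nf
    simp only [Complex.I_sq]
    ring
  have h1 : ∀ x y : ℝ, ∑' m : ℤ, (∑' n : ℤ, g (m, n) * e (((-n : ℤ) : ℂ) * x)) * e (m * y) = 0 := by
    intro x y
    rw [← h (x + y * omg D), Summable.tsum_prod]
    · refine tsum_congr fun m => ?_
      rw [← tsum_mul_right]
      refine tsum_congr fun n => ?_
      rw [hz, mul_assoc, ← e_add]
      congr 2
      push_cast; ring
    · refine Summable.of_norm (hg.congr fun q => ?_)
      rw [norm_mul, hz, norm_e_ofReal, mul_one]
  have hn : ∀ (x : ℝ) (n : ℤ), ‖e (((-n : ℤ) : ℂ) * x)‖ = 1 := by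
    intro x n
    have : (((-n : ℤ) : ℂ) * x) = (((-n : ℤ) * x : ℝ) : ℂ) := by push_cast; rfl
    rw [this, norm_e_ofReal]
  have h2 : ∀ (x : ℝ) (m : ℤ), ∑' n : ℤ, g (m, n) * e (((-n : ℤ) : ℂ) * x) = 0 := by
    intro x
    refine coeff_eq_zero_of_tsum_e_eq_zero ?_ (h1 x)
    refine Summable.of_nonneg_of_le (fun _ => norm_nonneg _) (fun m => ?_) hg.prod
    refine (norm_tsum_le_tsum_norm ?_).trans (le_of_eq ?_)
    · refine (hg.prod_factor m).congr fun n => ?_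
      rw [norm_mul, hn, mul_one]
    · refine tsum_congr fun n => ?_
      rw [norm_mul, hn, mul_one]
  have h3 := coeff_eq_zero_of_tsum_e_eq_zero (a := fun n => g (p.1, -n))
    ((Equiv.neg ℤ).summable_iff.2 (hg.prod_factor p.1))
    (fun x => by
      rw [← h2 x p.1, ← (Equiv.neg ℤ).tsum_eq]
      simp) (-p.2)
  simpa using h3

end Uniqueness

/-! ### Coordinate formulas for trace and norm -/

section Arithmetic

lemma trace_dC (D : ℕ) (hD : 0 < D) (x y : ℝ) (p : ℤ × ℤ) :
    conj (dC D p) * (x + y * omg D) + dC D p * conj ((x : ℂ) + y * omg D) =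
      ((-p.2 * x + p.1 * y : ℝ) : ℂ) := by
  have hδ := sqrtC_ne_zero hD
  have hδ2 := sqrtC_sq D
  simp only [dC, oC, omg, map_add, map_mul, map_intCast, map_div₀, map_natCast, Complex.conj_I,
    Complex.conj_ofReal, map_ofNat]
  push_cast
  field_simp
  ring_nf
  simp only [Complex.I_sq]
  ring

lemma normSq_oC (D : ℕ) (p : ℤ × ℤ) :
    Complex.normSq (oC D p) = p.1 ^ 2 + D * p.1 * p.2 + (D ^ 2 + D) / 4 * p.2 ^ 2 := by
  have hδ2 : Real.sqrt D ^ 2 = D := Real.sq_sqrt (by positivity)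
  rw [Complex.normSq_apply, oC_re, oC_im]
  linear_combination ((p.2 : ℝ) ^ 2 / 4) * hδ2

lemma dC_eq {D : ℕ} (hD : 0 < D) (p : ℤ × ℤ) : dC D p =
    ((-p.2 / 2 : ℝ) : ℂ) + (((p.1 + p.2 * (D / 2)) / Real.sqrt D : ℝ) : ℂ) * Complex.I := by
  have hδ := sqrtC_ne_zero hD
  simp only [dC, oC, omg]
  push_cast
  field_simp
  ring_nf
  simp only [Complex.I_sq]
  ring

lemma dC_re {D : ℕ} (hD : 0 < D) (p : ℤ × ℤ) : (dC D p).re = -p.2 / 2 := by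
  rw [dC_eq hD, ← Complex.mk_eq_add_mul_I]

lemma dC_im {D : ℕ} (hD : 0 < D) (p : ℤ × ℤ) :
    (dC D p).im = (p.1 + p.2 * (D / 2)) / Real.sqrt D := by
  rw [dC_eq hD, ← Complex.mk_eq_add_mul_I]

lemma four_dvd_sq_add {D : ℕ} (h : D % 4 = 0 ∨ D % 4 = 3) : ∃ q : ℤ, (D : ℤ) ^ 2 + D = 4 * q := by
  have : (D ^ 2 + D) % 4 = 0 := by
    rw [Nat.add_mod, Nat.pow_mod]
    rcases h with h | h <;> rw [h]
  obtain ⟨q, hq⟩ := Nat.dvd_of_mod_eq_zero this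
  exact ⟨q, by exact_mod_cast hq⟩

end Arithmetic

/-! ### Arithmetic of the inverse different and its quotient -/

section Lattice

variable {K : Type*} [Field K] {ι : K →+* ℂ} {D : ℕ}

namespace IsQuadLattice

lemma oC_mem (h : IsQuadLattice ι D) (p : ℤ × ℤ) : oC D p ∈ intC ι :=
  (h.mem_iff _).2 ⟨p.1, p.2, rfl⟩

lemma exists_oC (h : IsQuadLattice ι D) {a : ℂ} (ha : a ∈ intC ι) : ∃ p, a = oC D p := by
  obtain ⟨m, n, rfl⟩ := (h.mem_iff _).1 ha
  exact ⟨(m, n), rfl⟩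

lemma dC_mem (h : IsQuadLattice ι D) (p : ℤ × ℤ) : dC D p ∈ invDiff ι D :=
  ⟨oC D p, h.oC_mem p, rfl⟩

lemma exists_dC (h : IsQuadLattice ι D) {a : ℂ} (ha : a ∈ invDiff ι D) : ∃ p, a = dC D p := by
  obtain ⟨b, hb, rfl⟩ := ha
  obtain ⟨p, rfl⟩ := h.exists_oC hb
  exact ⟨p, rfl⟩

lemma isFundamental (h : IsQuadLattice ι D) : IsFundamental D := ⟨h.pos, h.mod_four, h.fundamental⟩

end IsQuadLattice

lemma oC_injective {D : ℕ} (hD : 0 < D) : Function.Injective (oC D) := by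
  have hs : 0 < Real.sqrt D := Real.sqrt_pos.2 (by exact_mod_cast hD)
  intro p q hpq
  have h1 := congrArg Complex.im hpq
  rw [oC_im, oC_im] at h1
  have h2 : (p.2 : ℝ) = q.2 := mul_right_cancel₀ (by positivity) h1
  have h3 := congrArg Complex.re hpq
  rw [oC_re, oC_re, h2] at h3
  have h4 : (p.1 : ℝ) = q.1 := add_right_cancel h3
  exact Prod.ext (by exact_mod_cast h4) (by exact_mod_cast h2)

lemma dC_injective {D : ℕ} (hD : 0 < D) : Function.Injective (dC D) := fun _ _ hpq =>
  oC_injective hD (mul_left_cancel₀ (dScale_ne_zero hD) hpq)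

/-- Coordinates on the inverse different. -/
def invDiffEquiv (h : IsQuadLattice ι D) : ℤ × ℤ ≃ invDiff ι D :=
  Equiv.ofBijective (fun p => ⟨dC D p, h.dC_mem p⟩)
    ⟨fun _ _ hpq => dC_injective h.pos (congrArg Subtype.val hpq), fun ⟨a, ha⟩ => by
      obtain ⟨p, rfl⟩ := h.exists_dC ha
      exact ⟨p, rfl⟩⟩

lemma invDiffEquiv_coe (h : IsQuadLattice ι D) (p : ℤ × ℤ) : (invDiffEquiv h p : ℂ) = dC D p := rfl

/-- The trace form `t̄ s + t s̄`. -/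
def trp (t s : ℂ) : ℂ := conj t * s + t * conj s

lemma trp_neg_right (a b : ℂ) : trp a (-b) = -trp a b := by
  simp only [trp, map_neg]; ring

lemma trp_comm (a b : ℂ) : trp a b = trp b a := by
  simp only [trp]; ring

lemma trp_int_mul (n : ℤ) (a b : ℂ) : trp a (n * b) = n * trp a b := by
  simp only [trp, map_mul, map_intCast]; ring

lemma trp_real (a b : ℂ) : trp a b = ((2 * (conj a * b).re : ℝ) : ℂ) := by
  have : trp a b = conj a * b + conj (conj a * b) := by simp [trp]
  rw [this, Complex.add_conj]

namespace IsQuadLattice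

lemma trp_int (h : IsQuadLattice ι D) {t s : ℂ} (ht : t ∈ invDiff ι D) (hs : s ∈ intC ι) :
    ∃ n : ℤ, trp t s = n := by
  obtain ⟨p, rfl⟩ := h.exists_dC ht
  obtain ⟨q, rfl⟩ := h.exists_oC hs
  refine ⟨-p.2 * q.1 + p.1 * q.2, ?_⟩
  have := trace_dC D h.pos q.1 q.2 p
  simp only [Complex.ofReal_intCast] at this
  rw [trp, oC, this]
  push_cast; ring

lemma normSq_int (h : IsQuadLattice ι D) {s : ℂ} (hs : s ∈ intC ι) :
    ∃ n : ℤ, Complex.normSq s = n := by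
  obtain ⟨q, rfl⟩ := h.exists_oC hs
  obtain ⟨r, hr⟩ := four_dvd_sq_add h.mod_four
  refine ⟨q.1 ^ 2 + D * q.1 * q.2 + r * q.2 ^ 2, ?_⟩
  rw [normSq_oC]
  have : (D : ℝ) ^ 2 + D = 4 * r := by exact_mod_cast hr
  rw [this]; push_cast; ring

lemma normSq_invDiff (h : IsQuadLattice ι D) {s : ℂ} (hs : s ∈ invDiff ι D) :
    ∃ n : ℤ, (D : ℝ) * Complex.normSq s = n := by
  obtain ⟨q, rfl⟩ := h.exists_dC hs
  obtain ⟨n, hn⟩ := h.normSq_int (h.oC_mem q)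
  refine ⟨n, ?_⟩
  have hD : (0 : ℝ) < D := by exact_mod_cast h.pos
  rw [← hn, dC, map_mul, map_div₀, Complex.normSq_I, Complex.normSq_ofReal,
    Real.mul_self_sqrt hD.le]
  field_simp

/-- `𝓞_K` is contained in the inverse different. -/
lemma int_le (h : IsQuadLattice ι D) {s : ℂ} (hs : s ∈ intC ι) : s ∈ invDiff ι D := by
  obtain ⟨q, rfl⟩ := h.exists_oC hs
  obtain ⟨r, hr⟩ := four_dvd_sq_add h.mod_four
  have hs0 : 0 < Real.sqrt D := Real.sqrt_pos.2 (by exact_mod_cast h.pos)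
  have hδ2 : Real.sqrt D ^ 2 = D := Real.sq_sqrt (by positivity)
  have hr' : (D : ℝ) ^ 2 + D = 4 * r := by exact_mod_cast hr
  have : oC D q = dC D (q.1 * D + 2 * r * q.2, -(2 * q.1 + q.2 * D)) := by
    apply Complex.ext
    · rw [oC_re, dC_re h.pos]; push_cast; ring
    · rw [oC_im, dC_im h.pos]; push_cast; field_simp
      linear_combination (q.2 : ℝ) * hδ2 + (q.2 : ℝ) * hr'
  rw [this]
  exact h.dC_mem _

lemma D_mul_mem (h : IsQuadLattice ι D) {s : ℂ} (hs : s ∈ invDiff ι D) : (D : ℂ) * s ∈ intC ι := by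
  obtain ⟨q, rfl⟩ := h.exists_dC hs
  obtain ⟨r, hr⟩ := four_dvd_sq_add h.mod_four
  have hs0 : 0 < Real.sqrt D := Real.sqrt_pos.2 (by exact_mod_cast h.pos)
  have hδ2 : Real.sqrt D ^ 2 = D := Real.sq_sqrt (by positivity)
  have hr' : (D : ℝ) ^ 2 + D = 4 * r := by exact_mod_cast hr
  have hnat : ((D : ℕ) : ℂ) = ((D : ℝ) : ℂ) := by simp
  have : (D : ℂ) * dC D q = oC D (-(q.1 * D) - 2 * r * q.2, 2 * q.1 + q.2 * D) := by
    apply Complex.ext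
    · rw [hnat, Complex.re_ofReal_mul, oC_re, dC_re h.pos]; push_cast
      linear_combination (-(q.2 : ℝ) / 2) * hr'
    · rw [hnat, Complex.im_ofReal_mul, oC_im, dC_im h.pos]; push_cast; field_simp
      linear_combination -(2 * (q.1 : ℝ) + q.2 * D) * hδ2
  rw [this]
  exact h.oC_mem _

/-- The inverse different is the trace dual of `𝓞_K`. -/
lemma mem_int_of_trp (h : IsQuadLattice ι D) {s : ℂ} 
    (ht : ∀ t ∈ invDiff ι D, ∃ n : ℤ, trp s t = n) : s ∈ intC ι := by
  obtain ⟨a, ha⟩ := ht _ (h.dC_mem (1, 0))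
  obtain ⟨b, hb⟩ := ht _ (h.dC_mem (0, 1))
  have hs0 : 0 < Real.sqrt D := Real.sqrt_pos.2 (by exact_mod_cast h.pos)
  refine (h.mem_iff _).2 ⟨-b, a, ?_⟩
  set δ := Real.sqrt D with hδdef
  have hδ2 : δ ^ 2 = D := Real.sq_sqrt (by positivity)
  have d1 : dC D (1, 0) = ((1 / δ : ℝ) : ℂ) * Complex.I := by
    rw [dC_eq h.pos]; simp [← hδdef]
  have d2 : dC D (0, 1) = ((-1 / 2 : ℝ) : ℂ) + ((δ / 2 : ℝ) : ℂ) * Complex.I := by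
    rw [dC_eq h.pos]
    simp only [← hδdef, Int.cast_zero, Int.cast_one, zero_add, one_mul]
    rw [show (D : ℝ) / 2 / δ = δ / 2 by rw [← hδ2]; field_simp]
  rw [trp_real, d1] at ha
  rw [trp_real, d2] at hb
  have ha' : 2 * (conj s * (((1 / δ : ℝ) : ℂ) * Complex.I)).re = (a : ℝ) := by exact_mod_cast ha
  have hb' : 2 * (conj s * (((-1 / 2 : ℝ) : ℂ) + ((δ / 2 : ℝ) : ℂ) * Complex.I)).re = (b : ℝ) := by
    exact_mod_cast hb
  simp only [Complex.mul_re, Complex.mul_im, Complex.add_re, Complex.add_im, Complex.ofReal_re,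
    Complex.ofReal_im, Complex.I_re, Complex.I_im, Complex.conj_re, Complex.conj_im] at ha' hb'
  have e1 : s.im = a * (δ / 2) := by
    field_simp at ha' ⊢
    linarith
  apply Complex.ext
  · simp only [Complex.add_re, Complex.intCast_re, Complex.mul_re, Complex.intCast_im, omg_re,
        zero_mul, sub_zero]
    push_cast
    rw [← hδ2]
    nlinarith
  · simp only [Complex.add_im, Complex.intCast_im, Complex.mul_im, Complex.intCast_re, omg_im,
        zero_mul, add_zero, zero_add]
    rw [e1]

/-- Membership of a class. -/
lemma mk_eq_mk_iff {a b : invDiff ι D} :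
    (QuotientAddGroup.mk a : discGroup ι D) = QuotientAddGroup.mk b ↔ (b : ℂ) - a ∈ intC ι := by
  rw [QuotientAddGroup.eq, AddSubgroup.mem_addSubgroupOf]
  simp [neg_add_eq_sub]

/-- `D` times the inverse different lies in the ring of integers, so coordinates reduced modulo `D`
represent every class. -/
lemma finite (h : IsQuadLattice ι D) : Finite (discGroup ι D) := by
  refine Finite.of_surjective (fun p : Fin D × Fin D =>
    (QuotientAddGroup.mk (⟨dC D ((p.1 : ℕ), (p.2 : ℕ)), h.dC_mem _⟩ : invDiff ι D) :
      discGroup ι D)) ?_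
  intro q
  obtain ⟨⟨a, ha⟩, rfl⟩ := QuotientAddGroup.mk_surjective q
  obtain ⟨p, rfl⟩ := h.exists_dC ha
  have hD : (0 : ℤ) < D := by exact_mod_cast h.pos
  have key : ∀ n : ℤ, ∃ i : Fin D, n = D * (n / D) + (i : ℕ) := fun n => by
    have h1 := Int.emod_nonneg n hD.ne'
    have h2 := Int.emod_lt_of_pos n hD
    refine ⟨⟨(n % D).toNat, by omega⟩, ?_⟩
    have := Int.mul_ediv_add_emod n D
    simp only [Int.toNat_of_nonneg h1]
    omega
  obtain ⟨i, hi⟩ := key p.1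
  obtain ⟨j, hj⟩ := key p.2
  refine ⟨(i, j), mk_eq_mk_iff.2 ?_⟩
  have : dC D p - dC D ((i : ℕ), (j : ℕ)) = (D : ℂ) * dC D (p.1 / D, p.2 / D) := by
    have e1 : (p.1 : ℂ) = D * ((p.1 / D : ℤ) : ℂ) + (i : ℕ) := by exact_mod_cast congrArg (fun n : ℤ => (n : ℂ)) hi
    have e2 : (p.2 : ℂ) = D * ((p.2 / D : ℤ) : ℂ) + (j : ℕ) := by exact_mod_cast congrArg (fun n : ℤ => (n : ℂ)) hj
    simp only [dC, oC]
    rw [e1, e2]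
    push_cast
    ring
  show dC D p - dC D ((i : ℕ), (j : ℕ)) ∈ intC ι
  rw [this]
  exact h.D_mul_mem (h.dC_mem _)

end IsQuadLattice

end Lattice

/-! ### Slash actions of the modular group -/

section Slash

/-- The automorphy factor `cτ + d`. -/
def jac (A : SL(2, ℤ)) (τ : ℂ) : ℂ := (A 1 0 : ℂ) * τ + A 1 1

lemma jac_ne_zero (A : SL(2, ℤ)) (τ : ℍ) : jac A τ ≠ 0 := by
  have := UpperHalfPlane.denom_ne_zero (A : GL (Fin 2) ℝ) τ
  simpa [jac, UpperHalfPlane.denom] using this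

lemma coe_smul_eq (A : SL(2, ℤ)) (τ : ℍ) :
    ((A • τ : ℍ) : ℂ) = ((A 0 0 : ℂ) * τ + A 0 1) / jac A τ := by
  rw [UpperHalfPlane.coe_specialLinearGroup_apply]
  simp [jac]

lemma slashMat_apply (k : ℤ) (A : SL(2, ℤ)) (φ : ℍ → ℂ → ℂ → ℂ) (τ : ℍ) (z w : ℂ) :
    slashMat k 1 1 A φ τ z w = jac A τ ^ (-k) * e (-((A 1 0 : ℂ) * z * w / jac A τ)) *
      φ (A • τ) (z / jac A τ) (w / jac A τ) := by
  simp [slashMat, jac]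

lemma det_eq (A : SL(2, ℤ)) : (A 0 0 : ℂ) * A 1 1 - (A 0 1 : ℂ) * A 1 0 = 1 := by
  have := A.det_coe
  rw [Matrix.det_fin_two] at this
  exact_mod_cast congrArg (fun n : ℤ => (n : ℂ)) this

lemma mul_apply_SL (A B : SL(2, ℤ)) (i j : Fin 2) :
    (A * B) i j = A i 0 * B 0 j + A i 1 * B 1 j := by
  simp [Matrix.SpecialLinearGroup.coe_mul, Matrix.mul_apply, Fin.sum_univ_two]

lemma jac_mul (A B : SL(2, ℤ)) (τ : ℍ) :
    jac (A * B) τ = jac A ((B • τ : ℍ) : ℂ) * jac B τ := by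
  have h := jac_ne_zero B τ
  rw [jac, jac, coe_smul_eq, mul_apply_SL, mul_apply_SL]
  field_simp
  rw [jac]
  push_cast
  ring

/-- The slash operator on functions on the upper half plane. -/
def ellSlash (κ : ℤ) (A : SL(2, ℤ)) (f : ℍ → ℂ) (τ : ℍ) : ℂ := jac A τ ^ (-κ) * f (A • τ)

lemma ellSlash_mul (κ : ℤ) (A B : SL(2, ℤ)) (f : ℍ → ℂ) :
    ellSlash κ (A * B) f = ellSlash κ B (ellSlash κ A f) := by
  ext τ
  rw [ellSlash, ellSlash, ellSlash, jac_mul, mul_zpow, mul_smul]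
  ring

lemma slashMat_mul (k : ℤ) (A B : SL(2, ℤ)) (φ : ℍ → ℂ → ℂ → ℂ) :
    slashMat k 1 1 (A * B) φ = slashMat k 1 1 B (slashMat k 1 1 A φ) := by
  funext τ z w
  have hB := jac_ne_zero B τ
  have hA := jac_ne_zero A (B • τ)
  have hAB := jac_ne_zero (A * B) τ
  rw [slashMat_apply, slashMat_apply, slashMat_apply, jac_mul, mul_zpow, mul_smul]
  have h1 : z / (jac A ((B • τ : ℍ) : ℂ) * jac B τ) = z / jac B τ / jac A ((B • τ : ℍ) : ℂ) := by
    field_simp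
  have h2 : w / (jac A ((B • τ : ℍ) : ℂ) * jac B τ) = w / jac B τ / jac A ((B • τ : ℍ) : ℂ) := by
    field_simp
  have h3 : e (-(((A * B) 1 0 : ℂ) * z * w / (jac A ((B • τ : ℍ) : ℂ) * jac B τ))) =
      e (-((B 1 0 : ℂ) * z * w / jac B τ)) *
        e (-((A 1 0 : ℂ) * (z / jac B τ) * (w / jac B τ) / jac A ((B • τ : ℍ) : ℂ))) := by
    rw [← e_add]
    congr 1
    have hdet := det_eq B
    -- The cocycle identity for the index-1 exponential; it is here that `det B = 1` enters.
    have hc : ((A * B) 1 0 : ℂ) * jac B τ = (B 1 0 : ℂ) * (jac A ((B • τ : ℍ) : ℂ) * jac B τ) +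
        A 1 0 := by
      rw [← jac_mul, jac, jac, mul_apply_SL, mul_apply_SL]
      push_cast
      linear_combination (A 1 0 : ℂ) * hdet
    field_simp
    linear_combination (-(z * w)) * hc
  rw [h1, h2, h3]
  ring

lemma slashMat_one (k : ℤ) (φ : ℍ → ℂ → ℂ → ℂ) : slashMat k 1 1 1 φ = φ := by
  funext τ z w
  rw [slashMat_apply]
  simp [jac, e_zero]

lemma slashMat_sum {α : Type*} (s : Finset α) (k : ℤ) (A : SL(2, ℤ)) (c : α → ℂ)
    (φ : α → ℍ → ℂ → ℂ → ℂ) (τ : ℍ) (z w : ℂ) :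
    slashMat k 1 1 A (fun τ z w => ∑ i ∈ s, c i * φ i τ z w) τ z w =
      ∑ i ∈ s, c i * slashMat k 1 1 A (φ i) τ z w := by
  simp only [slashMat_apply, Finset.mul_sum]
  exact Finset.sum_congr rfl fun i _ => by ring

/-- The weight splits as `(k - 1) + 1`: the theta functions carry weight 1 and the whole index,
which is why the components have weight `k - 1`. -/
lemma slashMat_sum_fun {α : Type*} (s : Finset α) (k : ℤ) (A : SL(2, ℤ)) (f : α → ℍ → ℂ)
    (φ : α → ℍ → ℂ → ℂ → ℂ) (τ : ℍ) (z w : ℂ) :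
    slashMat k 1 1 A (fun τ z w => ∑ i ∈ s, f i τ * φ i τ z w) τ z w =
      ∑ i ∈ s, ellSlash (k - 1) A (f i) τ * slashMat 1 1 1 A (φ i) τ z w := by
  simp only [slashMat_apply, ellSlash, Finset.mul_sum]
  refine Finset.sum_congr rfl fun i _ => ?_
  have : jac A τ ^ (-k) = jac A τ ^ (-(k - 1)) * jac A τ ^ (-1 : ℤ) := by
    rw [← zpow_add₀ (jac_ne_zero A τ)]; congr 1; ring
  rw [this]
  ring

end Slash

/-! ### The representation on theta functions -/

section Theta

variable {K : Type*} [Field K] {ι : K →+* ℂ} {D : ℕ}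

/-- The class of an element of the inverse different. -/
abbrev cls (a : invDiff ι D) : discGroup ι D := QuotientAddGroup.mk a

lemma theta_eq (q : discGroup ι D) (τ : ℍ) (z w : ℂ) :
    theta ι D q τ z w = ∑' a : {a : invDiff ι D // cls a = q}, thetaTerm τ z w (a : invDiff ι D) :=
  rfl

lemma summable_thetaTerm (h : IsQuadLattice ι D) {τ : ℂ} (hτ : 0 < τ.im) (z w : ℂ) :
    Summable fun a : invDiff ι D => ‖thetaTerm τ z w a‖ := by
  rw [← (invDiffEquiv h).summable_iff]
  exact summable_thetaTerm_mul h.pos (dScale_ne_zero h.pos) hτ z w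

/-- A sum over the inverse different, arranged by classes. -/
lemma tsum_cls [Fintype (discGroup ι D)] {G : invDiff ι D → ℂ} (hG : Summable G)
    (F : discGroup ι D → ℂ) :
    Summable (fun a : invDiff ι D => F (cls a) * G a) ∧
    ∑' a : invDiff ι D, F (cls a) * G a =
      ∑ q, F q * ∑' a : {a : invDiff ι D // cls a = q}, G a := by
  have key : ∀ q : discGroup ι D, HasSum (fun a : {a : invDiff ι D // cls a = q} => F (cls a.1) * G a)
      (F q * ∑' a : {a : invDiff ι D // cls a = q}, G a) := by
    intro q
    have := ((hG.subtype {a | cls a = q}).hasSum).mul_left (F q)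
    refine this.congr_fun fun a => ?_
    have ha : cls a.1 = q := a.2
    simp [ha]
  have hsum : Summable (fun a : invDiff ι D => F (cls a) * G a) := by
    obtain ⟨C, hC⟩ : ∃ C, ∀ q, ‖F q‖ ≤ C := by
      refine ⟨∑ q, ‖F q‖, fun q => ?_⟩
      exact Finset.single_le_sum (f := fun q => ‖F q‖) (fun _ _ => norm_nonneg _) (Finset.mem_univ q)
    refine Summable.of_norm_bounded (hG.norm.mul_left C) fun a => ?_
    rw [norm_mul]
    exact mul_le_mul_of_nonneg_right (hC _) (norm_nonneg _)
  refine ⟨hsum, ?_⟩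
  have h2 := (Equiv.sigmaFiberEquiv (fun a : invDiff ι D => cls a)).tsum_eq
    (fun a : invDiff ι D => F (cls a) * G a)
  rw [← h2, Summable.tsum_sigma, tsum_fintype]
  · exact Finset.sum_congr rfl fun q _ => (key q).tsum_eq
  · exact (Equiv.sigmaFiberEquiv (fun a : invDiff ι D => cls a)).summable_iff.2 hsum

lemma tsum_theta [Fintype (discGroup ι D)] (h : IsQuadLattice ι D) (F : discGroup ι D → ℂ)
    (τ : ℍ) (z w : ℂ) :
    ∑' a : invDiff ι D, F (cls a) * thetaTerm τ z w a = ∑ q, F q * theta ι D q τ z w :=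
  (tsum_cls (summable_thetaTerm h τ.im_pos z w).of_norm F).2

/-- The coset of a class, in coordinates. -/
lemma theta_mk (h : IsQuadLattice ι D) (u : invDiff ι D) (τ : ℍ) (z w : ℂ) :
    theta ι D (cls u) τ z w = ∑' p : ℤ × ℤ, thetaTerm τ z w ((u : ℂ) + oC D p) := by
  rw [theta_eq]
  have hmem : ∀ p, (u : ℂ) + oC D p ∈ invDiff ι D := fun p =>
    (invDiff ι D).add_mem u.2 (h.int_le (h.oC_mem p))
  let E : ℤ × ℤ ≃ {a : invDiff ι D // cls a = cls u} :=
    Equiv.ofBijective (fun p => ⟨⟨(u : ℂ) + oC D p, hmem p⟩, by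
      rw [eq_comm, IsQuadLattice.mk_eq_mk_iff]
      simpa using h.oC_mem p⟩)
      ⟨fun p q hpq => by
        have := congrArg (fun a : {a : invDiff ι D // cls a = cls u} => ((a : invDiff ι D) : ℂ)) hpq
        exact oC_injective h.pos (add_left_cancel this), fun ⟨a, ha⟩ => by
        rw [eq_comm, IsQuadLattice.mk_eq_mk_iff] at ha
        obtain ⟨p, hp⟩ := h.exists_oC ha
        refine ⟨p, Subtype.ext (Subtype.ext ?_)⟩
        show (u : ℂ) + oC D p = a
        rw [← hp]; ring⟩
  exact (E.tsum_eq _).symm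

/-- `e[|u|²]` as a function of the class of `u`. -/
def qe (q : discGroup ι D) : ℂ := e (Complex.normSq (q.out : invDiff ι D))

/-- `e[tr(ū v)]` as a function of the classes of `u` and `v`. -/
def be (q r : discGroup ι D) : ℂ := e (trp (q.out : invDiff ι D) (r.out : invDiff ι D))

lemma normSq_add_eq (a b : ℂ) :
    ((Complex.normSq (a + b) : ℝ) : ℂ) = Complex.normSq a + trp a b + Complex.normSq b := by
  rw [← Complex.mul_conj, ← Complex.mul_conj, ← Complex.mul_conj, trp, map_add]; ring

/-- In `|a + x|² = |a|² + tr(āx) + |x|²` the last two terms are integers for integral `x`. -/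
lemma e_normSq_congr (h : IsQuadLattice ι D) {a b : invDiff ι D} (hab : cls a = cls b) :
    e (Complex.normSq a) = e (Complex.normSq b) := by
  rw [IsQuadLattice.mk_eq_mk_iff] at hab
  obtain ⟨n, hn⟩ := h.trp_int a.2 hab
  obtain ⟨m, hm⟩ := h.normSq_int hab
  have := normSq_add_eq (a : ℂ) (b - a)
  rw [add_sub_cancel, hn, hm] at this
  rw [this, e_add, e_add, e_int, Complex.ofReal_intCast, e_int]; simp

lemma e_trp_congr (h : IsQuadLattice ι D) {a b c d : invDiff ι D} (hab : cls a = cls b)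
    (hcd : cls c = cls d) : e (trp a c) = e (trp b d) := by
  rw [IsQuadLattice.mk_eq_mk_iff] at hab hcd
  obtain ⟨n, hn⟩ := h.trp_int a.2 hcd
  obtain ⟨m, hm⟩ := h.trp_int d.2 hab
  have e1 : trp b d = trp a c + (n + m : ℤ) := by
    push_cast
    rw [← hn, ← hm, trp_comm (d : ℂ)]
    simp only [trp, map_sub]; ring
  rw [e1, e_add, e_int, mul_one]

lemma mk_out (q : discGroup ι D) : cls (q.out : invDiff ι D) = q := QuotientAddGroup.out_eq' q

lemma qe_cls (h : IsQuadLattice ι D) (a : invDiff ι D) : qe (cls a) = e (Complex.normSq a) :=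
  e_normSq_congr h (mk_out _)

lemma be_cls (h : IsQuadLattice ι D) (a b : invDiff ι D) : be (cls a) (cls b) = e (trp a b) :=
  e_trp_congr h (mk_out _) (mk_out _)

lemma be_neg_right (h : IsQuadLattice ι D) (q r : discGroup ι D) : be q (-r) = (be q r)⁻¹ := by
  obtain ⟨a, rfl⟩ := QuotientAddGroup.mk_surjective q
  obtain ⟨b, rfl⟩ := QuotientAddGroup.mk_surjective r
  rw [← QuotientAddGroup.mk_neg, be_cls h, be_cls h, ← e_neg, AddSubgroup.coe_neg, trp_neg_right]

lemma be_comm (q r : discGroup ι D) : be q r = be r q := by rw [be, be, trp_comm]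

lemma conj_be (q r : discGroup ι D) : conj (be q r) = (be q r)⁻¹ := by
  rw [be, trp_real, conj_e_ofReal, e_neg]

lemma norm_qe (q : discGroup ι D) : ‖qe q‖ = 1 := norm_e_ofReal _

lemma theta_neg (h : IsQuadLattice ι D) (q : discGroup ι D) (τ : ℍ) (z w : ℂ) :
    theta ι D q τ (-z) (-w) = theta ι D (-q) τ z w := by
  obtain ⟨u, rfl⟩ := QuotientAddGroup.mk_surjective q
  have := theta_mk h (-u) τ z w
  change theta ι D (-cls u) τ z w = _ at this
  rw [this, theta_mk h, ← (Equiv.neg (ℤ × ℤ)).tsum_eq]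
  refine tsum_congr fun p => ?_
  have e1 : oC D (Equiv.neg (ℤ × ℤ) p) = -oC D p := by
    simp [oC]; ring
  rw [e1, thetaTerm, thetaTerm, AddSubgroup.coe_neg]
  congr 1
  simp only [map_add, map_neg]
  ring

/-- Linear independence of the theta functions at a fixed `τ`. -/
lemma theta_independent [Fintype (discGroup ι D)] (h : IsQuadLattice ι D) (τ : ℍ)
    {c c' : discGroup ι D → ℂ}
    (hc : ∀ z : ℂ, ∑ q, c q * theta ι D q τ z (conj z) = ∑ q, c' q * theta ι D q τ z (conj z)) :
    c = c' := by
  funext q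
  obtain ⟨a, rfl⟩ := QuotientAddGroup.mk_surjective q
  obtain ⟨p, rfl⟩ := (invDiffEquiv h).surjective a
  -- On `w = z̄` the dependence on `z` is a unitary character, so a relation between theta functions
  -- is a vanishing Fourier series on the torus.
  have hfac : ∀ (z : ℂ) (p : ℤ × ℤ), thetaTerm τ z (conj z) (dC D p) =
      thetaTerm τ 0 0 (dC D p) * e (conj (dC D p) * z + dC D p * conj z) := by
    intro z p
    rw [thetaTerm, thetaTerm, ← e_add]; congr 1; ring
  have hs := (summable_thetaTerm_mul h.pos (dScale_ne_zero h.pos) τ.im_pos 0 0)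
  have key := coeff_eq_zero_of_tsum_dC_eq_zero h.pos
    (g := fun p => (c (cls (invDiffEquiv h p)) - c' (cls (invDiffEquiv h p))) *
      thetaTerm τ 0 0 (dC D p)) ?_ ?_ p
  · rcases mul_eq_zero.1 key with h1 | h1
    · exact sub_eq_zero.1 h1
    · exact absurd h1 (e_ne_zero _)
  · have h1 := (tsum_cls (summable_thetaTerm h τ.im_pos 0 0).of_norm
      (fun q => c q - c' q)).1.norm
    exact (invDiffEquiv h).summable_iff.2 h1
  · intro z
    have h1 := tsum_theta h (fun q => c q - c' q) τ z (conj z)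
    simp only [sub_mul, Finset.sum_sub_distrib, hc, sub_self] at h1
    rw [← (invDiffEquiv h).tsum_eq] at h1
    refine Eq.trans (tsum_congr fun p => ?_) h1
    rw [invDiffEquiv_coe, hfac]
    ring

/-- `R` is the matrix by which `A` acts on the theta functions in weight `1`. -/
def IsThetaMatrix [Fintype (discGroup ι D)] (A : SL(2, ℤ))
    (R : Matrix (discGroup ι D) (discGroup ι D) ℂ) : Prop :=
  ∀ u τ z w, slashMat 1 1 1 A (theta ι D u) τ z w = ∑ v, R u v * theta ι D v τ z w

variable [Fintype (discGroup ι D)]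

lemma IsThetaMatrix.mul {A B : SL(2, ℤ)} {R R' : Matrix (discGroup ι D) (discGroup ι D) ℂ}
    (hA : IsThetaMatrix A R) (hB : IsThetaMatrix B R') : IsThetaMatrix (A * B) (R * R') := by
  intro u τ z w
  have : slashMat 1 1 1 A (theta ι D u) = fun τ z w => ∑ v, R u v * theta ι D v τ z w := by
    funext τ z w; exact hA u τ z w
  rw [slashMat_mul, this, slashMat_sum]
  simp only [hB _ τ z w, Matrix.mul_apply, Finset.mul_sum, Finset.sum_mul]
  rw [Finset.sum_comm]
  exact Finset.sum_congr rfl fun v _ => Finset.sum_congr rfl fun x _ => by ring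

lemma IsThetaMatrix.unique (h : IsQuadLattice ι D) {A : SL(2, ℤ)}
    {R R' : Matrix (discGroup ι D) (discGroup ι D) ℂ} (hR : IsThetaMatrix A R)
    (hR' : IsThetaMatrix A R') : R = R' := by
  ext u v
  have := theta_independent h UpperHalfPlane.I (c := R u) (c' := R' u) fun z => by
    rw [← hR u, ← hR' u]
  exact congrFun this v

lemma isThetaMatrix_one [DecidableEq (discGroup ι D)] :
    IsThetaMatrix 1 (1 : Matrix (discGroup ι D) (discGroup ι D) ℂ) := by
  intro u τ z w
  rw [slashMat_one]
  simp [Matrix.one_apply]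

lemma IsThetaMatrix.inv [DecidableEq (discGroup ι D)] {A : SL(2, ℤ)}
    {R R' : Matrix (discGroup ι D) (discGroup ι D) ℂ}
    (hA : IsThetaMatrix A R) (hR : R' * R = 1) : IsThetaMatrix A⁻¹ R' := by
  intro u τ z w
  have key : ∀ v, theta ι D v τ z w = ∑ x, R v x * slashMat 1 1 1 A⁻¹ (theta ι D x) τ z w := by
    intro v
    have h1 : slashMat 1 1 1 A (theta ι D v) = fun τ z w => ∑ x, R v x * theta ι D x τ z w := by
      funext τ z w; exact hA v τ z w
    rw [← slashMat_sum, ← h1, ← slashMat_mul, mul_inv_cancel, slashMat_one]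
  calc _ = ∑ x, (R' * R) u x * slashMat 1 1 1 A⁻¹ (theta ι D x) τ z w := by
        rw [hR]; simp [Matrix.one_apply]
    _ = _ := by
        simp only [Matrix.mul_apply, Finset.sum_mul]
        rw [Finset.sum_comm]
        refine Finset.sum_congr rfl fun v _ => ?_
        rw [key v, Finset.mul_sum]
        exact Finset.sum_congr rfl fun x _ => by ring

lemma T_zpow_smul (n : ℤ) (τ : ℍ) : ((ModularGroup.T ^ n • τ : ℍ) : ℂ) = τ + n := by
  rw [coe_smul_eq, jac, ModularGroup.coe_T_zpow]; simp

lemma isThetaMatrix_T_zpow [DecidableEq (discGroup ι D)] (h : IsQuadLattice ι D) (n : ℤ) :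
    IsThetaMatrix (ModularGroup.T ^ n) (Matrix.diagonal fun q : discGroup ι D => qe q ^ n) := by
  intro u τ z w
  have hj : jac (ModularGroup.T ^ n) τ = 1 := by simp [jac, ModularGroup.coe_T_zpow]
  have hc : ((ModularGroup.T ^ n) 1 0 : ℤ) = 0 := by rw [ModularGroup.coe_T_zpow]; simp
  rw [slashMat_apply, hj, hc]
  simp only [Matrix.diagonal_apply, ite_mul, zero_mul, Finset.sum_ite_eq, Finset.mem_univ, if_true]
  obtain ⟨a, rfl⟩ := QuotientAddGroup.mk_surjective u
  rw [theta_eq, theta_eq]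
  simp only [one_zpow, Int.cast_zero, zero_mul, neg_zero, e_zero, one_mul, div_one]
  rw [← tsum_mul_left]
  refine tsum_congr fun b => ?_
  have h1 := qe_cls h b.1
  have h2 : cls b.1 = cls a := b.2
  rw [h2] at h1
  rw [h1, thetaTerm, thetaTerm, T_zpow_smul, e, e, e, ← Complex.exp_int_mul, ← Complex.exp_add,
    ← Complex.mul_conj]
  congr 1; ring

/-- The matrix of `S`. -/
def matS : Matrix (discGroup ι D) (discGroup ι D) ℂ :=
  fun u v => -Complex.I / ((Real.sqrt D : ℝ) : ℂ) * (be v u)⁻¹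

/-- The index factor completes the square, so the coset sum is the Gaussian sum over the lattice
translated by `(a - z, ā - w)`. Poisson summation gives a sum over the inverse different, whose
dependence on `a` is the pairing `be`. -/
lemma isThetaMatrix_S (h : IsQuadLattice ι D) :
    IsThetaMatrix ModularGroup.S (matS (ι := ι) (D := D)) := by
  intro u τ z w
  have hτ := τ.ne_zero
  have hj : jac ModularGroup.S τ = τ := by simp [jac, ModularGroup.S]
  have hc : (ModularGroup.S 1 0 : ℤ) = 1 := by simp [ModularGroup.S]
  have hS : ((ModularGroup.S • τ : ℍ) : ℂ) = -1 / τ := by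
    rw [coe_smul_eq, hj]; simp [ModularGroup.S]
  rw [slashMat_apply, hj, hc]
  obtain ⟨a, rfl⟩ := QuotientAddGroup.mk_surjective u
  have hp := poisson_oC h.pos τ.im_pos ((a : ℂ) - z) (conj (a : ℂ) - w)
  rw [theta_mk h, mul_assoc, ← tsum_mul_left]
  have e1 : ∀ p : ℤ × ℤ, e (-(((1 : ℤ) : ℂ) * z * w / τ)) *
      thetaTerm ((ModularGroup.S • τ : ℍ) : ℂ) (z / τ) (w / τ) ((a : ℂ) + oC D p) =
      e (-((oC D p + ((a : ℂ) - z)) * (conj (oC D p) + (conj (a : ℂ) - w)) / τ)) := by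
    intro p
    rw [thetaTerm, ← e_add, hS]
    congr 1
    simp only [map_add]
    push_cast
    field_simp
    ring
  rw [tsum_congr e1, hp]
  have e2 : ∑' p : ℤ × ℤ, thetaTerm τ ((a : ℂ) - z) (conj (a : ℂ) - w) (dC D p) =
      ∑ q : discGroup ι D, (be q (cls a))⁻¹ * theta ι D q τ z w := by
    rw [← tsum_theta h (fun q => (be q (cls a))⁻¹), ← (invDiffEquiv h).tsum_eq,
      ← (Equiv.neg (ℤ × ℤ)).tsum_eq]
    refine tsum_congr fun p => ?_
    have e3 : dC D (Equiv.neg (ℤ × ℤ) p) = -dC D p := by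
      simp [dC, oC]; ring
    rw [e3, be_cls h, invDiffEquiv_coe, ← e_neg, thetaTerm, thetaTerm, ← e_add, trp]
    congr 1
    simp only [map_neg]
    ring
  rw [e2, Finset.mul_sum, Finset.mul_sum]
  refine Finset.sum_congr rfl fun v _ => ?_
  rw [matS]
  have := sqrtC_ne_zero h.pos
  field_simp

/-- Orthogonality of the pairing, obtained without counting classes: `S² = -1` acts in weight 1 by
`θ_u ↦ -θ_{-u}`, and this must agree with the square of the `S`-matrix. -/
lemma sum_be [DecidableEq (discGroup ι D)] (h : IsQuadLattice ι D) (u w : discGroup ι D) :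
    ∑ v, (be v u)⁻¹ * (be w v)⁻¹ = if w = -u then (D : ℂ) else 0 := by
  have h1 := (isThetaMatrix_S (ι := ι) (D := D) h).mul (isThetaMatrix_S h)
  have h2 : IsThetaMatrix (ModularGroup.S * ModularGroup.S)
      (fun u w : discGroup ι D => if w = -u then (-1 : ℂ) else 0) := by
    intro u τ z w
    have hS : ModularGroup.S * ModularGroup.S = -1 := by
      ext i j; rw [mul_apply_SL]; fin_cases i <;> fin_cases j <;> simp [ModularGroup.S]
    have hj : jac (-1) τ = -1 := by simp [jac]
    have hc : ((-1 : SL(2, ℤ)) 1 0 : ℤ) = 0 := by simp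
    rw [hS, slashMat_apply, hj, hc]
    have hact : (-1 : SL(2, ℤ)) • τ = τ := by
      rw [ModularGroup.SL_neg_smul, one_smul]
    rw [hact]
    simp [e_zero, div_neg, theta_neg h]
  have h3 := congrFun (congrFun (h1.unique h h2) u) w
  rw [Matrix.mul_apply] at h3
  simp only [matS] at h3
  have hδ := sqrtC_ne_zero h.pos
  have hδ2 := sqrtC_sq D
  have h4 : (-Complex.I / ((Real.sqrt D : ℝ) : ℂ)) ^ 2 * ∑ v, (be v u)⁻¹ * (be w v)⁻¹ =
      if w = -u then (-1 : ℂ) else 0 := by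
    rw [← h3, Finset.mul_sum]
    exact Finset.sum_congr rfl fun v _ => by ring
  rw [div_pow, hδ2, neg_sq, Complex.I_sq] at h4
  generalize ∑ v, (be v u)⁻¹ * (be w v)⁻¹ = X at h4 ⊢
  have hD : (D : ℂ) ≠ 0 := by exact_mod_cast h.pos.ne'
  split_ifs at h4 ⊢
  · field_simp at h4
    linear_combination -h4
  · field_simp at h4
    linear_combination -h4

lemma matS_unitary [DecidableEq (discGroup ι D)] (h : IsQuadLattice ι D) :
    matS (ι := ι) (D := D) * (matS (ι := ι) (D := D)).conjTranspose = 1 := by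
  ext u u'
  have hδ := sqrtC_ne_zero h.pos
  have hδ2 := sqrtC_sq D
  have hD : (D : ℂ) ≠ 0 := by exact_mod_cast h.pos.ne'
  have h1 := sum_be h u (-u')
  rw [Matrix.mul_apply]
  have h2 : ∀ v : discGroup ι D, matS u v * (matS (ι := ι) (D := D)).conjTranspose v u' =
      (1 / (D : ℂ)) * ((be v u)⁻¹ * (be (-u') v)⁻¹) := by
    intro v
    rw [Matrix.conjTranspose_apply, matS, matS, RCLike.star_def, map_mul, map_inv₀, conj_be,
      inv_inv, map_div₀, map_neg, Complex.conj_I, Complex.conj_ofReal, be_comm (-u') v,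
      be_neg_right h, inv_inv, ← hδ2]
    field_simp
    rw [Complex.I_sq]
    ring
  rw [Finset.sum_congr rfl fun v _ => h2 v, ← Finset.mul_sum, h1, Matrix.one_apply]
  simp only [neg_inj]
  by_cases huu : u = u'
  · rw [if_pos huu, if_pos huu.symm]; field_simp
  · rw [if_neg huu, if_neg (Ne.symm huu), mul_zero]

/-- Every element of the modular group acts on theta functions by a unitary matrix. -/
theorem exists_isThetaMatrix [DecidableEq (discGroup ι D)] (h : IsQuadLattice ι D) (A : SL(2, ℤ)) :
    ∃ R : Matrix (discGroup ι D) (discGroup ι D) ℂ, IsThetaMatrix A R ∧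
      R * R.conjTranspose = 1 := by
  have hA : A ∈ Subgroup.closure {ModularGroup.S, ModularGroup.T} := by
    rw [SpecialLinearGroup.SL2Z_generators]; trivial
  induction hA using Subgroup.closure_induction with
  | mem x hx =>
    rcases hx with rfl | rfl
    · exact ⟨_, isThetaMatrix_S h, matS_unitary h⟩
    · refine ⟨_, by simpa using isThetaMatrix_T_zpow h 1, ?_⟩
      rw [Matrix.diagonal_conjTranspose, Matrix.diagonal_mul_diagonal, ← Matrix.diagonal_one]
      congr 1
      funext q
      have := norm_qe q
      rw [Pi.star_apply, RCLike.star_def, Complex.mul_conj, Complex.normSq_eq_norm_sq, this]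
      simp
  | one => exact ⟨1, isThetaMatrix_one, by simp⟩
  | mul x y _ _ hx hy =>
    obtain ⟨R, hR, hR1⟩ := hx
    obtain ⟨R', hR', hR1'⟩ := hy
    refine ⟨_, hR.mul hR', ?_⟩
    rw [Matrix.conjTranspose_mul, Matrix.mul_assoc, ← Matrix.mul_assoc R', hR1', Matrix.one_mul, hR1]
  | inv x _ hx =>
    obtain ⟨R, hR, hR1⟩ := hx
    have hR2 : R.conjTranspose * R = 1 := mul_eq_one_comm.1 hR1
    exact ⟨_, hR.inv hR2, by rw [Matrix.conjTranspose_conjTranspose, hR2]⟩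

end Theta

/-! ### Translations, and `θ₀` as an eigenfunction of `Γ₀(D)` -/

section Heisenberg

variable {K : Type*} [Field K] {ι : K →+* ℂ} {D : ℕ}

lemma theta_add_mu (h : IsQuadLattice ι D) (q : discGroup ι D) (μ : invDiff ι D) (τ : ℍ) (z w : ℂ) :
    theta ι D q τ (z + μ) (w + conj (μ : ℂ)) = be q (cls μ) * theta ι D q τ z w := by
  rw [theta_eq, theta_eq, ← tsum_mul_left]
  refine tsum_congr fun a => ?_
  have h1 := be_cls h a.1 μ
  have h2 : cls a.1 = q := a.2
  rw [h2] at h1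
  rw [h1, thetaTerm, thetaTerm, ← e_add, trp]
  congr 1; ring

lemma theta_add_lam (h : IsQuadLattice ι D) (q : discGroup ι D) {l : ℂ} (hl : l ∈ intC ι) (τ : ℍ)
    (z w : ℂ) : theta ι D q τ (z + l * τ) (w + conj l * τ) =
      e (-(l * conj l * τ + conj l * z + l * w)) * theta ι D q τ z w := by
  obtain ⟨u, rfl⟩ := QuotientAddGroup.mk_surjective q
  obtain ⟨r, rfl⟩ := h.exists_oC hl
  rw [theta_mk h, theta_mk h, ← tsum_mul_left,
    ← (Equiv.addRight r).tsum_eq (fun p => e _ * thetaTerm τ z w ((u : ℂ) + oC D p))]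
  refine tsum_congr fun p => ?_
  have : oC D (Equiv.addRight r p) = oC D p + oC D r := by
    simp [oC]; ring
  rw [this, thetaTerm, thetaTerm, ← e_add]
  congr 1
  simp only [map_add]
  ring

variable [Fintype (discGroup ι D)]

/-- `θ₀` is fixed by translation by `μ` in the inverse different. Carried through `A`, this becomes
translation by `cμτ + dμ`. Since `D ∣ c`, the vector `cμ` is integral and contributes only an
automorphy factor common to all classes, while `dμ` multiplies `θ_v` by `be`. Independence then
compares coefficients. -/
lemma row_zero_mul_be (h : IsQuadLattice ι D) {A : SL(2, ℤ)} (hA : (D : ℤ) ∣ A 1 0)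
    {R : Matrix (discGroup ι D) (discGroup ι D) ℂ} (hR : IsThetaMatrix A R) (v : discGroup ι D)
    (μ ν : invDiff ι D) (hν : (ν : ℂ) = (A 1 1 : ℂ) * μ) : R 0 v * be v (cls ν) = R 0 v := by
  have key : (fun v => R 0 v * be v (cls ν)) = R 0 := by
    refine theta_independent h UpperHalfPlane.I fun z => ?_
    set τ := UpperHalfPlane.I
    obtain ⟨c', hc'⟩ := hA
    have hl : (A 1 0 : ℂ) * (μ : ℂ) ∈ intC ι := by
      have h1 := (intC ι).zsmul_mem (h.D_mul_mem μ.2) c'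
      rw [hc']
      simpa [zsmul_eq_mul, mul_assoc, mul_comm, mul_left_comm] using h1
    obtain ⟨n, hn⟩ := h.normSq_invDiff μ.2
    have hJ := jac_ne_zero A τ
    set J := jac A τ with hJdef
    have hn' : (D : ℂ) * ((μ : ℂ) * conj (μ : ℂ)) = n := by
      rw [Complex.mul_conj]; exact_mod_cast hn
    set m : ℂ := (μ : ℂ) with hm
    have e1 := hR 0 τ (z + m * J) (conj z + conj m * J)
    rw [slashMat_apply, ← hJdef] at e1
    have e2 : (z + m * J) / J = z / J + m := by field_simp
    have e3 : (conj z + conj m * J) / J = conj z / J + conj m := by field_simp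
    rw [e2, e3, theta_add_mu h] at e1
    have hbe : be (0 : discGroup ι D) (cls μ) = 1 := by
      have : (0 : discGroup ι D) = cls 0 := rfl
      rw [this, be_cls h]; simp [trp, e_zero]
    rw [hbe, one_mul] at e1
    have e4 := hR 0 τ z (conj z)
    rw [slashMat_apply, ← hJdef] at e4
    have e5 : e (-((A 1 0 : ℂ) * (z + m * J) * (conj z + conj m * J) / J)) =
        e (-(A 1 0 : ℂ) * (conj m * z + m * conj z + m * conj m * J)) *
          e (-((A 1 0 : ℂ) * z * conj z / J)) := by
      rw [← e_add]; congr 1; field_simp; ring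
    have e6 : ∀ v, theta ι D v τ (z + m * J) (conj z + conj m * J) =
        e (-(A 1 0 : ℂ) * (conj m * z + m * conj z + m * conj m * J)) *
          (be v (cls ν) * theta ι D v τ z (conj z)) := by
      intro v
      have f1 : z + m * J = (z + ν) + ((A 1 0 : ℂ) * m) * τ := by
        rw [hJdef, jac, hν]; ring
      have f2 : conj z + conj m * J = (conj z + conj (ν : ℂ)) + conj ((A 1 0 : ℂ) * m) * τ := by
        rw [hJdef, jac, hν, map_mul, map_mul, map_intCast, map_intCast]; ring
      rw [f1, f2, theta_add_lam h v hl, theta_add_mu h]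
      congr 1
      -- The two exponents differ by `c d |μ|²` up to sign, an integer because `D ∣ c` and `D|μ|²`
      -- is integral.
      have f3 : -((A 1 0 : ℂ) * m * conj ((A 1 0 : ℂ) * m) * τ +
          conj ((A 1 0 : ℂ) * m) * (z + ν) + (A 1 0 : ℂ) * m * (conj z + conj (ν : ℂ))) =
          -(A 1 0 : ℂ) * (conj m * z + m * conj z + m * conj m * J) +
            ((-(c' * A 1 1 * n) : ℤ) : ℂ) := by
        have hc2 : (A 1 0 : ℂ) = D * c' := by rw [hc']; push_cast; rfl
        rw [hJdef, jac, hν, map_mul, map_mul, map_intCast, map_intCast]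
        push_cast
        rw [← hn', hc2]; ring
      rw [f3, e_add, e_int, mul_one]
    rw [e5] at e1
    have e7 : e (-(A 1 0 : ℂ) * (conj m * z + m * conj z + m * conj m * J)) *
        ∑ v, R 0 v * theta ι D v τ z (conj z) =
        e (-(A 1 0 : ℂ) * (conj m * z + m * conj z + m * conj m * J)) *
        ∑ v, R 0 v * be v (cls ν) * theta ι D v τ z (conj z) := by
      rw [← e4, Finset.mul_sum]
      refine Eq.trans ?_ (e1.trans ?_)
      · ring
      · refine Finset.sum_congr rfl fun v _ => ?_
        rw [e6]; ring
    exact (mul_left_cancel₀ (e_ne_zero _) e7).symm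
  exact congrFun key v

/-- For `A ∈ Γ₀(D)` the function `θ₀` is an eigenfunction. -/
lemma row_zero_eq_zero (h : IsQuadLattice ι D) {A : SL(2, ℤ)} (hA : (D : ℤ) ∣ A 1 0)
    {R : Matrix (discGroup ι D) (discGroup ι D) ℂ} (hR : IsThetaMatrix A R) {v : discGroup ι D}
    (hv : v ≠ 0) : R 0 v = 0 := by
  by_contra hne
  apply hv
  obtain ⟨a, rfl⟩ := QuotientAddGroup.mk_surjective v
  have h1 : ∀ t ∈ invDiff ι D, ∃ n : ℤ, trp ((A 1 1 : ℂ) * a) t = n := by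
    intro t ht
    have hmem : (A 1 1 : ℂ) * t ∈ invDiff ι D := by
      simpa [zsmul_eq_mul] using (invDiff ι D).zsmul_mem ht (A 1 1)
    have h2 := row_zero_mul_be h hA hR (cls a) ⟨t, ht⟩ ⟨_, hmem⟩ rfl
    have h3 : be (cls a) (cls ⟨_, hmem⟩) = 1 := mul_left_cancel₀ hne (by rw [h2, mul_one])
    rw [be_cls h, e_eq_one_iff] at h3
    obtain ⟨n, hn⟩ := h3
    refine ⟨n, ?_⟩
    rw [← hn, trp_int_mul, trp_comm, trp_int_mul, trp_comm]
  have h2 := h.mem_int_of_trp h1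
  obtain ⟨c', hc'⟩ := hA
  have hdet : A 0 0 * A 1 1 - A 0 1 * A 1 0 = 1 := by
    have := A.det_coe
    rwa [Matrix.det_fin_two] at this
  -- Trace duality has put `d·a` in the ring of integers, and `D·a` always lies there; the
  -- determinant relation makes `d` and `D` coprime, so `a` is integral too.
  have h3 : (a : ℂ) = (A 0 0 : ℤ) • ((A 1 1 : ℂ) * a) - (A 0 1 * c' : ℤ) • ((D : ℂ) * a) := by
    have hd : (A 0 0 : ℂ) * A 1 1 - (A 0 1 : ℂ) * (D * c') = 1 := by
      rw [hc'] at hdet; exact_mod_cast congrArg (fun n : ℤ => (n : ℂ)) hdet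
    simp only [zsmul_eq_mul]
    push_cast
    linear_combination (-(a : ℂ)) * hd
  have h4 : (a : ℂ) ∈ intC ι := by
    rw [h3]
    exact (intC ι).sub_mem ((intC ι).zsmul_mem h2 _) ((intC ι).zsmul_mem (h.D_mul_mem a.2) _)
  exact (QuotientAddGroup.eq_zero_iff a).2 (AddSubgroup.mem_addSubgroupOf.2 h4)

end Heisenberg

/-! ### Theta series at the cusp -/

section Limit

/-- Only the zero vector survives as `Y → ∞`, the terms at `Y = 1` serving as the dominating series.
The second elliptic variable is the conjugate of the first, so the linear part of the exponent is
real and does not affect absolute values. -/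
lemma tendsto_tsum_thetaTerm {D : ℕ} (hD : 0 < D) (x : ℝ) (P : ℂ) :
    Filter.Tendsto (fun Y : ℝ => ∑' p : ℤ × ℤ, thetaTerm (x + Y * Complex.I) P (conj P) (dC D p))
      Filter.atTop (nhds 1) := by
  have hnorm : ∀ (Y : ℝ) (p : ℤ × ℤ), ‖thetaTerm (x + Y * Complex.I) P (conj P) (dC D p)‖ =
      Real.exp (-(2 * Real.pi * (Complex.normSq (dC D p) * Y))) := by
    intro Y p
    rw [thetaTerm, norm_e, add_assoc]
    have := trp_real (dC D p) P
    rw [trp] at this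
    rw [this, Complex.mul_conj, Complex.add_im, Complex.im_ofReal_mul]
    simp
  have hsum := summable_thetaTerm_mul hD (dScale_ne_zero hD) (τ := (x + (1 : ℝ) * Complex.I))
    (by simp) P (conj P)
  have hlim : ∑' p : ℤ × ℤ, (if p = 0 then (1 : ℂ) else 0) = 1 := by
    rw [tsum_ite_eq]
  rw [← hlim]
  refine tendsto_tsum_of_dominated_convergence hsum (fun p => ?_) ?_
  · split_ifs with hp
    · subst hp
      have : ∀ Y : ℝ, thetaTerm (x + Y * Complex.I) P (conj P) (dC D 0) = 1 := by
        intro Y; simp [thetaTerm, dC, oC, e_zero]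
      simp only [this]
      exact tendsto_const_nhds
    · rw [tendsto_zero_iff_norm_tendsto_zero]
      simp only [hnorm]
      have hne : dC D p ≠ 0 := fun h0 => hp (dC_injective hD (by rw [h0]; simp [dC, oC]))
      have hpos : 0 < Complex.normSq (dC D p) := Complex.normSq_pos.2 hne
      refine Real.tendsto_exp_neg_atTop_nhds_zero.comp ?_
      have h1 : 0 < 2 * Real.pi * Complex.normSq (dC D p) := by have := Real.pi_pos; positivity
      refine (Filter.tendsto_id.const_mul_atTop h1).congr fun Y => ?_
      simp; ring
  · filter_upwards [Filter.eventually_ge_atTop 1] with Y hY p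
    have := hnorm 1 p
    rw [dC] at this
    rw [this, ← dC, hnorm, Real.exp_le_exp]
    have h1 := Complex.normSq_nonneg (dC D p)
    have := Real.pi_pos
    have h2 : Complex.normSq (dC D p) * 1 ≤ Complex.normSq (dC D p) * Y :=
      mul_le_mul_of_nonneg_left hY h1
    nlinarith

end Limit

/-! ### The eigenvalue of `θ₀` through Gauss sums -/

section Gauss

variable {K : Type*} [Field K] {ι : K →+* ℂ} {D : ℕ}

lemma cls_zero : cls (0 : invDiff ι D) = 0 := rfl

lemma qe_zero (h : IsQuadLattice ι D) : qe (0 : discGroup ι D) = 1 := by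
  rw [← cls_zero, qe_cls h]; simp [e_zero]

/-- Split the lattice into classes modulo `p`. The factor `e[b|o|²/p]` is constant on each class,
and the remaining Gaussian, with the scale `i/(p²Y)` chosen so that the inverted variable is `iY`,
is transformed by Poisson summation. -/
lemma theta_zero_gauss (h : IsQuadLattice ι D) {p : ℕ} [NeZero p] (b : ℤ) {Y : ℝ} (hY : 0 < Y)
    {τ : ℍ} (hτ : (τ : ℂ) = b / p + Complex.I / (p ^ 2 * Y)) :
    theta ι D 0 τ 0 0 = ((Y : ℂ) / (Real.sqrt D : ℝ)) * ∑ r : Fin p × Fin p,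
      e (b * Complex.normSq (oC D ((r.1 : ℕ), (r.2 : ℕ))) / p) *
        ∑' t : ℤ × ℤ, thetaTerm (((0 : ℝ) : ℂ) + Y * Complex.I) (oC D ((r.1 : ℕ), (r.2 : ℕ)) / p)
          (conj (oC D ((r.1 : ℕ), (r.2 : ℕ)) / p)) (dC D t) := by
  have hp : (p : ℂ) ≠ 0 := by exact_mod_cast NeZero.ne p
  have hYC : (Y : ℂ) ≠ 0 := by exact_mod_cast hY.ne'
  have h1 := theta_mk h 0 τ 0 0
  rw [cls_zero] at h1
  simp only [AddSubgroup.coe_zero, zero_add] at h1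
  have hs : Summable fun o : ℤ × ℤ => thetaTerm τ 0 0 (oC D o) := by
    have := (summable_thetaTerm_mul h.pos one_ne_zero τ.im_pos 0 0).of_norm
    simpa using this
  let E : (ℤ × ℤ) × (Fin p × Fin p) ≃ ℤ × ℤ :=
    ((Equiv.prodProdProdComm ℤ ℤ (Fin p) (Fin p)).trans
      ((Int.divModEquiv p).symm.prodCongr (Int.divModEquiv p).symm))
  have hE : ∀ x r, E (x, r) = (x.1 * p + (r.1 : ℕ), x.2 * p + (r.2 : ℕ)) := fun x r => rfl
  have hs' : Summable fun c => thetaTerm τ 0 0 (oC D (E c)) := E.summable_iff.2 hs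
  have hs2 := (Equiv.prodComm _ _).summable_iff.2 hs'
  have hs3 : Summable fun c : (Fin p × Fin p) × (ℤ × ℤ) => thetaTerm τ 0 0 (oC D (E (c.2, c.1))) :=
    hs2
  rw [h1, ← E.tsum_eq, ← (Equiv.prodComm (Fin p × Fin p) (ℤ × ℤ)).tsum_eq]
  simp only [Equiv.prodComm_apply, Prod.swap]
  rw [hs3.tsum_prod, tsum_fintype, Finset.mul_sum]
  refine Finset.sum_congr rfl fun r _ => ?_
  set s : ℂ := oC D ((r.1 : ℕ), (r.2 : ℕ)) with hsdef
  have hYI : 0 < (((0 : ℝ) : ℂ) + Y * Complex.I).im := by simpa using hY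
  have hP := poisson_oC h.pos hYI (s / p) (conj (s / p))
  have e1 : ∀ x : ℤ × ℤ, thetaTerm τ 0 0 (oC D (E (x, r))) = e (b * Complex.normSq s / p) *
      e (-((oC D x + s / p) * (conj (oC D x) + conj (s / p)) / (((0 : ℝ) : ℂ) + Y * Complex.I))) := by
    intro x
    have hx : oC D (E (x, r)) = s + p * oC D x := by
      rw [hE, hsdef]; simp only [oC]; push_cast; ring
    obtain ⟨n, hn⟩ := h.trp_int (h.int_le (h.oC_mem ((r.1 : ℕ), (r.2 : ℕ)))) (h.oC_mem x)
    obtain ⟨m, hm⟩ := h.normSq_int (h.oC_mem x)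
    rw [← hsdef, trp] at hn
    have hm' : oC D x * conj (oC D x) = m := by rw [Complex.mul_conj, hm]; simp
    have e2 : thetaTerm τ 0 0 (oC D (E (x, r))) = e (b * Complex.normSq s / p) *
      e (-((oC D x + s / p) * (conj (oC D x) + conj (s / p)) / (((0 : ℝ) : ℂ) + Y * Complex.I))) *
        e ((b * (n + p * m) : ℤ)) := by
      rw [thetaTerm, ← e_add, ← e_add]
      congr 1
      rw [hx, hτ, ← Complex.mul_conj]
      push_cast
      rw [← hn, ← hm']
      simp only [map_add, map_mul, map_natCast, map_div₀]
      field_simp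
      ring_nf
      simp only [Complex.I_sq]
      ring
    rw [e2, e_int, mul_one]
  have e3 : (fun x : ℤ × ℤ => thetaTerm τ 0 0 (oC D (E (x, r)))) = fun x => _ := funext e1
  calc _ = ∑' x : ℤ × ℤ, thetaTerm τ 0 0 (oC D (E (x, r))) := rfl
    _ = _ := by
      rw [e3, tsum_mul_left, hP]
      have : -Complex.I * (((0 : ℝ) : ℂ) + Y * Complex.I) = Y := by
        push_cast; linear_combination (-(Y : ℂ)) * Complex.I_sq
      rw [this]
      ring

lemma sum_e_norm {D p : ℕ} [hp : Fact p.Prime] (hp2 : p ≠ 2)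
    (hD4 : D % 4 = 0 ∨ D % 4 = 3) (hpD : ¬ p ∣ D) {b : ℤ} (hb : ¬ (p : ℤ) ∣ b) :
    ∑ r : Fin p × Fin p, e (b * Complex.normSq (oC D ((r.1 : ℕ), (r.2 : ℕ))) / p) =
      (jacobiSym (-D) p : ℂ) * p := by
  obtain ⟨q, hq⟩ := four_dvd_sq_add hD4
  have hterm : ∀ i j : ℕ, e (b * Complex.normSq (oC D (i, j)) / p) =
      ZMod.stdAddChar ((b : ZMod p) * ((i : ZMod p) ^ 2 + (D : ZMod p) * (i : ZMod p) * (j : ZMod p)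
        + (q : ZMod p) * (j : ZMod p) ^ 2)) := by
    intro i j
    have h1 : (b : ZMod p) * ((i : ZMod p) ^ 2 + (D : ZMod p) * (i : ZMod p) * (j : ZMod p)
        + (q : ZMod p) * (j : ZMod p) ^ 2) =
        ((b * ((i : ℤ) ^ 2 + D * i * j + q * (j : ℤ) ^ 2) : ℤ) : ZMod p) := by push_cast; ring
    rw [h1, ZMod.stdAddChar_coe, e, normSq_oC]
    congr 1
    have hqR : (D : ℂ) ^ 2 + D = 4 * q := by exact_mod_cast hq
    push_cast
    rw [hqR]
    ring
  have hbij : Function.Bijective (fun i : Fin p => ((i : ℕ) : ZMod p)) := by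
    rw [Fintype.bijective_iff_injective_and_card]
    refine ⟨fun i j hij => ?_, by rw [ZMod.card, Fintype.card_fin]⟩
    have := (ZMod.natCast_eq_natCast_iff' _ _ _).1 hij
    rw [Nat.mod_eq_of_lt i.2, Nat.mod_eq_of_lt j.2] at this
    exact Fin.ext this
  have hDz : (D : ZMod p) ≠ 0 := by rwa [Ne, ZMod.natCast_eq_zero_iff]
  have hbz : (b : ZMod p) ≠ 0 := by rwa [Ne, ZMod.intCast_zmod_eq_zero_iff_dvd]
  have hqz : 4 * (q : ZMod p) = (D : ZMod p) ^ 2 + D := by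
    have := congrArg (fun n : ℤ => (n : ZMod p)) hq
    push_cast at this
    exact this.symm
  have hmain := sum_norm_form hp2 (ZMod.isPrimitive_stdAddChar p) hbz hDz hqz
  rw [Fintype.sum_prod_type]
  have hleg : (quadraticChar (ZMod p) (-(D : ZMod p))) = jacobiSym (-D) p := by
    rw [← jacobiSym.legendreSym.to_jacobiSym, legendreSym]
    push_cast; rfl
  rw [← hleg, ← hmain]
  refine Fintype.sum_bijective _ hbij _ _ fun i => ?_
  exact Fintype.sum_bijective _ hbij _ _ fun j => hterm i j

variable [Fintype (discGroup ι D)]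

/-- The point `τ = -1/t` with `t = c/p + iY` is sent by `A` to `b/p + i/(p²Y)`. Poisson summation at
both points and `Y → ∞` leave `R 0 0` equal to the Gauss sum of the norm form divided by `p`, that
is `(-D/p)`, which reciprocity turns into `χ(p)`. -/
lemma row_zero_prime (h : IsQuadLattice ι D) {A : SL(2, ℤ)} (hA : (D : ℤ) ∣ A 1 0)
    {R : Matrix (discGroup ι D) (discGroup ι D) ℂ} (hR : IsThetaMatrix A R)
    {p : ℕ} [hp : Fact p.Prime] (hp2 : p ≠ 2) (hpD : ¬ p ∣ D) (hAp : A 1 1 = p) :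
    R 0 0 = (chi D p : ℂ) := by
  have hp0 : (p : ℂ) ≠ 0 := by exact_mod_cast hp.out.ne_zero
  have hδ := sqrtC_ne_zero h.pos
  have hdetZ : A 0 0 * A 1 1 - A 0 1 * A 1 0 = 1 := by
    have := A.det_coe
    rwa [Matrix.det_fin_two] at this
  have hdet := det_eq A
  rw [hAp] at hdet hdetZ
  have hb : ¬ (p : ℤ) ∣ A 0 1 := by
    rintro ⟨m, hm⟩
    have : (p : ℤ) ∣ 1 := by
      rw [← hdetZ, hm]
      exact ⟨A 0 0 - m * A 1 0, by ring⟩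
    have := Int.eq_one_of_dvd_one (by positivity) this
    exact hp.out.one_lt.ne' (by exact_mod_cast this)
  set x : ℝ := (A 1 0 : ℝ) / p with hx
  set G : ℝ → ℂ := fun Y => ∑ r : Fin p × Fin p,
      e ((A 0 1 : ℂ) * Complex.normSq (oC D ((r.1 : ℕ), (r.2 : ℕ))) / p) *
        ∑' t : ℤ × ℤ, thetaTerm (((0 : ℝ) : ℂ) + Y * Complex.I) (oC D ((r.1 : ℕ), (r.2 : ℕ)) / p)
          (conj (oC D ((r.1 : ℕ), (r.2 : ℕ)) / p)) (dC D t) with hG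
  set H : ℝ → ℂ := fun Y => ∑' t : ℤ × ℤ, thetaTerm (x + Y * Complex.I) 0 (conj 0) (dC D t) with hH
  have key : ∀ Y : ℝ, 0 < Y → (1 / (p : ℂ)) * G Y = R 0 0 * H Y := by
    intro Y hY
    have hYC : (Y : ℂ) ≠ 0 := by exact_mod_cast hY.ne'
    have ht : 0 < ((x : ℂ) + Y * Complex.I).im := by simpa using hY
    set t : ℂ := (x : ℂ) + Y * Complex.I with htdef
    have ht0 : t ≠ 0 := by intro h0; rw [h0] at ht; simp at ht
    have hxC : (x : ℂ) = (A 1 0 : ℂ) / p := by rw [hx]; push_cast; rfl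
    let τ : ℍ := ⟨-1 / t, neg_inv_im_pos ht⟩
    have hτ : (τ : ℂ) = -1 / t := rfl
    have hpt : -(A 1 0 : ℂ) + p * t = p * Y * Complex.I := by
      rw [htdef, hxC]; field_simp; ring
    have hj : jac A τ = p * Y * Complex.I / t := by
      rw [jac, hτ, hAp, ← hpt]
      push_cast; field_simp
    have hAτ : ((A • τ : ℍ) : ℂ) = (A 0 1 : ℂ) / p + Complex.I / (p ^ 2 * Y) := by
      rw [coe_smul_eq, hj, hτ]
      have hI := Complex.I_ne_zero
      have e1 : (A 0 0 : ℂ) * (-1 / t) + A 0 1 = (-(A 0 0 : ℂ) + A 0 1 * t) / t := by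
        field_simp
      have e2 : -(A 0 0 : ℂ) + A 0 1 * t = -1 / p + A 0 1 * Y * Complex.I := by
        rw [htdef, hxC]; field_simp
        push_cast at hdet
        linear_combination -hdet
      rw [e1, e2]
      field_simp
      ring_nf
      simp only [Complex.I_sq]
      ring
    have h1 := hR 0 τ 0 0
    rw [slashMat_apply, Finset.sum_eq_single (0 : discGroup ι D)
      (fun v _ hv => by rw [row_zero_eq_zero h hA hR hv, zero_mul])
      (fun hn => absurd (Finset.mem_univ _) hn)] at h1
    simp only [mul_zero, zero_div, neg_zero, e_zero, mul_one] at h1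
    rw [theta_zero_gauss h (A 0 1) hY hAτ, hj] at h1
    have h2 : theta ι D 0 τ 0 0 = (-Complex.I * t / (Real.sqrt D : ℝ)) * H Y := by
      have h3 := theta_mk h 0 τ 0 0
      rw [cls_zero] at h3
      have h4 := poisson_oC h.pos ht 0 0
      rw [h3]
      simp only [hH, map_zero]
      rw [← h4]
      refine tsum_congr fun o => ?_
      rw [thetaTerm, hτ]
      congr 1
      simp only [AddSubgroup.coe_zero]
      ring_nf
    rw [h2] at h1
    have h5 : (p * Y * Complex.I / t) ^ (-1 : ℤ) * ((Y : ℂ) / (Real.sqrt D : ℝ) * G Y) =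
        R 0 0 * (-Complex.I * t / (Real.sqrt D : ℝ) * H Y) := h1
    have hI := Complex.I_ne_zero
    rw [zpow_neg_one] at h5
    field_simp at h5
    rw [Complex.I_sq] at h5
    field_simp
    linear_combination h5
  have hGlim : Filter.Tendsto (fun Y => (1 / (p : ℂ)) * G Y) Filter.atTop
      (nhds ((1 / (p : ℂ)) * ((chi D p : ℂ) * p))) := by
    refine Filter.Tendsto.const_mul _ ?_
    rw [chi_prime h.isFundamental (hp.out.odd_of_ne_two hp2),
      ← sum_e_norm hp2 h.mod_four hpD hb]
    refine tendsto_finsetSum _ fun r _ => ?_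
    have := (tendsto_tsum_thetaTerm h.pos 0 (oC D ((r.1 : ℕ), (r.2 : ℕ)) / p)).const_mul
      (e ((A 0 1 : ℂ) * Complex.normSq (oC D ((r.1 : ℕ), (r.2 : ℕ))) / p))
    rwa [mul_one] at this
  have hHlim : Filter.Tendsto (fun Y => R 0 0 * H Y) Filter.atTop (nhds (R 0 0 * 1)) :=
    Filter.Tendsto.const_mul _ (tendsto_tsum_thetaTerm h.pos x 0)
  have heq : (fun Y => (1 / (p : ℂ)) * G Y) =ᶠ[Filter.atTop] fun Y => R 0 0 * H Y := by
    filter_upwards [Filter.eventually_gt_atTop 0] with Y hY using key Y hY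
  have := tendsto_nhds_unique (hGlim.congr' heq) hHlim
  rw [mul_one] at this
  rw [← this]
  field_simp

lemma row_zero_mul (h : IsQuadLattice ι D) {A B : SL(2, ℤ)} (hA : (D : ℤ) ∣ A 1 0)
    {R R' R'' : Matrix (discGroup ι D) (discGroup ι D) ℂ} (hR : IsThetaMatrix A R)
    (hR' : IsThetaMatrix B R') (hR'' : IsThetaMatrix (A * B) R'') (v : discGroup ι D) :
    R'' 0 v = R 0 0 * R' 0 v := by
  rw [hR''.unique h (hR.mul hR'), Matrix.mul_apply, Finset.sum_eq_single (0 : discGroup ι D)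
      (fun v _ hv => by rw [row_zero_eq_zero h hA hR hv, zero_mul])
      (fun hn => absurd (Finset.mem_univ _) hn)]

/-- Right multiplication by `T^n` replaces `d` by `d + nc` without changing the eigenvalue, as
`e[|0|²] = 1`. Dirichlet's theorem makes the new entry prime, and `D ∣ c` keeps `χ` unchanged. -/
lemma row_zero_of_ne_zero [DecidableEq (discGroup ι D)] (h : IsQuadLattice ι D) {A : SL(2, ℤ)}
    (hA : (D : ℤ) ∣ A 1 0)
    {R : Matrix (discGroup ι D) (discGroup ι D) ℂ} (hR : IsThetaMatrix A R) (hc : A 1 0 ≠ 0) :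
    R 0 0 = (chi D (A 1 1) : ℂ) := by
  have hdetZ : A 0 0 * A 1 1 - A 0 1 * A 1 0 = 1 := by
    have := A.det_coe
    rwa [Matrix.det_fin_two] at this
  have hcop : IsCoprime (A 1 1) ((A 1 0).natAbs : ℤ) := by
    have : IsCoprime (A 1 1) (A 1 0) := ⟨A 0 0, -A 0 1, by linear_combination hdetZ⟩
    rcases Int.natAbs_eq (A 1 0) with h1 | h1
    · rwa [← h1]
    · have h2 : ((A 1 0).natAbs : ℤ) = -(A 1 0) := by omega
      rw [h2]; exact this.neg_right
  -- The bound `D + 2` makes `p` odd and prime to `D`.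
  obtain ⟨p, hpgt, hp, hpm⟩ := Nat.forall_exists_prime_gt_and_zmodEq (D + 2)
    (Int.natAbs_ne_zero.2 hc) hcop
  have : Fact p.Prime := ⟨hp⟩
  have hpD : ¬ p ∣ D := fun hd => by
    have := Nat.le_of_dvd h.pos hd
    omega
  obtain ⟨n, hn⟩ : (A 1 0) ∣ (p : ℤ) - A 1 1 := by
    have := hpm.symm.dvd
    rwa [Int.natAbs_dvd] at this
  have hT := isThetaMatrix_T_zpow h n
  have h10 : (A * ModularGroup.T ^ n) 1 0 = A 1 0 := by
    rw [mul_apply_SL, ModularGroup.coe_T_zpow]; simp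
  have h11 : (A * ModularGroup.T ^ n) 1 1 = p := by
    rw [mul_apply_SL, ModularGroup.coe_T_zpow]; simp; linarith
  have h1 := row_zero_prime h (by rw [h10]; exact hA) (hR.mul hT) (by omega) hpD h11
  rw [row_zero_mul h hA hR hT (hR.mul hT), Matrix.diagonal_apply_eq, qe_zero h, one_zpow,
    mul_one] at h1
  rw [h1]
  congr 1
  refine chi_congr h.mod_four ?_
  refine (Int.modEq_iff_dvd.2 ?_).symm
  exact hA.trans ⟨n, hn⟩

/-- `θ₀` transforms under `Γ₀(D)` by the character `χ`. -/
theorem row_zero_eq_chi [DecidableEq (discGroup ι D)] (h : IsQuadLattice ι D) {A : SL(2, ℤ)}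
    (hA : (D : ℤ) ∣ A 1 0)
    {R : Matrix (discGroup ι D) (discGroup ι D) ℂ} (hR : IsThetaMatrix A R) :
    R 0 0 = (chi D (A 1 1) : ℂ) := by
  by_cases hc : A 1 0 = 0
  -- With `c = 0` there is no progression to choose a prime from; multiplying by `(1 0; D 1)`, whose
  -- eigenvalue is `χ(1) = 1`, makes the entry nonzero.
  · let B : SL(2, ℤ) := ⟨!![1, 0; (D : ℤ), 1], by simp⟩
    have b10 : B 1 0 = (D : ℤ) := rfl
    have b11 : B 1 1 = 1 := rfl
    have b01 : B 0 1 = 0 := rfl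
    obtain ⟨R', hR', -⟩ := exists_isThetaMatrix h B
    have hD0 : (D : ℤ) ≠ 0 := by exact_mod_cast h.pos.ne'
    have h1 := row_zero_of_ne_zero h (by rw [b10]) hR' (by rw [b10]; exact hD0)
    have h2 : (A * B) 1 0 = A 1 1 * D := by rw [mul_apply_SL, hc, b10]; ring
    have h3 : (A * B) 1 1 = A 1 1 := by rw [mul_apply_SL, b01, b11]; ring
    have hd : A 1 1 ≠ 0 := by
      intro h0
      have := A.det_coe
      rw [Matrix.det_fin_two, h0, hc] at this
      simp at this
    have h4 := row_zero_of_ne_zero h (by rw [h2]; exact ⟨A 1 1, mul_comm _ _⟩) (hR.mul hR')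
      (by rw [h2]; exact mul_ne_zero hd hD0)
    rw [row_zero_mul h hA hR hR' (hR.mul hR'), h1, h3, b11, chi_one, Int.cast_one, mul_one] at h4
    exact h4
  · exact row_zero_of_ne_zero h hA hR hc

/-- The first row of the matrix of `(1 0; N 1)` for `N` prime to `D`. -/
theorem row_zero_lower [DecidableEq (discGroup ι D)] (h : IsQuadLattice ι D) {B : SL(2, ℤ)} {N y : ℤ}
    (hB : (B : Matrix (Fin 2) (Fin 2) ℤ) = !![1, 0; N, 1]) (hy : N * y ≡ -1 [ZMOD D])
    {R : Matrix (discGroup ι D) (discGroup ι D) ℂ} (hR : IsThetaMatrix B R) (v : discGroup ι D) :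
    R 0 v = (chi D N : ℂ) * (-Complex.I / ((Real.sqrt D : ℝ) : ℂ)) * qe v ^ (-y) := by
  -- The lower row of `A` is `(-(Ny + 1), N)`: the congruence on `y` puts `A` in `Γ₀(D)`, with
  -- eigenvalue `χ(N)`.
  obtain ⟨A, hAe⟩ : ∃ A, A = B * ModularGroup.T ^ y * ModularGroup.S⁻¹ := ⟨_, rfl⟩
  have hBe : B = A * (ModularGroup.S * ModularGroup.T ^ (-y)) := by
    rw [hAe]; group
  obtain ⟨RA, hRA, -⟩ := exists_isThetaMatrix h A
  have b10 : B 1 0 = N := by simp [hB]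
  have b11 : B 1 1 = 1 := by simp [hB]
  have hSinv : ((ModularGroup.S⁻¹ : SL(2, ℤ)) : Matrix (Fin 2) (Fin 2) ℤ) = !![0, 1; -1, 0] := by
    rw [Matrix.SpecialLinearGroup.coe_inv, ModularGroup.coe_S, Matrix.adjugate_fin_two]; simp
  have a10 : A 1 0 = -(N * y + 1) := by
    rw [hAe, mul_apply_SL, mul_apply_SL, mul_apply_SL, ModularGroup.coe_T_zpow, hSinv, b10, b11]
    simp
  have a11 : A 1 1 = N := by
    rw [hAe, mul_apply_SL, mul_apply_SL, mul_apply_SL, ModularGroup.coe_T_zpow, hSinv, b10, b11]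
    simp
  have hdvd : (D : ℤ) ∣ A 1 0 := by
    rw [a10, dvd_neg]
    have := hy.symm.dvd
    simpa using this
  have h1 := row_zero_eq_chi h hdvd hRA
  have hST := (isThetaMatrix_S h).mul (isThetaMatrix_T_zpow h (-y))
  rw [hBe] at hR
  rw [row_zero_mul h hdvd hRA hST hR, h1, a11, Matrix.mul_diagonal, matS]
  have : be v (0 : discGroup ι D) = 1 := by
    obtain ⟨a, rfl⟩ := QuotientAddGroup.mk_surjective v
    rw [← cls_zero, be_cls h]; simp [trp, e_zero]
  rw [this]
  simp [mul_assoc]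

end Gauss

/-! ### Theta components of a special Jacobi form -/

section Components

variable {K : Type*} [Field K] {ι : K →+* ℂ} {D N : ℕ} {k : ℤ} {φ : ℍ → ℂ → ℂ → ℂ}

lemma fourierCoeff_spec (hφ : IsJacobiForm ι D k 1 N φ) :
    IsFourierExpansion ι D 1 1 (fourierCoeff ι D 1 φ) φ := by
  have hex : ∃ c, IsFourierExpansion ι D 1 1 c φ := by
    obtain ⟨ν, -, hν, c, hc⟩ := hφ.fourier 1
    rw [hν rfl, slashMat_one] at hc
    exact ⟨c, hc⟩
  rw [fourierCoeff, dif_pos hex]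
  exact hex.choose_spec

lemma alphaStar_eq (hD : 0 < D) (hφ : φ ∈ specialJacobi ι D k N) {n ℓ : ℕ} {t : invDiff ι D}
    (hn : (D : ℝ) * (ℓ - Complex.normSq t) = n) :
    alphaStar ι D φ n = fourierCoeff ι D 1 φ ℓ t := by
  have hex : ∃ p : ℕ × invDiff ι D, (D : ℝ) * (p.1 - Complex.normSq p.2) = n := ⟨(ℓ, t), hn⟩
  rw [alphaStar, dif_pos hex]
  refine hφ.2 _ _ _ _ (mul_left_cancel₀ (b := (_ : ℝ)) (Nat.cast_ne_zero.2 hD.ne') ?_)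
  rw [hn, hex.choose_spec]

lemma normCong_cls_iff (h : IsQuadLattice ι D) (t : invDiff ι D) (n : ℤ) :
    NormCong ι D (cls t) n ↔ ∃ m : ℤ, (D : ℝ) * Complex.normSq t + n = D * m := by
  refine ⟨fun ⟨u, hu, m, hm⟩ => ?_, fun ⟨m, hm⟩ => ⟨t, rfl, m, hm⟩⟩
  rw [IsQuadLattice.mk_eq_mk_iff] at hu
  obtain ⟨a, ha⟩ := h.trp_int u.2 hu
  obtain ⟨b, hb⟩ := h.normSq_int hu
  have h1 := normSq_add_eq (u : ℂ) (t - u)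
  rw [add_sub_cancel, ha, hb] at h1
  have h2 : Complex.normSq (t : ℂ) = Complex.normSq (u : ℂ) + a + b := by exact_mod_cast h1
  refine ⟨m + a + b, ?_⟩
  rw [h2]
  push_cast
  linear_combination hm

/-- The partial sums of the Fourier expansion at a fixed vector of the inverse different. -/
lemma IsFourierExpansion.hasSum_fiber {ν : ℕ} {c : ℕ → invDiff ι D → ℂ} {ψ : ℍ → ℂ → ℂ → ℂ}
    (hc : IsFourierExpansion ι D 1 ν c ψ) (τ : ℍ) (z w : ℂ) :
    HasSum (fun t : invDiff ι D => (∑' ℓ : ℕ, c ℓ t * e ((ℓ : ℂ) / ν * τ)) *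
      e (conj (t : ℂ) * z + (t : ℂ) * w)) (ψ τ z w) := by
  have h1 := hc.hasSum τ z w
  have h2 := (Equiv.prodComm (invDiff ι D) ℕ).hasSum_iff.2 h1
  have h3 := h2.prod_fiberwise (fun t => (h2.summable.prod_factor t).hasSum)
  refine h3.congr_fun fun t => ?_
  rw [← tsum_mul_right]
  refine tsum_congr fun ℓ => ?_
  simp only [Equiv.prodComm_apply, Prod.swap, Function.comp]
  rw [mul_assoc, ← e_add]
  ring_nf

lemma IsFourierExpansion.summable_fiber {ν : ℕ} {c : ℕ → invDiff ι D → ℂ} {ψ : ℍ → ℂ → ℂ → ℂ}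
    (hc : IsFourierExpansion ι D 1 ν c ψ) (τ : ℍ) (t : invDiff ι D) :
    Summable fun ℓ : ℕ => ‖c ℓ t * e ((ℓ : ℂ) / ν * τ)‖ := by
  have h2 := ((Equiv.prodComm (invDiff ι D) ℕ).summable_iff.2 (hc.hasSum τ 0 0).summable).norm
  refine (h2.prod_factor t).congr fun ℓ => ?_
  simp

/-- Theta components in terms of the coefficients at a given representative. -/
lemma hasSum_thetaComponent (h : IsQuadLattice ι D) (hφ : φ ∈ specialJacobi ι D k N)
    (t : invDiff ι D) (τ : ℍ) :
    HasSum (fun n : ℕ => open Classical in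
      if NormCong ι D (cls t) n then alphaStar ι D φ n * e (n * τ / D) else 0)
      (∑' ℓ : ℕ, fourierCoeff ι D 1 φ ℓ t * e (((ℓ : ℂ) - Complex.normSq t) * τ)) := by
  classical
  have hD0 : (D : ℝ) ≠ 0 := by exact_mod_cast h.pos.ne'
  have hDC : (D : ℂ) ≠ 0 := by exact_mod_cast h.pos.ne'
  have hDR : (0 : ℝ) < D := by exact_mod_cast h.pos
  have hc := fourierCoeff_spec hφ.1
  set c := fourierCoeff ι D 1 φ with hcdef
  have hs : Summable fun ℓ : ℕ => c ℓ t * e (((ℓ : ℂ) - Complex.normSq t) * τ) := by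
    refine ((hc.summable_fiber τ t).of_norm.mul_right (e (-(Complex.normSq t * τ)))).congr
      fun ℓ => ?_
    rw [mul_assoc, ← e_add]
    congr 2
    push_cast
    ring
  obtain ⟨M, hM⟩ := h.normSq_invDiff t.2
  have hM0 : 0 ≤ M := by
    have : (0 : ℝ) ≤ M := by rw [← hM]; exact mul_nonneg hDR.le (Complex.normSq_nonneg _)
    exact_mod_cast this
  -- The support condition of the Fourier expansion gives `Dℓ ≥ M = D|t|²`, so the truncation in
  -- `(Dℓ - M).toNat` loses nothing.
  have hsup : ∀ ℓ : Function.support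
      (fun ℓ : ℕ => c ℓ t * e (((ℓ : ℂ) - Complex.normSq t) * τ)), M ≤ D * (ℓ : ℕ) := by
    intro ⟨ℓ, hℓ⟩
    have h1 := hc.support ℓ t (left_ne_zero_of_mul hℓ)
    simp only [Nat.cast_one, one_mul, mul_one] at h1
    have h2 : (M : ℝ) ≤ ((D * ℓ : ℤ) : ℝ) := by
      rw [← hM]; push_cast
      exact mul_le_mul_of_nonneg_left h1 hDR.le
    exact_mod_cast h2
  have hi : ∀ ℓ : Function.support
      (fun ℓ : ℕ => c ℓ t * e (((ℓ : ℂ) - Complex.normSq t) * τ)),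
      ((((D * (ℓ : ℕ) - M).toNat : ℕ) : ℤ)) = D * (ℓ : ℕ) - M :=
    fun ℓ => Int.toNat_of_nonneg (by have := hsup ℓ; omega)
  have hiR : ∀ ℓ : Function.support
      (fun ℓ : ℕ => c ℓ t * e (((ℓ : ℂ) - Complex.normSq t) * τ)),
      ((((D * (ℓ : ℕ) - M).toNat : ℕ) : ℝ)) = D * (ℓ : ℕ) - M := fun ℓ => by
    have := congrArg (fun n : ℤ => (n : ℝ)) (hi ℓ)
    push_cast at this
    exact_mod_cast this
  have hval : ∀ ℓ n : ℕ, (n : ℝ) = D * ℓ - M → NormCong ι D (cls t) n ∧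
      alphaStar ι D φ n * e (n * τ / D) = c ℓ t * e (((ℓ : ℂ) - Complex.normSq t) * τ) := by
    intro ℓ n hn
    refine ⟨(normCong_cls_iff h t n).2 ⟨ℓ, ?_⟩, ?_⟩
    · push_cast; rw [hM, hn]; ring
    · rw [alphaStar_eq h.pos hφ (ℓ := ℓ) (t := t) (by rw [mul_sub, hM, hn])]
      congr 2
      have hn' : (n : ℂ) = D * (ℓ - Complex.normSq t) := by
        have : (n : ℝ) = D * (ℓ - Complex.normSq t) := by rw [mul_sub, hM, hn]
        rw [← Complex.ofReal_natCast, this]; push_cast; rfl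
      rw [hn']
      field_simp
  -- The series are matched by `n = Dℓ - M`; the congruence in the definition of the component says
  -- exactly that `n` has this form.
  refine (hasSum_iff_hasSum_of_ne_zero_bij (fun ℓ => (D * (ℓ : ℕ) - M).toNat) ?_ ?_ ?_).2 hs.hasSum
  · intro ℓ ℓ' hll
    have h1 := hi ℓ
    have hll' : (D * (ℓ : ℕ) - M).toNat = (D * (ℓ' : ℕ) - M).toNat := hll
    rw [hll', hi ℓ'] at h1
    have h2 : (D : ℤ) * (ℓ' : ℕ) = D * (ℓ : ℕ) := by linarith
    have h3 : ((ℓ' : ℕ) : ℤ) = (ℓ : ℕ) :=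
      mul_left_cancel₀ (by exact_mod_cast h.pos.ne') h2
    exact Subtype.ext (by exact_mod_cast h3.symm)
  · intro n hn
    have hn' : (if NormCong ι D (cls t) n then alphaStar ι D φ n * e (n * τ / D) else 0) ≠ 0 := hn
    by_cases hcong : NormCong ι D (cls t) n
    · obtain ⟨m, hm⟩ := (normCong_cls_iff h t n).1 hcong
      rw [hM] at hm
      have hmZ : M + n = D * m := by exact_mod_cast hm
      have hm0 : 0 ≤ m := by
        have : 0 ≤ (D : ℤ) * m := by rw [← hmZ]; positivity
        exact nonneg_of_mul_nonneg_right this (by exact_mod_cast h.pos)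
      lift m to ℕ using hm0
      have hnR : (n : ℝ) = D * m - M := by
        push_cast at hm; linarith
      obtain ⟨-, hv⟩ := hval m n hnR
      rw [if_pos hcong, hv] at hn'
      refine ⟨⟨m, hn'⟩, ?_⟩
      show (D * (m : ℤ) - M).toNat = n
      have : D * (m : ℤ) - M = n := by linarith
      rw [this]; simp
    · rw [if_neg hcong] at hn'; exact absurd rfl hn'
  · intro ℓ
    obtain ⟨h1, h2⟩ := hval ℓ _ (hiR ℓ)
    rw [if_pos h1, h2]

lemma summable_thetaComponent (h : IsQuadLattice ι D) (hφ : φ ∈ specialJacobi ι D k N)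
    (q : discGroup ι D) (τ : ℍ) :
    HasSum (fun n : ℕ => open Classical in
      if NormCong ι D q n then alphaStar ι D φ n * e (n * τ / D) else 0)
      (thetaComponent ι D φ q τ) := by
  obtain ⟨t, rfl⟩ := QuotientAddGroup.mk_surjective q
  exact (hasSum_thetaComponent h hφ t τ).summable.hasSum

variable [Fintype (discGroup ι D)]

/-- The theta decomposition. -/
theorem theta_decomposition (h : IsQuadLattice ι D) (hφ : φ ∈ specialJacobi ι D k N) (τ : ℍ)
    (z w : ℂ) : φ τ z w = ∑ q, thetaComponent ι D φ q τ * theta ι D q τ z w := by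
  have h1 := (fourierCoeff_spec hφ.1).hasSum_fiber τ z w
  rw [← tsum_theta h, ← h1.tsum_eq]
  refine tsum_congr fun t => ?_
  have h2 : thetaComponent ι D φ (cls t) τ = _ := (hasSum_thetaComponent h hφ t τ).tsum_eq
  rw [h2, ← tsum_mul_right, ← tsum_mul_right]
  refine tsum_congr fun ℓ => ?_
  rw [thetaTerm, mul_assoc, mul_assoc, ← e_add, ← e_add, Complex.mul_conj]
  congr 2
  push_cast
  ring

/-- The theta components of a transform. -/
def transComponent (k : ℤ) (A : SL(2, ℤ)) (R : Matrix (discGroup ι D) (discGroup ι D) ℂ)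
    (f : discGroup ι D → ℍ → ℂ) (v : discGroup ι D) (τ : ℍ) : ℂ :=
  ∑ u, ellSlash (k - 1) A (f u) τ * R u v

lemma slashMat_decomposition (h : IsQuadLattice ι D) (hφ : φ ∈ specialJacobi ι D k N)
    {A : SL(2, ℤ)} {R : Matrix (discGroup ι D) (discGroup ι D) ℂ} (hR : IsThetaMatrix A R)
    (τ : ℍ) (z w : ℂ) : slashMat k 1 1 A φ τ z w =
      ∑ v, transComponent k A R (thetaComponent ι D φ) v τ * theta ι D v τ z w := by
  have h1 : φ = fun τ z w => ∑ q, thetaComponent ι D φ q τ * theta ι D q τ z w := by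
    funext τ z w; exact theta_decomposition h hφ τ z w
  conv_lhs => rw [h1]
  rw [slashMat_sum_fun]
  simp only [hR _ τ z w, transComponent, Finset.mul_sum, Finset.sum_mul]
  rw [Finset.sum_comm]
  exact Finset.sum_congr rfl fun v _ => Finset.sum_congr rfl fun u _ => by ring

/-- Unitarity inverts the definition of `transComponent`, which is where the complex conjugates come
from. -/
lemma ellSlash_eq_sum [DecidableEq (discGroup ι D)] {A : SL(2, ℤ)}
    {R : Matrix (discGroup ι D) (discGroup ι D) ℂ}
    (hR : R * R.conjTranspose = 1) (f : discGroup ι D → ℍ → ℂ) (u : discGroup ι D) (τ : ℍ) :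
    ellSlash (k - 1) A (f u) τ = ∑ v, conj (R u v) * transComponent k A R f v τ := by
  calc _ = ∑ x, ellSlash (k - 1) A (f x) τ * (R * R.conjTranspose) x u := by
        rw [hR]; simp [Matrix.one_apply]
    _ = _ := by
        simp only [transComponent, Matrix.mul_apply, Finset.mul_sum, Matrix.conjTranspose_apply]
        rw [Finset.sum_comm]
        refine Finset.sum_congr rfl fun v _ => Finset.sum_congr rfl fun x _ => ?_
        rw [RCLike.star_def]
        ring

lemma transComponent_of_mem (h : IsQuadLattice ι D) (hφ : φ ∈ specialJacobi ι D k N)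
    {A : SL(2, ℤ)} (hA : A ∈ CongruenceSubgroup.Gamma0 N)
    {R : Matrix (discGroup ι D) (discGroup ι D) ℂ} (hR : IsThetaMatrix A R) (v : discGroup ι D)
    (τ : ℍ) : transComponent k A R (thetaComponent ι D φ) v τ = thetaComponent ι D φ v τ := by
  have h1 := hφ.1.slash_mat 1 A hA
  simp only [Units.val_one, map_one] at h1
  refine congrFun (theta_independent h τ
    (c := fun v => transComponent k A R (thetaComponent ι D φ) v τ)
    (c' := fun v => thetaComponent ι D φ v τ) fun z => ?_) v
  rw [← slashMat_decomposition h hφ hR, h1, ← theta_decomposition h hφ]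

/-- At fixed `τ` and `w = z̄` the transformed form has two Fourier series in `z`, from its own
expansion and from the theta functions; uniqueness of coefficients equates them. -/
lemma transComponent_cls (h : IsQuadLattice ι D) (hφ : φ ∈ specialJacobi ι D k N)
    {A : SL(2, ℤ)} {R : Matrix (discGroup ι D) (discGroup ι D) ℂ} (hR : IsThetaMatrix A R)
    {ν : ℕ} {c : ℕ → invDiff ι D → ℂ} (hc : IsFourierExpansion ι D 1 ν c (slashMat k 1 1 A φ))
    (t : invDiff ι D) (τ : ℍ) :
    transComponent k A R (thetaComponent ι D φ) (cls t) τ =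
      ∑' ℓ : ℕ, c ℓ t * e (((ℓ : ℂ) / ν - Complex.normSq t) * τ) := by
  set H : discGroup ι D → ℂ := fun v => transComponent k A R (thetaComponent ι D φ) v τ with hH
  set G : invDiff ι D → ℂ := fun t => ∑' ℓ : ℕ, c ℓ t * e ((ℓ : ℂ) / ν * τ) with hG
  have hfac : ∀ (z : ℂ) (t : invDiff ι D), thetaTerm τ z (conj z) t =
      thetaTerm τ 0 0 t * e (conj (t : ℂ) * z + t * conj z) := by
    intro z p
    rw [thetaTerm, thetaTerm, ← e_add]; congr 1; ring
  have s1 : Summable fun t : invDiff ι D => H (cls t) * thetaTerm τ 0 0 t :=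
    (tsum_cls (summable_thetaTerm h τ.im_pos 0 0).of_norm H).1
  have s2 : Summable G := by simpa [e_zero] using (hc.hasSum_fiber τ 0 0).summable
  have hzero : ∀ p, G (invDiffEquiv h p) -
      H (cls (invDiffEquiv h p)) * thetaTerm τ 0 0 (invDiffEquiv h p) = 0 := by
    refine coeff_eq_zero_of_tsum_dC_eq_zero h.pos
      ((invDiffEquiv h).summable_iff.2 (s2.sub s1).norm) fun z => ?_
    have h1 := hc.hasSum_fiber τ z (conj z)
    have h2 : HasSum (fun t : invDiff ι D => H (cls t) * thetaTerm τ z (conj z) t)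
        (slashMat k 1 1 A φ τ z (conj z)) := by
      rw [slashMat_decomposition h hφ hR, ← tsum_theta h]
      exact (tsum_cls (summable_thetaTerm h τ.im_pos z (conj z)).of_norm H).1.hasSum
    have h3 := (invDiffEquiv h).hasSum_iff.2 (h1.sub h2)
    rw [sub_self] at h3
    refine Eq.trans (tsum_congr fun p => ?_) h3.tsum_eq
    have h4 := hfac z (invDiffEquiv h p)
    change (G _ - _) * e (conj (invDiffEquiv h p : ℂ) * z + (invDiffEquiv h p : ℂ) * conj z) =
      G _ * _ - H _ * thetaTerm τ z (conj z) (invDiffEquiv h p)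
    rw [h4]
    ring
  obtain ⟨p, rfl⟩ := (invDiffEquiv h).surjective t
  set t := invDiffEquiv h p
  have h1 := sub_eq_zero.1 (hzero p)
  have h2 : thetaTerm τ 0 0 t * e (-(Complex.normSq t * τ)) = 1 := by
    rw [thetaTerm, ← e_add, Complex.mul_conj, ← e_zero]
    congr 1
    ring
  have h3 : H (cls t) = G t * e (-(Complex.normSq t * τ)) := by
    rw [h1, mul_assoc, h2, mul_one]
  change H (cls t) = _
  rw [h3, hG, ← tsum_mul_right]
  refine tsum_congr fun ℓ => ?_
  rw [mul_assoc, ← e_add]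
  congr 2
  ring

/-- The condition `ν|t|² ≤ ℓ` makes all exponents non-negative, so for `Im τ ≥ 1` each term is
bounded by its absolute value at `i`, where the series converges absolutely. -/
lemma isBounded_transComponent (h : IsQuadLattice ι D) (hφ : φ ∈ specialJacobi ι D k N)
    {A : SL(2, ℤ)} {R : Matrix (discGroup ι D) (discGroup ι D) ℂ} (hR : IsThetaMatrix A R)
    (v : discGroup ι D) :
    IsBoundedAtImInfty (transComponent k A R (thetaComponent ι D φ) v) := by
  obtain ⟨t, rfl⟩ := QuotientAddGroup.mk_surjective v
  obtain ⟨ν, hν, -, c, hc⟩ := hφ.1.fourier A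
  rw [isBoundedAtImInfty_iff]
  set B : ℕ → ℝ := fun ℓ => ‖c ℓ t * e (((ℓ : ℂ) / ν - Complex.normSq t) * UpperHalfPlane.I)‖ with hB
  have hnorm : ∀ (ℓ : ℕ) (τ : ℍ), ‖c ℓ t * e (((ℓ : ℂ) / ν - Complex.normSq t) * τ)‖ =
      ‖c ℓ t‖ * Real.exp (-(2 * Real.pi * (((ℓ : ℝ) / ν - Complex.normSq t) * τ.im))) := by
    intro ℓ τ
    have : ((ℓ : ℂ) / ν - Complex.normSq t) = (((ℓ : ℝ) / ν - Complex.normSq t : ℝ) : ℂ) := by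
      push_cast; rfl
    rw [norm_mul, norm_e, this, Complex.im_ofReal_mul]
    congr 2
  have hBs : Summable B := by
    refine ((hc.summable_fiber UpperHalfPlane.I t).mul_right
      ‖e (-(Complex.normSq t * UpperHalfPlane.I))‖).congr fun ℓ => ?_
    rw [← norm_mul, mul_assoc, ← e_add, hB]
    simp only
    congr 3
    ring
  refine ⟨∑' ℓ, B ℓ, 1, fun τ hτ => ?_⟩
  rw [show transComponent k A R (thetaComponent ι D φ) (QuotientAddGroup.mk t) τ = _ from
    transComponent_cls h hφ hR hc t τ]
  refine tsum_of_norm_bounded hBs.hasSum fun ℓ => ?_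
  rw [hB]
  simp only [hnorm]
  by_cases h0 : c ℓ t = 0
  · simp [h0]
  · have h1 := hc.support ℓ t h0
    rw [Nat.cast_one, mul_one] at h1
    have hνR : (0 : ℝ) < ν := by exact_mod_cast hν
    have h2 : 0 ≤ (ℓ : ℝ) / ν - Complex.normSq t := by
      rw [sub_nonneg, le_div_iff₀ hνR, mul_comm]; exact h1
    refine mul_le_mul_of_nonneg_left (Real.exp_le_exp.2 (neg_le_neg ?_)) (norm_nonneg _)
    have hp := Real.pi_pos
    have h3 : UpperHalfPlane.I.im ≤ τ.im := by simpa using hτ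
    gcongr

/-- Theta components are bounded at all cusps. -/
lemma isBounded_ellSlash_thetaComponent (h : IsQuadLattice ι D) (hφ : φ ∈ specialJacobi ι D k N)
    (A : SL(2, ℤ)) (u : discGroup ι D) :
    IsBoundedAtImInfty (ellSlash (k - 1) A (thetaComponent ι D φ u)) := by
  classical
  obtain ⟨R, hR, hU⟩ := exists_isThetaMatrix h A
  have h1 : ellSlash (k - 1) A (thetaComponent ι D φ u) =
      fun τ => ∑ v, conj (R u v) * transComponent k A R (thetaComponent ι D φ) v τ := by
    funext τ; exact ellSlash_eq_sum hU _ u τ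
  rw [h1, ← Finset.sum_fn]
  exact Asymptotics.IsBigO.sum fun v _ =>
    (isBounded_transComponent h hφ hR v).const_mul_left _

lemma ellSlash_thetaComponent [DecidableEq (discGroup ι D)] (h : IsQuadLattice ι D)
    (hφ : φ ∈ specialJacobi ι D k N)
    {A : SL(2, ℤ)} (hA : A ∈ CongruenceSubgroup.Gamma0 N)
    {R : Matrix (discGroup ι D) (discGroup ι D) ℂ} (hR : IsThetaMatrix A R)
    (hU : R * R.conjTranspose = 1) (u : discGroup ι D) (τ : ℍ) :
    ellSlash (k - 1) A (thetaComponent ι D φ u) τ =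
      ∑ v, conj (R u v) * thetaComponent ι D φ v τ := by
  rw [ellSlash_eq_sum hU]
  exact Finset.sum_congr rfl fun v _ => by rw [transComponent_of_mem h hφ hA hR]

/-- `f₀` is equivariant under `Γ₀(DN)` with character `χ`. -/
theorem ellSlash_thetaComponent_zero (h : IsQuadLattice ι D) (hφ : φ ∈ specialJacobi ι D k N)
    {A : SL(2, ℤ)} (hN : (N : ℤ) ∣ A 1 0) (hD : (D : ℤ) ∣ A 1 0) (τ : ℍ) :
    ellSlash (k - 1) A (thetaComponent ι D φ 0) τ =
      (chi D (A 1 1) : ℂ) * thetaComponent ι D φ 0 τ := by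
  classical
  obtain ⟨R, hR, hU⟩ := exists_isThetaMatrix h A
  have hA : A ∈ CongruenceSubgroup.Gamma0 N := by
    rw [CongruenceSubgroup.Gamma0_mem, ZMod.intCast_zmod_eq_zero_iff_dvd]
    exact hN
  rw [ellSlash_thetaComponent h hφ hA hR hU, Finset.sum_eq_single (0 : discGroup ι D)
      (fun v _ hv => by rw [row_zero_eq_zero h hD hR hv, map_zero, zero_mul])
      (fun hn => absurd (Finset.mem_univ _) hn), row_zero_eq_chi h hD hR]
  simp

lemma ellSlash_lower (h : IsQuadLattice ι D) (hφ : φ ∈ specialJacobi ι D k N) {B : SL(2, ℤ)}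
    {y : ℤ} (hB : (B : Matrix (Fin 2) (Fin 2) ℤ) = !![1, 0; (N : ℤ), 1])
    (hy : (N : ℤ) * y ≡ -1 [ZMOD D]) (τ : ℍ) :
    ellSlash (k - 1) B (thetaComponent ι D φ 0) τ =
      (chi D N : ℂ) * (Complex.I / ((Real.sqrt D : ℝ) : ℂ)) *
        ∑ v, qe v ^ y * thetaComponent ι D φ v τ := by
  classical
  obtain ⟨R, hR, hU⟩ := exists_isThetaMatrix h B
  have hA : B ∈ CongruenceSubgroup.Gamma0 N := by
    rw [CongruenceSubgroup.Gamma0_mem, hB]; simp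
  rw [ellSlash_thetaComponent h hφ hA hR hU, Finset.mul_sum]
  refine Finset.sum_congr rfl fun v _ => ?_
  have hq : conj (qe v) = (qe v)⁻¹ := (Complex.inv_eq_conj (norm_qe v)).symm
  rw [row_zero_lower h hB hy hR]
  simp only [map_mul, map_intCast, map_div₀, map_neg, Complex.conj_I, neg_neg, Complex.conj_ofReal,
    map_zpow₀, hq, inv_zpow', mul_assoc]

end Components

/-! ### Elliptic forms: expansions, dilation and cusps -/

section Elliptic

lemma slash_eq_ellSlash (κ : ℤ) (γ : SL(2, ℤ)) (g : ℍ → ℂ) : g ∣[κ] γ = ellSlash κ γ g := by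
  ext τ
  rw [ModularForm.SL_slash_apply, ellSlash, mul_comm]
  congr 2

/-- Multiplication by `D` on the upper half plane. -/
def dilate {D : ℕ} (hD : 0 < D) (τ : ℍ) : ℍ :=
  ⟨(D : ℂ) * τ, by
    have : (0 : ℝ) < D := by exact_mod_cast hD
    rw [← Complex.ofReal_natCast, Complex.im_ofReal_mul]
    exact mul_pos this τ.im_pos⟩

lemma coe_dilate {D : ℕ} (hD : 0 < D) (τ : ℍ) : (dilate hD τ : ℂ) = D * τ := rfl

lemma e_nat_mul (m : ℕ) (x : ℂ) : Function.Periodic.qParam 1 x ^ m = e (m * x) := by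
  rw [Function.Periodic.qParam, ← Complex.exp_nat_mul, e]
  congr 1
  push_cast
  ring

variable {f : ℍ → ℂ} {c : ℕ → ℂ}

lemma mdiff_of_hasSum (hf : ∀ τ : ℍ, HasSum (fun m : ℕ => c m * e (m * τ)) (f τ)) : MDiff f := by
  rw [mdifferentiable_iff]
  intro z hz
  have hz' : 0 < z.im := hz
  set U : Set ℂ := {w | z.im / 2 < w.im} with hU
  have hUo : IsOpen U := isOpen_lt continuous_const Complex.continuous_im
  let τ : ℍ := ⟨((z.im / 2 : ℝ) : ℂ) * Complex.I, by simpa using hz'⟩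
  have key : DifferentiableOn ℂ (fun w : ℂ => ∑' m : ℕ, c m * e (m * w)) U := by
    refine Complex.differentiableOn_tsum_of_summable_norm (hf τ).summable.norm (fun m => ?_) hUo
      fun m w hw => ?_
    · unfold e
      fun_prop
    · rw [norm_mul, norm_mul, norm_e, norm_e]
      refine mul_le_mul_of_nonneg_left (Real.exp_le_exp.2 ?_) (norm_nonneg _)
      have h1 : ((m : ℂ) * w).im = m * w.im := by
        rw [← Complex.ofReal_natCast, Complex.im_ofReal_mul]
      have h2 : ((m : ℂ) * (τ : ℂ)).im = m * (z.im / 2) := by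
        rw [← Complex.ofReal_natCast, Complex.im_ofReal_mul]
        simp [τ]
      rw [h1, h2]
      have h3 : z.im / 2 ≤ w.im := le_of_lt hw
      have hp := Real.pi_pos
      have h4 : (m : ℝ) * (z.im / 2) ≤ m * w.im := by gcongr
      nlinarith
  have hzU : U ∈ nhds z := hUo.mem_nhds (by
    show z.im / 2 < z.im
    linarith)
  refine ((key.differentiableAt hzU).congr_of_eventuallyEq ?_).differentiableWithinAt
  filter_upwards [hzU] with w hw
  have hw0 : 0 < w.im := lt_trans (by positivity) hw
  rw [Function.comp, ofComplex_apply_of_im_pos hw0]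
  exact (hf ⟨w, hw0⟩).tsum_eq.symm

/-- Both the given series and the canonical expansion are power series at `0` of the same analytic
cusp function. -/
lemma coeff_of_hasSum (hf : ∀ τ : ℍ, HasSum (fun m : ℕ => c m * e (m * τ)) (f τ)) (m : ℕ) :
    ellCoeff f m = c m := by
  have hf' : ∀ τ : ℍ, HasSum (fun m : ℕ => c m • Function.Periodic.qParam 1 τ ^ m) (f τ) := by
    intro τ
    simpa only [e_nat_mul, smul_eq_mul] using hf τ
  have hbdd := isBoundedAtImInfty_of_hasSum_qExpansion one_pos hf'
  have hper : Function.Periodic (f ∘ ofComplex) ((1 : ℝ) : ℂ) := by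
    intro w
    by_cases hw : 0 < w.im
    · have hw1 : 0 < (w + ((1 : ℝ) : ℂ)).im := by simpa using hw
      rw [Function.comp, Function.comp, ofComplex_apply_of_im_pos hw1, ofComplex_apply_of_im_pos hw]
      refine (hf _).unique ?_
      refine (hf ⟨w, hw⟩).congr_fun fun n => ?_
      have : (n : ℂ) * (w + ((1 : ℝ) : ℂ)) = n * w + (n : ℤ) := by push_cast; ring
      show c n * e (n * (w + ((1 : ℝ) : ℂ))) = c n * e (n * w)
      rw [this, e_add, e_int, mul_one]
    -- Off the upper half plane `ofComplex` has a constant default value, so periodicity is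
    -- automatic there.
    · have hw1 : (w + ((1 : ℝ) : ℂ)).im ≤ 0 := by simpa using hw
      rw [Function.comp, Function.comp, ofComplex_apply_of_im_nonpos hw1,
        ofComplex_apply_of_im_nonpos (not_lt.1 hw)]
  have han := analyticAt_cuspFunction_zero one_pos hper (mdiff_of_hasSum hf) hbdd
  have h1 := (hasFPowerSeriesOnBall_cuspFunction one_pos han hf').hasFPowerSeriesAt
  have h2 := (hasFPowerSeriesOnBall_cuspFunction one_pos han
    (hasSum_qExpansion one_pos hper (mdiff_of_hasSum hf) hbdd)).hasFPowerSeriesAt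
  have h3 := congrArg (FormalMultilinearSeries.coeff · m) (h2.eq_formalMultilinearSeries h1)
  simpa [ellCoeff, FormalMultilinearSeries.coeff_ofScalars] using h3

lemma ellSlash_dilate {D : ℕ} (hD : 0 < D) (κ : ℤ) {γ γ' : SL(2, ℤ)} (g : ℍ → ℂ)
    (h00 : γ' 0 0 = γ 0 0) (h01 : γ' 0 1 = D * γ 0 1) (h10 : γ 1 0 = D * γ' 1 0)
    (h11 : γ' 1 1 = γ 1 1) (τ : ℍ) :
    ellSlash κ γ (fun τ => g (dilate hD τ)) τ = ellSlash κ γ' g (dilate hD τ) := by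
  have hj : jac γ' (dilate hD τ) = jac γ τ := by
    rw [jac, jac, h10, h11, coe_dilate]; push_cast; ring
  have hs : dilate hD (γ • τ) = γ' • dilate hD τ := by
    apply UpperHalfPlane.ext
    rw [coe_smul_eq, hj, coe_dilate, coe_dilate, coe_smul_eq, h00, h01]
    push_cast
    ring
  rw [ellSlash, ellSlash, hj, hs]

/-- Factor `diag(D, 1) γ = A (m b; 0 d)` with `A` in the modular group and `m, d > 0`. The
triangular part sends `i∞` to itself, so boundedness of the slash by `A` is enough. -/
lemma isBounded_ellSlash_dilate {D : ℕ} (hD : 0 < D) (κ : ℤ) {g : ℍ → ℂ}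
    (hg : ∀ A, IsBoundedAtImInfty (ellSlash κ A g)) (γ : SL(2, ℤ)) :
    IsBoundedAtImInfty (ellSlash κ γ (fun τ => g (dilate hD τ))) := by
  have hdet : γ 0 0 * γ 1 1 - γ 0 1 * γ 1 0 = 1 := by
    have := γ.det_coe
    rwa [Matrix.det_fin_two] at this
  have hDZ : (0 : ℤ) < D := by exact_mod_cast hD
  -- The gcd of the first column of `diag(D, 1) γ`; dividing that column by it gives the first
  -- column of `A`.
  set m : ℤ := (Int.gcd (D * γ 0 0) (γ 1 0) : ℤ) with hm
  have hm0 : 0 < m := by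
    have : Int.gcd (D * γ 0 0) (γ 1 0) ≠ 0 := by
      rw [Ne, Int.gcd_eq_zero_iff]
      rintro ⟨h1, h2⟩
      have h3 : γ 0 0 = 0 := by
        rcases mul_eq_zero.1 h1 with h | h
        · omega
        · exact h
      rw [h3, h2] at hdet
      simp at hdet
    rw [hm]
    exact_mod_cast Nat.pos_of_ne_zero this
  obtain ⟨p, hp⟩ : m ∣ D * γ 0 0 := Int.gcd_dvd_left ..
  obtain ⟨q, hq⟩ : m ∣ γ 1 0 := Int.gcd_dvd_right ..
  have hcop : IsCoprime p q := by
    obtain ⟨u, v, huv⟩ : ∃ u v, m = D * γ 0 0 * u + γ 1 0 * v :=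
      ⟨_, _, Int.gcd_eq_gcd_ab _ _⟩
    refine ⟨u, v, mul_left_cancel₀ hm0.ne' ?_⟩
    rw [hp, hq] at huv
    linear_combination -huv
  obtain ⟨A, hA0, hA1⟩ := hcop.exists_SL2_col 0
  have hAdet : A 0 0 * A 1 1 - A 0 1 * A 1 0 = 1 := by
    have := A.det_coe
    rwa [Matrix.det_fin_two] at this
  rw [hA0, hA1] at hAdet
  -- `b` and `d` form the second column of `A⁻¹ diag(D, 1) γ`; comparing determinants gives `m d =
  -- D`.
  set b : ℤ := A 1 1 * (D * γ 0 1) - A 0 1 * γ 1 1 with hb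
  set d : ℤ := -q * (D * γ 0 1) + p * γ 1 1 with hd
  have hmd : m * d = D := by
    rw [hd]; linear_combination (-γ 1 1) * hp + D * γ 0 1 * hq + D * hdet
  have hd0 : 0 < d := by
    have : 0 < m * d := by rw [hmd]; exact hDZ
    exact pos_of_mul_pos_right this hm0.le
  have e01 : p * b + A 0 1 * d = D * γ 0 1 := by
    rw [hb, hd]; linear_combination (D * γ 0 1) * hAdet
  have e11 : q * b + A 1 1 * d = γ 1 1 := by
    rw [hb, hd]; linear_combination γ 1 1 * hAdet
  have hdC : (d : ℂ) ≠ 0 := by exact_mod_cast hd0.ne'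
  have hdR : (0 : ℝ) < d := by exact_mod_cast hd0
  have hmR : (0 : ℝ) < m := by exact_mod_cast hm0
  have him : ∀ τ : ℍ, (((m : ℂ) * τ + b) / d).im = m * τ.im / d := by
    intro τ
    have h1 : ((m : ℂ) * τ + b) / d = (((m / d : ℝ)) : ℂ) * τ + ((b / d : ℝ) : ℂ) := by
      push_cast; ring
    rw [h1, Complex.add_im, Complex.im_ofReal_mul, Complex.ofReal_im, add_zero]
    show (m / d : ℝ) * τ.im = _
    ring
  let σ : ℍ → ℍ := fun τ => ⟨((m : ℂ) * τ + b) / d, by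
    rw [him]; have := τ.im_pos; positivity⟩
  have hσ : ∀ τ : ℍ, (σ τ : ℂ) = ((m : ℂ) * τ + b) / d := fun τ => rfl
  have hj : ∀ τ : ℍ, jac γ τ = jac A (σ τ) * d := by
    intro τ
    rw [jac, jac, hσ, hA1, ← e11, hq]
    push_cast
    field_simp
    ring
  have hs : ∀ τ : ℍ, dilate hD (γ • τ) = A • σ τ := by
    intro τ
    apply UpperHalfPlane.ext
    have h1 := jac_ne_zero A (σ τ)
    rw [coe_smul_eq, coe_dilate, coe_smul_eq, hj, hA0]
    generalize jac A (σ τ) = J at h1 ⊢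
    rw [hσ]
    have hp' : (D : ℂ) * γ 0 0 = m * p := by exact_mod_cast hp
    have h01' : (p : ℂ) * b + A 0 1 * d = D * γ 0 1 := by exact_mod_cast e01
    field_simp
    linear_combination (τ : ℂ) * hp' - h01'
  have hval : ∀ τ : ℍ, ellSlash κ γ (fun τ => g (dilate hD τ)) τ =
      (d : ℂ) ^ (-κ) * ellSlash κ A g (σ τ) := by
    intro τ
    rw [ellSlash, ellSlash, hs, hj, mul_zpow]; ring
  obtain ⟨M, Y, hMY⟩ := isBoundedAtImInfty_iff.1 (hg A)
  refine isBoundedAtImInfty_iff.2 ⟨‖(d : ℂ) ^ (-κ)‖ * M, Y * d / m, fun τ hτ => ?_⟩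
  rw [hval, norm_mul]
  refine mul_le_mul_of_nonneg_left (hMY _ ?_) (norm_nonneg _)
  show Y ≤ (((m : ℂ) * τ + b) / d).im
  rw [him, le_div_iff₀ hdR]
  rw [div_le_iff₀ hmR] at hτ
  linarith

end Elliptic

/-! ### The map to the plus space -/

section Main

variable {K : Type*} [Field K] {ι : K →+* ℂ} {D N : ℕ} {k : ℤ} {φ : ℍ → ℂ → ℂ → ℂ}

/-- `(1 0; N 1)`. -/
def lowerMat (N : ℤ) : SL(2, ℤ) := ⟨!![1, 0; N, 1], by simp⟩

lemma coe_lowerMat (N : ℤ) : (lowerMat N : Matrix (Fin 2) (Fin 2) ℤ) = !![1, 0; N, 1] := rfl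

/-- `W_D = (1 0; N 1) T^y diag(D, 1)` separates a modular transformation from a dilation. -/
lemma toElliptic_eq (hD : 0 < D) (y : ℤ) (φ : ℍ → ℂ → ℂ → ℂ) : toElliptic ι D k N y φ =
    fun τ => ellSlash (k - 1) (lowerMat N * ModularGroup.T ^ y) (thetaComponent ι D φ 0)
      (dilate hD τ) := by
  funext τ
  have h00 : matW D N y 0 0 = D := by simp [matW, Matrix.mul_apply]
  have h01 : matW D N y 0 1 = y := by simp [matW, Matrix.mul_apply]
  have h10 : matW D N y 1 0 = N * D := by simp [matW, Matrix.mul_apply]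
  have h11 : matW D N y 1 1 = N * y + 1 := by simp [matW, Matrix.mul_apply]
  set A := lowerMat N * ModularGroup.T ^ y with hA
  have a00 : A 0 0 = 1 := by
    rw [hA, mul_apply_SL, coe_lowerMat, ModularGroup.coe_T_zpow]; simp
  have a01 : A 0 1 = y := by
    rw [hA, mul_apply_SL, coe_lowerMat, ModularGroup.coe_T_zpow]; simp
  have a10 : A 1 0 = N := by
    rw [hA, mul_apply_SL, coe_lowerMat, ModularGroup.coe_T_zpow]; simp
  have a11 : A 1 1 = N * y + 1 := by
    rw [hA, mul_apply_SL, coe_lowerMat, ModularGroup.coe_T_zpow]; simp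
  have hj : jac A (dilate hD τ) = (matW D N y 1 0 : ℂ) * τ + matW D N y 1 1 := by
    rw [jac, a10, a11, h10, h11, coe_dilate]; push_cast; ring
  rw [toElliptic, slashInt, ellSlash, hj]
  congr 2
  rw [← ofComplex_apply (A • dilate hD τ)]
  congr 1
  rw [coe_smul_eq, hj, coe_dilate, a00, a01, h00, h01]
  push_cast
  ring

/-- Moving `γ` past the dilation gives `γ'`, and conjugating `γ'` by `W = (1 0; N 1) T^y` gives `B`
in `Γ₀(DN)`, under which `f₀` transforms by `χ`. -/
lemma toElliptic_slash (h : IsQuadLattice ι D) (hφ : φ ∈ specialJacobi ι D k N) {y : ℤ}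
    (hy : (N : ℤ) * y ≡ -1 [ZMOD D]) {γ : SL(2, ℤ)}
    (hγ : γ ∈ CongruenceSubgroup.Gamma0 (D * N)) :
    toElliptic ι D k N y φ ∣[k - 1] γ = (chi D (γ 1 1) : ℂ) • toElliptic ι D k N y φ := by
  have : Finite (discGroup ι D) := h.finite
  have : Fintype (discGroup ι D) := Fintype.ofFinite _
  rw [CongruenceSubgroup.Gamma0_mem, ZMod.intCast_zmod_eq_zero_iff_dvd] at hγ
  obtain ⟨x, hx⟩ := hγ
  push_cast at hx
  have hdet : γ 0 0 * γ 1 1 - γ 0 1 * γ 1 0 = 1 := by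
    have := γ.det_coe
    rwa [Matrix.det_fin_two] at this
  let γ' : SL(2, ℤ) := ⟨!![γ 0 0, D * γ 0 1; N * x, γ 1 1], by
    rw [Matrix.det_fin_two_of]
    rw [hx] at hdet
    linear_combination hdet⟩
  have g00 : γ' 0 0 = γ 0 0 := rfl
  have g01 : γ' 0 1 = D * γ 0 1 := rfl
  have g10 : γ' 1 0 = N * x := rfl
  have g11 : γ' 1 1 = γ 1 1 := rfl
  set W := lowerMat N * ModularGroup.T ^ y with hW
  have w00 : W 0 0 = 1 := by
    rw [hW, mul_apply_SL, coe_lowerMat, ModularGroup.coe_T_zpow]; simp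
  have w01 : W 0 1 = y := by
    rw [hW, mul_apply_SL, coe_lowerMat, ModularGroup.coe_T_zpow]; simp
  have w10 : W 1 0 = N := by
    rw [hW, mul_apply_SL, coe_lowerMat, ModularGroup.coe_T_zpow]; simp
  have w11 : W 1 1 = N * y + 1 := by
    rw [hW, mul_apply_SL, coe_lowerMat, ModularGroup.coe_T_zpow]; simp
  have hinv : ((W⁻¹ : SL(2, ℤ)) : Matrix (Fin 2) (Fin 2) ℤ) = !![N * y + 1, -y; -N, 1] := by
    rw [Matrix.SpecialLinearGroup.coe_inv, Matrix.adjugate_fin_two, w00, w01, w10, w11]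
  obtain ⟨B, hB⟩ : ∃ B, B = W * γ' * W⁻¹ := ⟨_, rfl⟩
  have hBW : W * γ' = B * W := by rw [hB]; group
  obtain ⟨s, hs⟩ := hy.symm.dvd
  have hs' : (N : ℤ) * y = D * s - 1 := by linarith
  have hW10 : (W * γ') 1 0 = N * γ 0 0 + (N * y + 1) * (N * x) := by
    rw [mul_apply_SL, w10, w11, g00, g10]
  have hW11 : (W * γ') 1 1 = N * (D * γ 0 1) + (N * y + 1) * γ 1 1 := by
    rw [mul_apply_SL, w10, w11, g01, g11]
  have b10 : B 1 0 = N * D * (s * (γ 0 0 + D * s * x - γ 1 1) - N * γ 0 1) := by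
    rw [hB, mul_apply_SL, hW10, hW11, hinv]
    simp only [Matrix.of_apply, Matrix.cons_val_zero, Matrix.cons_val_one, hs']
    simp
    ring
  have b11 : B 1 1 = γ 0 0 + D * (-s * γ 0 0 - y * s * N * x + N * γ 0 1 + s * γ 1 1) := by
    rw [hB, mul_apply_SL, hW10, hW11, hinv]
    simp only [Matrix.of_apply, Matrix.cons_val_zero, Matrix.cons_val_one]
    simp
    linear_combination (-γ 0 0 + γ 1 1 - N * x * y) * hs'
  -- Modulo `D` the lower right entry of `B` is the upper left entry of `γ`, the inverse of its
  -- lower right one; `χ` takes values `±1` on units, so the two values agree.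
  have hchi : chi D (B 1 1) = chi D (γ 1 1) := by
    rw [chi_congr h.mod_four (b := γ 0 0)]
    · refine chi_eq_of_mul_modEq_one h.mod_four ?_
      refine (Int.modEq_iff_dvd.2 ⟨-(γ 0 1 * N * x), ?_⟩)
      rw [hx] at hdet
      linear_combination -hdet
    · refine (Int.modEq_iff_dvd.2 ?_).symm
      rw [b11]
      exact ⟨-s * γ 0 0 - y * s * N * x + N * γ 0 1 + s * γ 1 1, by ring⟩
  rw [slash_eq_ellSlash, toElliptic_eq h.pos]
  funext τ
  rw [ellSlash_dilate h.pos (k - 1) (γ' := γ') _ g00 g01 (by rw [hx, g10]; ring) g11,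
    ← ellSlash_mul, hBW, ellSlash_mul]
  have h1 : ellSlash (k - 1) B (thetaComponent ι D φ 0) =
      fun τ => (chi D (γ 1 1) : ℂ) * thetaComponent ι D φ 0 τ := by
    funext τ
    rw [ellSlash_thetaComponent_zero h hφ (by rw [b10, mul_assoc]; exact ⟨_, rfl⟩)
      (by rw [b10]; exact ⟨N * (s * (γ 0 0 + D * s * x - γ 1 1) - N * γ 0 1), by ring⟩), hchi]
  rw [h1]
  simp only [ellSlash, Pi.smul_apply, smul_eq_mul]
  ring

lemma toElliptic_isBounded (h : IsQuadLattice ι D) (hφ : φ ∈ specialJacobi ι D k N) (y : ℤ)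
    (γ : SL(2, ℤ)) : IsBoundedAtImInfty (toElliptic ι D k N y φ ∣[k - 1] γ) := by
  have : Finite (discGroup ι D) := h.finite
  have : Fintype (discGroup ι D) := Fintype.ofFinite _
  rw [slash_eq_ellSlash, toElliptic_eq h.pos]
  refine isBounded_ellSlash_dilate h.pos _ (fun A => ?_) γ
  rw [← ellSlash_mul]
  exact isBounded_ellSlash_thetaComponent h hφ _ _

/-- Translation by `y` multiplies the `n`-th term of `f_v` by `e[ny/D]`, which cancels `e[y|v|²]`
because `|v|² + n/D` is an integer. What remains is the number of classes occurring at `n`. -/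
lemma toElliptic_hasSum (h : IsQuadLattice ι D) (hφ : φ ∈ specialJacobi ι D k N) {y : ℤ}
    (hy : (N : ℤ) * y ≡ -1 [ZMOD D]) (τ : ℍ) :
    HasSum (fun n : ℕ => (Complex.I * ((aD ι D n : ℂ) / (Real.sqrt D : ℝ)) *
      (chi D N : ℂ) * alphaStar ι D φ n) * e (n * τ)) (toElliptic ι D k N y φ τ) := by
  classical
  have : Finite (discGroup ι D) := h.finite
  have : Fintype (discGroup ι D) := Fintype.ofFinite _
  have hDC : (D : ℂ) ≠ 0 := by exact_mod_cast h.pos.ne'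
  have hj : jac (ModularGroup.T ^ y) (dilate h.pos τ) = 1 := by simp [jac, ModularGroup.coe_T_zpow]
  rw [toElliptic_eq h.pos]
  simp only
  rw [ellSlash_mul, ellSlash, hj, one_zpow, one_mul, ellSlash_lower h hφ (coe_lowerMat _) hy]
  set τ' := ModularGroup.T ^ y • dilate h.pos τ with hτ'
  have hτ : (τ' : ℂ) = D * τ + y := by rw [hτ', T_zpow_smul, coe_dilate]
  have hv : ∀ v : discGroup ι D, HasSum (fun n : ℕ => if NormCong ι D v n then
      alphaStar ι D φ n * e (n * τ) else 0) (qe v ^ y * thetaComponent ι D φ v τ') := by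
    intro v
    obtain ⟨t, rfl⟩ := QuotientAddGroup.mk_surjective v
    refine ((summable_thetaComponent h hφ (cls t) τ').mul_left (qe (cls t) ^ y)).congr_fun
      fun n => ?_
    by_cases hn : NormCong ι D (cls t) n
    · obtain ⟨m, hm⟩ := (normCong_cls_iff h t n).1 hn
      simp only [if_pos hn]
      have hmC : (D : ℂ) * Complex.normSq t + n = D * m := by exact_mod_cast hm
      have hq : qe (cls t) ^ y = e (y * Complex.normSq t) := by
        rw [qe_cls h, e, e, ← Complex.exp_int_mul]
        congr 1
        ring
      rw [hq, hτ, mul_left_comm, ← e_add]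
      have : (y : ℂ) * Complex.normSq (t : ℂ) + n * (D * τ + y) / D = n * τ + ((y * m : ℤ) : ℂ) := by
        push_cast
        field_simp
        linear_combination (y : ℂ) * hmC
      rw [this, e_add, e_int, mul_one]
    · simp [if_neg hn]
  have h1 := (hasSum_sum fun v (_ : v ∈ Finset.univ) => hv v).mul_left
    ((chi D N : ℂ) * (Complex.I / ((Real.sqrt D : ℝ) : ℂ)))
  refine h1.congr_fun fun n => ?_
  rw [← Finset.sum_filter, Finset.sum_const, nsmul_eq_mul]
  have : aD ι D n = (Finset.univ.filter fun v : discGroup ι D => NormCong ι D v n).card := by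
    rw [aD, Nat.card_eq_fintype_card, Fintype.card_subtype]
  rw [this]
  ring

lemma ellCoeff_toElliptic (h : IsQuadLattice ι D) (hφ : φ ∈ specialJacobi ι D k N) {y : ℤ}
    (hy : (N : ℤ) * y ≡ -1 [ZMOD D]) (n : ℕ) :
    ellCoeff (toElliptic ι D k N y φ) n = Complex.I * ((aD ι D n : ℂ) / (Real.sqrt D : ℝ)) *
      (chi D N : ℂ) * alphaStar ι D φ n :=
  coeff_of_hasSum (toElliptic_hasSum h hφ hy) n

/-- A pair `(ℓ, t)` realizing `n` would give a class counted by `a_D(n)`; without one, `alphaStar`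
is its default value. -/
lemma alphaStar_eq_zero (h : IsQuadLattice ι D) {n : ℕ} (hn : aD ι D n = 0) :
    alphaStar ι D φ n = 0 := by
  have : Finite (discGroup ι D) := h.finite
  rw [alphaStar, dif_neg]
  rintro ⟨⟨ℓ, t⟩, hp⟩
  rw [aD, Nat.card_eq_zero] at hn
  rcases hn with hn | hn
  · refine hn.elim ⟨cls t, (normCong_cls_iff h t n).2 ⟨ℓ, ?_⟩⟩
    push_cast
    rw [← hp]
    ring
  · exact hn.not_finite inferInstance

lemma toElliptic_mapsTo (h : IsQuadLattice ι D) {y : ℤ} (hy : (N : ℤ) * y ≡ -1 [ZMOD D]) :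
    Set.MapsTo (toElliptic ι D k N y) (specialJacobi ι D k N) (plusForms ι D (k - 1) N) := by
  intro φ hφ
  refine ⟨⟨mdiff_of_hasSum (toElliptic_hasSum h hφ hy), fun γ hγ => toElliptic_slash h hφ hy hγ,
    toElliptic_isBounded h hφ y⟩, fun n hn => ?_⟩
  rw [ellCoeff_toElliptic h hφ hy, hn]
  simp

/-- Where `a_D(n) ≠ 0` the coefficient of `f` determines `α*(n)`, and elsewhere `α*(n) = 0`; the
theta decomposition then recovers `φ`. -/
lemma toElliptic_injOn (h : IsQuadLattice ι D) {y : ℤ} (hy : (N : ℤ) * y ≡ -1 [ZMOD D]) :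
    Set.InjOn (toElliptic ι D k N y) (specialJacobi ι D k N) := by
  intro φ hφ φ' hφ' heq
  have : Finite (discGroup ι D) := h.finite
  have : Fintype (discGroup ι D) := Fintype.ofFinite _
  have hchi : (chi D N : ℂ) ≠ 0 := by
    -- `-y` is the inverse of `N` modulo `D`, hence `χ(N)² = 1`.
    have h1 : (N : ℤ) * (-y) ≡ 1 [ZMOD D] := by simpa using hy.neg
    have h2 := chi_sq_eq_one h.mod_four h1
    intro h0
    have h3 : chi D N = 0 := by exact_mod_cast h0
    rw [h3] at h2
    simp at h2
  have hα : ∀ n, alphaStar ι D φ n = alphaStar ι D φ' n := by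
    intro n
    by_cases hn : aD ι D n = 0
    · rw [alphaStar_eq_zero h hn, alphaStar_eq_zero h hn]
    · have h1 := ellCoeff_toElliptic h hφ hy n
      rw [heq, ellCoeff_toElliptic h hφ' hy n] at h1
      have hn' : (aD ι D n : ℂ) ≠ 0 := by exact_mod_cast hn
      refine (mul_left_cancel₀ (mul_ne_zero (mul_ne_zero Complex.I_ne_zero
        (div_ne_zero hn' (sqrtC_ne_zero h.pos))) hchi) h1).symm
  funext τ z w
  rw [theta_decomposition h hφ, theta_decomposition h hφ']
  refine Finset.sum_congr rfl fun q _ => ?_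
  simp only [thetaComponent, hα]

end Main

end HermitianJacobi

end

theorem proposition2p5 {K : Type*} [Field K] [NumberField K] (ι : K →+* ℂ) (D N : ℕ)
    (hquad : Module.finrank ℚ K = 2) (hdisc : NumberField.discr K = -(D : ℤ))
    (k : ℤ) (hk : (Nat.card (NumberField.RingOfIntegers K)ˣ : ℤ) ∣ k)
    (hDN : Nat.Coprime D N) (y : ℤ) (hy : (N : ℤ) * y ≡ -1 [ZMOD (D : ℤ)]) :
    (∀ φ ∈ HermitianJacobi.specialJacobi ι D k N,
      (∀ (τ : UpperHalfPlane) (z w : ℂ),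
        φ τ z w = ∑ᶠ q : HermitianJacobi.discGroup ι D,
          HermitianJacobi.thetaComponent ι D φ q τ * HermitianJacobi.theta ι D q τ z w)) ∧
    Set.MapsTo (HermitianJacobi.toElliptic ι D k N y)
      (HermitianJacobi.specialJacobi ι D k N) (HermitianJacobi.plusForms ι D (k - 1) N) ∧
    Set.InjOn (HermitianJacobi.toElliptic ι D k N y) (HermitianJacobi.specialJacobi ι D k N) ∧
    ∀ φ ∈ HermitianJacobi.specialJacobi ι D k N, ∀ ℓ : ℕ,
      HermitianJacobi.ellCoeff (HermitianJacobi.toElliptic ι D k N y φ) ℓ =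
        Complex.I * ((HermitianJacobi.aD ι D ℓ : ℂ) / (Real.sqrt D : ℝ)) *
          (HermitianJacobi.chi D N : ℂ) * HermitianJacobi.alphaStar ι D φ ℓ := by
  have h := HermitianJacobi.isQuadLattice hquad ι D hdisc
  have : Finite (HermitianJacobi.discGroup ι D) := h.finite
  have : Fintype (HermitianJacobi.discGroup ι D) := Fintype.ofFinite _
  refine ⟨fun φ hφ τ z w => ?_, HermitianJacobi.toElliptic_mapsTo h hy,
    HermitianJacobi.toElliptic_injOn h hy,
    fun φ hφ ℓ => HermitianJacobi.ellCoeff_toElliptic h hφ hy ℓ⟩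
  rw [finsum_eq_sum_of_fintype]
  exact HermitianJacobi.theta_decomposition h hφ τ z w
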